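/- **Setting.** Let $(\Omega,\Sigma,P)$ be a probability space. For each $s\in\Omega$ let $g(\cdot,s),h(\cdot,s):\mathbb R^n\to\mathbb R$ be continuous convex functions such that, for each $x$, $g(x,\cdot)$ and $h(x,\cdot)$ are measurable with finite expectations $G(x)=\mathbb E_s[g(x,s)]$ and $H(x)=\mathbb E_s[h(x,s)]$. Let $r_1,r_2:\mathbb R^n\to\mathbb R\cup\{+\infty\}$ be lower semicontinuous convex functions such that $r=r_1-r_2$ (with $+\infty-(+\infty)=+\infty$) is lower semicontinuous. Consider the stochastic DC program of minimizing $f(x)=\mathbb E_s[g(x,s)-h(x,s)]+r(x)$ over $\mathbb R^n$. A point $x$ is called *critical* if $0\in\Gamma(x):=\partial G(x)+\partial r_1(x)-\partial H(x)-\partial r_2(x)$, where $\partial$ is the subdifferential of convex analysis (empty outside the effective domain). **Algorithms.** Let $(\alpha_k)_{k\ge 0}$ be positive reals and $A_k=\sum_{i=0}^k\alpha_i$. Algorithm 1 (SDCA1) starts from a point $x^0$ with $r_1(x^0)<+\infty$. At step $k\ge 0$ it draws a sample $s^k$ of law $P$, independent of all samples, iterates and subgradients obtained before ($s^i,z^i,u^i$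 for $i<k$ and $x^i$ for $i\le k$), chooses $z^k\in\partial h(\cdot,s^k)(x^k)$ and $u^k\in\partial r_2(x^k)$, sets $y^k=\frac1{A_k}\sum_{i=0}^k\alpha_iz^i$ and $w^k=\frac1{A_k}\sum_{i=0}^k\alpha_iu^i$, and takes for $x^{k+1}$ a minimizer over $\mathbb R^n$ of $G(x)+r_1(x)-\langle y^k+w^k,x\rangle$. Algorithm 2 (SDCA2) is the same with $G$ replaced by $G_k(x)=\frac1{A_k}\sum_{i=0}^k\alpha_ig(x,s^i)$. All $s^k,x^k,z^k,u^k$ are random variables on a common probability space. **Assumptions.** A family $\varphi(\cdot,s)$, $s\in\Omega$, of functions on $\mathbb R^n$ is said to satisfy (B) if, for every $x$, $\sup_{s}|\varphi(x,s)|<\infty$ and for every $\varepsilon>0$ there is $\delta>0$ with $|\varphi(z,s)-\varphi(x,s)|\le\varepsilon$ for all $s\in\Omega$ and all $z$ with $\|z-x\|<\delta$. (A1): $h$ satisfies (B). (A2): $g$ and $h$ satisfy (B). Let $\rho(\varphi)\in[0,\infty]$ be the supremum of all $\rho\ge0$ such that $\varphi(\lambda x+(1-\lambda)y)\le\lambda\varphi(x)+(1-\lambda)\varphi(y)-\frac\rho2\lambda(1-\lambda)\|x-y\|^2$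 for all $x,y$ and $\lambda\in[0,1]$. Put $\beta_k=A_k/(\sum_{i=0}^k\alpha_i^2)^{1/2}$. **Theorem.** Suppose that $\sum_k\alpha_k=\infty$, that for some $N,\gamma>0$ $$\frac{\sum_{i=0}^k\alpha_i^2}{A_k^2}\le\frac N{k^\gamma}\quad(k\ge1),\qquad \sum_{k=1}^\infty\frac{\alpha_k\bigl(1+\sqrt{\ln\beta_{k-1}}\bigr)}{\beta_{k-1}A_k}<\infty,$$ and that either $\gamma>1/2$ or $A_l/A_k\to1$ as $k,l\to\infty$ with $l/k\to1$. Let $(x^k)$ be generated by Algorithm 1 under (A1), or by Algorithm 2 under (A2). Suppose that $\inf_{s\in\Omega}\rho(h(\cdot,s))+\rho(r_2)>0$, that $\inf f$ is finite, and that almost surely $\limsup_k\|x^k\|<\infty$ and $\limsup_k\|u^k\|<\infty$. Then: (i) There is a subsequence $(x^{l_k})$ (with indices $l_0<l_1<\cdots$ that do not depend on the outcome) such that, almost surely, every limit point of $(x^{l_k})$ is a critical point. (ii) Let $C$ be a compact set that almost surely contains all $x^k$, and suppose that $r_2$ and all $h(\cdot,s)$, $s\in\Omega$ (for Algorithm 2,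 also all $g(\cdot,s)$) are differentiable at the points of $C$ with gradients that are Lipschitz on $C$ with a common modulus $L/2$. Let $d_k=\min_{1\le i\le k}\mathbb E\bigl[d(0,\Gamma(x^i))\bigr]$. Then $d_k$ is finite for $k\ge1$, and $$d_k=O\Bigl(1\Big/\sqrt{\textstyle\sum_{i=0}^k\alpha_i/A_i}\Bigr)\quad\text{as }k\to\infty .$$ In particular, $d_k=O(1/\sqrt{\ln k})$ if $\alpha_k=1$ for all $k$. -/

import Mathlib

open MeasureTheory ProbabilityTheory Filter Topology Set
open scoped ENNReal NNReal Pointwise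

noncomputable section

namespace SDCA

/-! ### Convex analysis for functions `ℝⁿ → ℝ ∪ {+∞}`

Extended valued functions are modelled as `EReal`-valued functions that never take the value `⊥`. -/

/-- `f` is `ρ`-convex:
`f (t x + (1-t) y) ≤ t f x + (1-t) f y - (ρ/2) t (1-t) ‖x-y‖²` for all `x, y` and `t ∈ [0,1]`.
The case `ρ = 0` is convexity. -/
def RhoConvex {n : ℕ} (ρ : ℝ≥0) (f : EuclideanSpace ℝ (Fin n) → EReal) : Prop :=
  ∀ x y : EuclideanSpace ℝ (Fin n), ∀ t ∈ Icc (0 : ℝ) 1,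
    f (t • x + (1 - t) • y) + ((ρ / 2 * t * (1 - t) * ‖x - y‖ ^ 2 : ℝ) : EReal)
      ≤ (t : EReal) * f x + ((1 - t : ℝ) : EReal) * f y

/-- The strong convexity modulus `ρ(f)`, the supremum (in `[0, ∞]`) of all `ρ ≥ 0` such that `f`
is `ρ`-convex. -/
def strongConvexityModulus {n : ℕ} (f : EuclideanSpace ℝ (Fin n) → EReal) : ℝ≥0∞ :=
  ⨆ (ρ : ℝ≥0) (_ : RhoConvex ρ f), (ρ : ℝ≥0∞)

/-- The subdifferential of convex analysis; it is empty outside the effective domain of `f`. -/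
def subdiff {n : ℕ} (f : EuclideanSpace ℝ (Fin n) → EReal) (x : EuclideanSpace ℝ (Fin n)) :
    Set (EuclideanSpace ℝ (Fin n)) :=
  {v | f x < ⊤ ∧ ∀ y, f x + ((inner ℝ v (y - x) : ℝ) : EReal) ≤ f y}

/-! ### The stochastic DC program -/

/-- The data of a stochastic DC program
`min f(x) = E_s[g(x,s) - h(x,s)] + r₁(x) - r₂(x)` over `ℝⁿ`, with samples `s` of law `P` on `Ω`. -/
structure Program (n : ℕ) {Ω : Type*} [MeasurableSpace Ω] (P : Measure Ω) where
  g : EuclideanSpace ℝ (Fin n) → Ω → ℝ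
  h : EuclideanSpace ℝ (Fin n) → Ω → ℝ
  r₁ : EuclideanSpace ℝ (Fin n) → EReal
  r₂ : EuclideanSpace ℝ (Fin n) → EReal
  g_convex : ∀ s, ConvexOn ℝ univ (fun x => g x s)
  g_continuous : ∀ s, Continuous (fun x => g x s)
  g_measurable : ∀ x, Measurable (g x)
  g_integrable : ∀ x, Integrable (g x) P
  h_convex : ∀ s, ConvexOn ℝ univ (fun x => h x s)
  h_continuous : ∀ s, Continuous (fun x => h x s)
  h_measurable : ∀ x, Measurable (h x)
  h_integrable : ∀ x, Integrable (h x) P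
  r₁_ne_bot : ∀ x, r₁ x ≠ ⊥
  r₁_convex : RhoConvex 0 r₁
  r₁_lsc : LowerSemicontinuous r₁
  r₂_ne_bot : ∀ x, r₂ x ≠ ⊥
  r₂_convex : RhoConvex 0 r₂
  r₂_lsc : LowerSemicontinuous r₂
  /-- `r = r₁ - r₂`, with the convention `(+∞) - (+∞) = +∞`, is lower semicontinuous. -/
  r_lsc : LowerSemicontinuous (fun x => if r₁ x = ⊤ then (⊤ : EReal) else r₁ x - r₂ x)

namespace Program

variable {n : ℕ} {Ω : Type*} [MeasurableSpace Ω] {P : Measure Ω}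

/-- `G(x) = E_s[g(x,s)]`. -/
def G (p : Program n P) (x : EuclideanSpace ℝ (Fin n)) : ℝ := ∫ s, p.g x s ∂P

/-- `H(x) = E_s[h(x,s)]`. -/
def H (p : Program n P) (x : EuclideanSpace ℝ (Fin n)) : ℝ := ∫ s, p.h x s ∂P

/-- `r = r₁ - r₂`, with the convention `(+∞) - (+∞) = +∞`
(the convention of `EReal` would be `⊤ - ⊤ = ⊥`). -/
def r (p : Program n P) (x : EuclideanSpace ℝ (Fin n)) : EReal :=
  if p.r₁ x = ⊤ then ⊤ else p.r₁ x - p.r₂ x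

/-- The objective `f(x) = E_s[g(x,s) - h(x,s)] + r(x)`. -/
def f (p : Program n P) (x : EuclideanSpace ℝ (Fin n)) : EReal :=
  ((∫ s, (p.g x s - p.h x s) ∂P : ℝ) : EReal) + p.r x

/-- The set `∂G(x) + ∂r₁(x) - ∂H(x) - ∂r₂(x)`. -/
def criticalitySet (p : Program n P) (x : EuclideanSpace ℝ (Fin n)) :
    Set (EuclideanSpace ℝ (Fin n)) :=
  subdiff (fun y => (p.G y : EReal)) x + subdiff p.r₁ x
    - subdiff (fun y => (p.H y : EReal)) x - subdiff p.r₂ x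

/-- DC criticality: `0 ∈ ∂G(x) + ∂r₁(x) - ∂H(x) - ∂r₂(x)`. -/
def IsCritical (p : Program n P) (x : EuclideanSpace ℝ (Fin n)) : Prop :=
  (0 : EuclideanSpace ℝ (Fin n)) ∈ p.criticalitySet x

/-- The distance to criticality `d(0, ∂G(x) + ∂r₁(x) - ∂H(x) - ∂r₂(x))` in `[0, ∞]`
(`∞` when the set is empty). -/
def distToCriticality (p : Program n P) (x : EuclideanSpace ℝ (Fin n)) : ℝ≥0∞ :=
  Metric.infEDist 0 (p.criticalitySet x)

end Program

/-! ### The weights -/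

/-- `A k = α 0 + ... + α k`. -/
def weightSum (α : ℕ → ℝ) (k : ℕ) : ℝ := ∑ i ∈ Finset.range (k + 1), α i

/-- `β k = (∑_{i ≤ k} α i) / (∑_{i ≤ k} (α i)²)^{1/2}`. -/
def beta (α : ℕ → ℝ) (k : ℕ) : ℝ :=
  weightSum α k / √(∑ i ∈ Finset.range (k + 1), α i ^ 2)

/-- `A l / A k → 1` as `k, l → ∞` with `l / k → 1`. -/
def QuotientLimit (α : ℕ → ℝ) : Prop :=
  Tendsto (fun q : ℕ × ℕ => weightSum α q.2 / weightSum α q.1)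
    (atTop ⊓ comap (fun q : ℕ × ℕ => (q.2 : ℝ) / (q.1 : ℝ)) (𝓝 1)) (𝓝 1)

/-- The conditions imposed on the weights. The second series is indexed by `k + 1`, `k ≥ 0`. -/
structure AdmissibleWeights (α : ℕ → ℝ) : Prop where
  pos : ∀ k, 0 < α k
  diverges : Tendsto (weightSum α) atTop atTop
  ratio_and_limit : ∃ N γ : ℝ, 0 < N ∧ 0 < γ ∧
    (∀ k : ℕ, 1 ≤ k →
      (∑ i ∈ Finset.range (k + 1), α i ^ 2) / weightSum α k ^ 2 ≤ N / (k : ℝ) ^ γ) ∧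
    (1 / 2 < γ ∨ QuotientLimit α)
  summable : Summable fun k : ℕ =>
    α (k + 1) * (1 + √(Real.log (beta α k))) / (beta α k * weightSum α (k + 1))

/-- The weighted average `(1 / A k) ∑_{i ≤ k} α i • v i`. -/
def weightedAvg {V : Type*} [AddCommMonoid V] [Module ℝ V] (α : ℕ → ℝ) (v : ℕ → V) (k : ℕ) : V :=
  (weightSum α k)⁻¹ • ∑ i ∈ Finset.range (k + 1), α i • v i

/-! ### The two algorithms -/

/-- The two stochastic DC algorithms: `sdca1` keeps the first DC component `G`, `sdca2` replaces it
by its sample approximation. -/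
inductive Variant
  | sdca1
  | sdca2

section Algorithms

variable {n : ℕ} {Ω : Type*} [MeasurableSpace Ω] {P : Measure Ω}

/-- A family `φ(·, s)`, `s ∈ Ω`, that is pointwise bounded in `s` and equicontinuous at each
point. -/
def BoundedEquicontinuous (φ : EuclideanSpace ℝ (Fin n) → Ω → ℝ) : Prop :=
  (∀ x, ∃ M : ℝ, ∀ s, |φ x s| ≤ M) ∧
    ∀ x, ∀ ε > 0, ∃ δ > 0, ∀ z ∈ Metric.ball x δ, ∀ s, |φ z s - φ x s| ≤ ε

/-- Assumption (A1) (on `h`) for the first algorithm, (A2) (on `g` and `h`) for the second. -/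
def BasicAssumption (p : Program n P) : Variant → Prop
  | .sdca1 => BoundedEquicontinuous p.h
  | .sdca2 => BoundedEquicontinuous p.g ∧ BoundedEquicontinuous p.h

/-- The first DC component used at step `k`, given the samples `s 0, s 1, ...`:
`G` for the first algorithm, `G_k = (1 / A k) ∑_{i ≤ k} α i g(·, s i)` for the second. -/
def firstComponent (p : Program n P) (α : ℕ → ℝ) (s : ℕ → Ω) (k : ℕ)
    (x : EuclideanSpace ℝ (Fin n)) : Variant → ℝ
  | .sdca1 => p.G x
  | .sdca2 => weightedAvg α (fun i => p.g x (s i)) k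

/-- The past before the `k`-th sample is drawn, the `σ`-algebra generated by
`s 0, …, s (k-1), x 0, …, x k, z 0, …, z (k-1), u 0, …, u (k-1)`. -/
@[reducible] def past {Θ : Type*} (s : ℕ → Θ → Ω) (x z u : ℕ → Θ → EuclideanSpace ℝ (Fin n)) (k : ℕ) :
    MeasurableSpace Θ :=
  (⨆ (i : ℕ) (_ : i < k), MeasurableSpace.comap (s i) inferInstance) ⊔
  (⨆ (i : ℕ) (_ : i ≤ k), MeasurableSpace.comap (x i) inferInstance) ⊔
  (⨆ (i : ℕ) (_ : i < k), MeasurableSpace.comap (z i) inferInstance) ⊔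
  (⨆ (i : ℕ) (_ : i < k), MeasurableSpace.comap (u i) inferInstance)

/-- `(x k)` is generated by the algorithm `v` with weights `α`, initial point `x₀`, samples
`s k`, and subgradients `z k ∈ ∂h(·, s k)(x k)`, `u k ∈ ∂r₂(x k)`; all of these are random
variables on a probability space `(Θ, μ)`. The sample `s k` is a fresh draw from `P`, that is,
it is independent of everything computed before it is drawn
(in particular, `s 0, s 1, ...` are i.i.d.). -/
structure IsGenerated (p : Program n P) (v : Variant) (α : ℕ → ℝ)
    {Θ : Type*} [MeasurableSpace Θ] (μ : Measure Θ) (x₀ : EuclideanSpace ℝ (Fin n))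
    (s : ℕ → Θ → Ω) (x z u : ℕ → Θ → EuclideanSpace ℝ (Fin n)) : Prop where
  measurable_s : ∀ k, Measurable (s k)
  measurable_x : ∀ k, Measurable (x k)
  measurable_z : ∀ k, Measurable (z k)
  measurable_u : ∀ k, Measurable (u k)
  law : ∀ k, μ.map (s k) = P
  fresh : ∀ k, Indep (MeasurableSpace.comap (s k) inferInstance) (past s x z u k) μ
  init_dom : p.r₁ x₀ < ⊤
  init : ∀ᵐ ω ∂μ, x 0 ω = x₀
  z_mem : ∀ᵐ ω ∂μ, ∀ k, z k ω ∈ subdiff (fun y => (p.h y (s k ω) : EReal)) (x k ω)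
  u_mem : ∀ᵐ ω ∂μ, ∀ k, u k ω ∈ subdiff p.r₂ (x k ω)
  /-- `x (k+1)` minimizes `y ↦ G̃(y) + r₁(y) - ⟨y^k + w^k, y⟩`, where `G̃` is `G` or `G_k`, and
  `y^k`, `w^k` are the weighted averages of the `z i` and of the `u i`. -/
  step : ∀ᵐ ω ∂μ, ∀ k, IsMinOn
    (fun y => ((firstComponent p α (fun i => s i ω) k y v
        - inner ℝ (weightedAvg α (fun i => z i ω) k + weightedAvg α (fun i => u i ω) k) y : ℝ)
        : EReal) + p.r₁ y) univ (x (k + 1) ω)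

/-- `φ` is (finite near and) differentiable at each point of `C`, and its gradient is Lipschitz
on `C` with modulus `K`. -/
def GradLipschitzOn (K : ℝ≥0) (φ : EuclideanSpace ℝ (Fin n) → EReal)
    (C : Set (EuclideanSpace ℝ (Fin n))) : Prop :=
  (∀ x ∈ C, (∀ᶠ y in 𝓝 x, φ y ≠ ⊤ ∧ φ y ≠ ⊥) ∧ DifferentiableAt ℝ (fun y => (φ y).toReal) x) ∧
    LipschitzOnWith K (gradient fun y => (φ y).toReal) C

/-- The smoothness assumption for the rate: `∇r₂` and all `∇h(·, s)` (and, for the second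
algorithm, all `∇g(·, s)`) are Lipschitz on `C` with the same modulus `L / 2`. -/
def EquiLipschitzGradients (p : Program n P) (L : ℝ≥0) (C : Set (EuclideanSpace ℝ (Fin n))) :
    Variant → Prop
  | .sdca1 => GradLipschitzOn (L / 2) p.r₂ C ∧
      ∀ s, GradLipschitzOn (L / 2) (fun y => (p.h y s : EReal)) C
  | .sdca2 => GradLipschitzOn (L / 2) p.r₂ C ∧
      ∀ s, GradLipschitzOn (L / 2) (fun y => (p.g y s : EReal)) C ∧
        GradLipschitzOn (L / 2) (fun y => (p.h y s : EReal)) C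

/-- `d_k = min_{1 ≤ i ≤ k} E[d(0, ∂G(x^i) + ∂r₁(x^i) - ∂H(x^i) - ∂r₂(x^i))]`, in `[0, ∞]`. -/
def expectedDist (p : Program n P) {Θ : Type*} [MeasurableSpace Θ] (μ : Measure Θ)
    (x : ℕ → Θ → EuclideanSpace ℝ (Fin n)) (k : ℕ) : ℝ≥0∞ :=
  ⨅ i ∈ Finset.Icc 1 k, ∫⁻ ω, p.distToCriticality (x i ω) ∂μ

end Algorithms

end SDCA

end

open SDCA

/-! Write `w k = α (k+1) / A (k+1)`. Linearizing `h(·, s i)` and `r₂` at `x i` turns the `i`-th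
sampled objective into a convex majorant, the `surrogate`, and `x (k+1)` minimizes the weighted
average of the surrogates `0, …, k`. Strong convexity of `h` or `r₂` makes this average exceed the
sampled objective at `x (k+1)` by a multiple of the `spread`, the weighted mean of `‖x (k+1) - x
i‖²`. Passing to the next average moves the minimal value by a step of relative size `w k` towards
the newly sampled objective at `x (k+1)`. Telescoping (`IsPath.descent`) bounds `∑ w k * spread k`
by a constant plus the noise `∑ w k * (new sample - sample average)` at `x (k+1)`, plus the
deviation in the last average.

The noise splits at the true expectation. New sample minus expectation is a martingale difference,
because the sample is fresh; its sums are bounded in `L²`, since `∑ w k ^ 2 < ∞` (`noise_moments`,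
`AdmissibleWeights.summable_sq`). Expectation minus sample average is evaluated at a point depending
on the same samples, so a uniform law of large numbers is needed: Hoeffding's bound on a net gives
the mean accuracy `sampleRate (beta α k)` (`exists_uniform_bound`), and the assumed series says that
this is summable against `w`. Hence `∑ w k * spread k < ∞` almost surely for bounded paths, and also
in mean when one ball contains all iterates.

For (i), `∑ w k = ∞`, so the spread tends to zero along a subsequence; a normalized expectation
makes the indices independent of the outcome (`exists_subsequence`). There the past iterates
concentrate, in weighted mean, around `x (k+1)`; averages of their subgradients become subgradients
at the limit point, and the Moreau–Rockafellar rule applied to the limiting subproblem gives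
criticality (`IsPath.isCritical`).

For (ii), Lipschitz gradients bound the distance to criticality at `x (k+1)` by `L * √spread` plus a
sampling error for gradients. Squaring the mean bounds and summing against `w` gives a bounded
total, so the squared minimum is at most a constant over `∑ w` (`expectedDist_rate`). -/

namespace SDCA

/-! ### Subgradients, strong convexity and the sum rule -/

section ConvexAnalysis

variable {n : ℕ}

/-- At a finite point, the subgradient inequality holds between real values. -/
theorem subdiff_toReal_le {f : EuclideanSpace ℝ (Fin n) → EReal} (hbot : ∀ x, f x ≠ ⊥)
    {x y v : EuclideanSpace ℝ (Fin n)} (hv : v ∈ subdiff f x) (hy : f y ≠ ⊤) :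
    (f x).toReal + inner ℝ v (y - x) ≤ (f y).toReal := by
  have h := hv.2 y
  rw [← EReal.coe_toReal hv.1.ne (hbot x), ← EReal.coe_toReal hy (hbot y)] at h
  exact_mod_cast h

theorem mem_subdiff_of_toReal_le {f : EuclideanSpace ℝ (Fin n) → EReal} (hbot : ∀ x, f x ≠ ⊥)
    {x v : EuclideanSpace ℝ (Fin n)} (hx : f x ≠ ⊤)
    (h : ∀ y, f y ≠ ⊤ → (f x).toReal + inner ℝ v (y - x) ≤ (f y).toReal) :
    v ∈ subdiff f x := by
  refine ⟨hx.lt_top, fun y => ?_⟩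
  by_cases hy : f y = ⊤
  · simp [hy]
  · rw [← EReal.coe_toReal hx (hbot x), ← EReal.coe_toReal hy (hbot y)]
    exact_mod_cast h y hy

theorem mem_subdiff_coe {f : EuclideanSpace ℝ (Fin n) → ℝ} {x v : EuclideanSpace ℝ (Fin n)} :
    v ∈ subdiff (fun y => (f y : EReal)) x ↔ ∀ y, f x + inner ℝ v (y - x) ≤ f y := by
  constructor
  · intro h y
    have := h.2 y
    dsimp only at this
    exact_mod_cast this
  · intro h
    refine ⟨EReal.coe_lt_top _, fun y => ?_⟩
    have := h y
    dsimp only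
    exact_mod_cast this

theorem RhoConvex.toReal_le {ρ : ℝ≥0} {f : EuclideanSpace ℝ (Fin n) → EReal}
    (hf : RhoConvex ρ f) (hbot : ∀ x, f x ≠ ⊥) {x y : EuclideanSpace ℝ (Fin n)}
    (hx : f x ≠ ⊤) (hy : f y ≠ ⊤) {t : ℝ} (ht : t ∈ Icc (0 : ℝ) 1) :
    f (t • x + (1 - t) • y) ≠ ⊤ ∧
    (f (t • x + (1 - t) • y)).toReal + ρ / 2 * t * (1 - t) * ‖x - y‖ ^ 2
      ≤ t * (f x).toReal + (1 - t) * (f y).toReal := by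
  have h := hf x y t ht
  rw [← EReal.coe_toReal hx (hbot x), ← EReal.coe_toReal hy (hbot y)] at h
  have hne : f (t • x + (1 - t) • y) ≠ ⊤ := by
    intro htop
    rw [htop, EReal.top_add_coe] at h
    exact absurd h (not_le.2 (by exact_mod_cast EReal.coe_lt_top _))
  refine ⟨hne, ?_⟩
  rw [← EReal.coe_toReal hne (hbot _)] at h
  exact_mod_cast h

theorem RhoConvex.mono {ρ ρ' : ℝ≥0} {f : EuclideanSpace ℝ (Fin n) → EReal}
    (hf : RhoConvex ρ f) (h : ρ' ≤ ρ) : RhoConvex ρ' f := by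
  intro x y t ht
  refine le_trans ?_ (hf x y t ht)
  gcongr
  · exact sub_nonneg.2 ht.2
  · exact ht.1

theorem rhoConvex_zero_of_convexOn {f : EuclideanSpace ℝ (Fin n) → ℝ}
    (hf : ConvexOn ℝ univ f) : RhoConvex 0 (fun y => (f y : EReal)) := by
  intro x y t ht
  have := hf.2 (mem_univ x) (mem_univ y) ht.1 (sub_nonneg.2 ht.2) (by ring)
  simp only [smul_eq_mul] at this
  simp only [NNReal.coe_zero, zero_div, zero_mul, EReal.coe_zero, add_zero]
  exact_mod_cast this

/-- A subgradient of a `ρ`-convex function satisfies the strong subgradient inequality. -/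
theorem RhoConvex.subdiff_toReal_le {ρ : ℝ≥0} {f : EuclideanSpace ℝ (Fin n) → EReal}
    (hf : RhoConvex ρ f) (hbot : ∀ x, f x ≠ ⊥) {x y v : EuclideanSpace ℝ (Fin n)}
    (hv : v ∈ subdiff f x) (hy : f y ≠ ⊤) :
    (f x).toReal + inner ℝ v (y - x) + ρ / 2 * ‖y - x‖ ^ 2 ≤ (f y).toReal := by
  -- Apply `ρ`-convexity and the plain subgradient inequality at `t • y + (1 - t) • x` and divide by
  -- `t`; the limit `t → 0` restores the full quadratic term.
  have key : ∀ t ∈ Ioo (0 : ℝ) 1,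
      (f x).toReal + inner ℝ v (y - x) + ρ / 2 * (1 - t) * ‖y - x‖ ^ 2 ≤ (f y).toReal := by
    intro t ht
    obtain ⟨h1, h2⟩ := hf.toReal_le hbot hy hv.1.ne (t := t) ⟨ht.1.le, ht.2.le⟩
    have h3 := SDCA.subdiff_toReal_le hbot hv h1
    have h4 : t • y + (1 - t) • x - x = t • (y - x) := by module
    rw [h4, inner_smul_right] at h3
    have : t * ((f x).toReal + inner ℝ v (y - x) + ρ / 2 * (1 - t) * ‖y - x‖ ^ 2)
        ≤ t * (f y).toReal := by nlinarith
    exact le_of_mul_le_mul_left this ht.1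
  have hlim : Tendsto (fun t : ℝ =>
      (f x).toReal + inner ℝ v (y - x) + ρ / 2 * (1 - t) * ‖y - x‖ ^ 2) (𝓝[>] 0)
      (𝓝 ((f x).toReal + inner ℝ v (y - x) + ρ / 2 * (1 - 0) * ‖y - x‖ ^ 2)) :=
    (Continuous.tendsto (by fun_prop) 0).mono_left nhdsWithin_le_nhds
  have := le_of_tendsto hlim (by
    filter_upwards [Ioo_mem_nhdsGT (zero_lt_one' ℝ)] with t ht using key t ht)
  simpa using this

/-- `ρ`-convexity passes to smaller constants, so whether the supremum is attained never matters. -/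
theorem exists_rhoConvex_of_lt_modulus {f : EuclideanSpace ℝ (Fin n) → EReal} {c : ℝ≥0}
    (h : (c : ℝ≥0∞) < strongConvexityModulus f) : RhoConvex c f := by
  unfold strongConvexityModulus at h
  obtain ⟨ρ, hρ⟩ := lt_iSup_iff.1 h
  obtain ⟨hc, hρ⟩ := lt_iSup_iff.1 hρ
  exact hc.mono (by exact_mod_cast hρ.le)

/-- Moreau–Rockafellar: at a minimizer of `G + r - ⟨q, ·⟩` with `G` finite convex, `q` splits into
subgradients of `G` and of `r`. -/
theorem exists_subdiff_add_eq_of_isMinOn {G : EuclideanSpace ℝ (Fin n) → ℝ}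
    (hG : ConvexOn ℝ univ G) {r : EuclideanSpace ℝ (Fin n) → EReal} (hr : RhoConvex 0 r)
    (hbot : ∀ x, r x ≠ ⊥) {q x : EuclideanSpace ℝ (Fin n)} (hx : r x ≠ ⊤)
    (hmin : ∀ y, r y ≠ ⊤ →
      G x - inner ℝ q x + (r x).toReal ≤ G y - inner ℝ q y + (r y).toReal) :
    ∃ ξ ∈ subdiff (fun y => (G y : EReal)) x, ∃ η ∈ subdiff r x, ξ + η = q := by
  have hGc : Continuous G := by
    rw [← continuousOn_univ]; exact hG.continuousOn isOpen_univ
  -- `S` is the strict epigraph of `G - ⟨q, ·⟩` and `T` the hypograph of the minimal value minus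
  -- `r`; minimality makes them disjoint. Since `G` is continuous, `S` is open, so they can be
  -- separated without any qualification condition on `r`.
  let S : Set (EuclideanSpace ℝ (Fin n) × ℝ) := {a | G a.1 - inner ℝ q a.1 < a.2}
  let T : Set (EuclideanSpace ℝ (Fin n) × ℝ) :=
    {a | r a.1 ≠ ⊤ ∧ a.2 + (r a.1).toReal ≤ G x - inner ℝ q x + (r x).toReal}
  have hSo : IsOpen S := isOpen_lt (by fun_prop) (by fun_prop)
  have hSc : Convex ℝ S := by
    rintro ⟨a, s⟩ ha ⟨b, t⟩ hb c d hc hd hcd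
    have ha' : G a - inner ℝ q a < s := ha
    have hb' : G b - inner ℝ q b < t := hb
    change G (c • a + d • b) - inner ℝ q (c • a + d • b) < c * s + d * t
    have h1 := hG.2 (mem_univ a) (mem_univ b) hc hd hcd
    simp only [smul_eq_mul] at h1
    rw [inner_add_right, inner_smul_right, inner_smul_right]
    rcases hc.eq_or_lt with rfl | hc'
    · have : d = 1 := by linarith
      subst this
      nlinarith
    · nlinarith [mul_lt_mul_of_pos_left ha' hc', mul_le_mul_of_nonneg_left hb'.le hd]
  have hTc : Convex ℝ T := by
    rintro ⟨a, s⟩ ⟨ha, ha'⟩ ⟨b, t⟩ ⟨hb, hb'⟩ c d hc hd hcd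
    have hd' : d = 1 - c := by linarith
    subst hd'
    obtain ⟨h1, h2⟩ := hr.toReal_le hbot ha hb (t := c) ⟨hc, by linarith⟩
    refine ⟨h1, ?_⟩
    change c * s + (1 - c) * t + (r (c • a + (1 - c) • b)).toReal ≤ _
    simp only at ha' hb'
    simp only [NNReal.coe_zero, zero_div, zero_mul, add_zero] at h2
    nlinarith [mul_le_mul_of_nonneg_left ha' hc, mul_le_mul_of_nonneg_left hb' hd]
  have hdisj : Disjoint S T := by
    rw [Set.disjoint_left]
    rintro ⟨a, s⟩ ha ⟨hb, hb'⟩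
    have ha' : G a - inner ℝ q a < s := ha
    have := hmin a hb
    simp only at hb'
    linarith
  obtain ⟨F, c, hS, hT⟩ := geometric_hahn_banach_open hSc hSo hTc hdisj
  set m : ℝ := G x - inner ℝ q x with hm
  set F₁ : EuclideanSpace ℝ (Fin n) →L[ℝ] ℝ := F.comp (ContinuousLinearMap.inl ℝ _ ℝ) with hF₁
  set κ : ℝ := F (0, 1) with hκ
  have hF : ∀ a s, F (a, s) = F₁ a + κ * s := by
    intro a s
    have : ((a, s) : EuclideanSpace ℝ (Fin n) × ℝ) = (a, 0) + s • (0, 1) := by simp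
    rw [this, map_add, map_smul, hF₁, hκ]
    simp [mul_comm]
  have hTx : c ≤ F₁ x + κ * m := by
    rw [← hF]; exact hT (x, m) ⟨hx, le_rfl⟩
  have hSx : ∀ t > 0, F₁ x + κ * (m + t) < c := by
    intro t ht
    rw [← hF]; exact hS (x, m + t) (by change _ < m + t; linarith)
  -- The separating hyperplane is not vertical: `(x, m)` lies in `T` and `(x, m + 1)` in `S`.
  have hκneg : κ < 0 := by
    have := hSx 1 one_pos
    linarith
  have hcle : F₁ x + κ * m ≤ c := by
    have hlim : Tendsto (fun t : ℝ => F₁ x + κ * (m + t)) (𝓝[>] 0) (𝓝 (F₁ x + κ * (m + 0))) :=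
      (Continuous.tendsto (by fun_prop) 0).mono_left nhdsWithin_le_nhds
    have := le_of_tendsto hlim (by filter_upwards [self_mem_nhdsWithin] with t ht using (hSx t ht).le)
    simpa using this
  have hSy : ∀ y, F₁ y + κ * (G y - inner ℝ q y) ≤ F₁ x + κ * m := by
    intro y
    have hlim : Tendsto (fun t : ℝ => F₁ y + κ * (G y - inner ℝ q y + t)) (𝓝[>] 0)
        (𝓝 (F₁ y + κ * (G y - inner ℝ q y + 0))) :=
      (Continuous.tendsto (by fun_prop) 0).mono_left nhdsWithin_le_nhds
    have := le_of_tendsto hlim (by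
      filter_upwards [self_mem_nhdsWithin] with t ht
      rw [← hF]
      exact (hS (y, _) (by
        have : (0:ℝ) < t := ht
        change G y - inner ℝ q y < G y - inner ℝ q y + t; linarith)).le)
    simp only [add_zero] at this
    linarith
  have hTy : ∀ y, r y ≠ ⊤ → F₁ x + κ * m ≤ F₁ y + κ * (m + (r x).toReal - (r y).toReal) := by
    intro y hy
    rw [← hF y]
    exact hcle.trans (hT (y, _) ⟨hy, by simp [hm]⟩)
  obtain ⟨p₀, hp₀⟩ : ∃ p₀ : EuclideanSpace ℝ (Fin n), ∀ y, F₁ y = inner ℝ p₀ y :=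
    ⟨(InnerProductSpace.toDual ℝ _).symm F₁, fun y => by simp⟩
  have hne : (-κ) ≠ 0 := by linarith
  have hp : ∀ y, F₁ y - F₁ x = -κ * inner ℝ ((-κ)⁻¹ • p₀) (y - x) := by
    intro y
    rw [real_inner_smul_left, mul_inv_cancel_left₀ hne, hp₀, hp₀, inner_sub_right]
  -- Rescaled by `-κ`, the horizontal part of the functional is a subgradient of `G - ⟨q, ·⟩` at
  -- `x`, and its opposite is one of `r`.
  refine ⟨q + (-κ)⁻¹ • p₀, mem_subdiff_coe.2 fun y => ?_, -((-κ)⁻¹ • p₀),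
    mem_subdiff_of_toReal_le hbot hx fun y hy => ?_, by abel⟩
  · have h1 := hSy y
    have h2 := hp y
    rw [inner_add_left, inner_sub_right q]
    have : -κ * (inner ℝ ((-κ)⁻¹ • p₀) (y - x)) ≤ -κ * (G y - inner ℝ q y - m) := by
      rw [← h2]; nlinarith
    have := le_of_mul_le_mul_left this (by linarith)
    linarith
  · have h1 := hTy y hy
    have h2 := hp y
    rw [inner_neg_left]
    have : -κ * ((r x).toReal - (r y).toReal) ≤ -κ * (inner ℝ ((-κ)⁻¹ • p₀) (y - x)) := by
      rw [← h2]; nlinarith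
    have := le_of_mul_le_mul_left this (by linarith)
    linarith

/-- A subgradient at a point of differentiability is the gradient. -/
theorem eq_gradient_of_mem_subdiff {f : EuclideanSpace ℝ (Fin n) → EReal}
    {x v : EuclideanSpace ℝ (Fin n)} (hfin : ∀ᶠ y in 𝓝 x, f y ≠ ⊤ ∧ f y ≠ ⊥)
    (hd : DifferentiableAt ℝ (fun y => (f y).toReal) x) (hv : v ∈ subdiff f x) :
    v = gradient (fun y => (f y).toReal) x := by
  have hx := hfin.self_of_nhds
  have hmin : IsLocalMin (fun y => (f y).toReal - inner ℝ v y) x := by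
    filter_upwards [hfin] with y hy
    have h := hv.2 y
    rw [← EReal.coe_toReal hx.1 hx.2, ← EReal.coe_toReal hy.1 hy.2] at h
    have h' : (f x).toReal + inner ℝ v (y - x) ≤ (f y).toReal := by exact_mod_cast h
    rw [inner_sub_right] at h'
    linarith
  have h1 : HasFDerivAt (fun y => (f y).toReal - inner ℝ v y)
      (InnerProductSpace.toDual ℝ _ (gradient (fun y => (f y).toReal) x) - innerSL ℝ v) x :=
    hd.hasGradientAt.hasFDerivAt.sub (innerSL ℝ v).hasFDerivAt
  have h2 := hmin.hasFDerivAt_eq_zero h1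
  refine ext_inner_right ℝ fun w => ?_
  have := DFunLike.congr_fun h2 w
  simp only [_root_.sub_apply, InnerProductSpace.toDual_apply_apply, innerSL_apply_apply,
    _root_.zero_apply] at this
  linarith

/-- The gradient of a real convex function is a subgradient. -/
theorem gradient_mem_subdiff {f : EuclideanSpace ℝ (Fin n) → ℝ} (hf : ConvexOn ℝ univ f)
    {x : EuclideanSpace ℝ (Fin n)} (hd : DifferentiableAt ℝ f x) :
    gradient f x ∈ subdiff (fun y => (f y : EReal)) x := by
  refine mem_subdiff_coe.2 fun y => ?_
  have hder : HasDerivAt (fun t : ℝ => f (x + t • (y - x))) (inner ℝ (gradient f x) (y - x)) 0 := by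
    have h0 : HasFDerivAt f (InnerProductSpace.toDual ℝ _ (gradient f x)) (x + (0:ℝ) • (y - x)) := by
      simpa using hd.hasGradientAt.hasFDerivAt
    have h1 : HasDerivAt (fun t : ℝ => x + t • (y - x)) (y - x) 0 := by
      simpa using ((hasDerivAt_id (0:ℝ)).smul_const (y - x)).const_add x
    have h2 := h0.comp_hasDerivAt (0:ℝ) h1
    rw [InnerProductSpace.toDual_apply_apply] at h2
    exact h2
  have hs := hder.tendsto_slope_zero_right
  have := le_of_tendsto hs (b := f y - f x) (by
    filter_upwards [Ioo_mem_nhdsGT (zero_lt_one' ℝ)] with t ht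
    have h2 := hf.2 (mem_univ y) (mem_univ x) ht.1.le (sub_nonneg.2 ht.2.le) (by ring)
    have h3 : t • y + (1 - t) • x = x + t • (y - x) := by module
    rw [h3] at h2
    simp only [smul_eq_mul] at h2
    simp only [zero_add, zero_smul, add_zero, smul_eq_mul]
    rw [inv_mul_le_iff₀ ht.1]
    linarith)
  linarith

/-- Subgradients on a ball are bounded by twice a bound of the function on a larger ball. -/
theorem norm_le_of_mem_subdiff {f : EuclideanSpace ℝ (Fin n) → ℝ} {R M : ℝ}
    (hM : ∀ x, ‖x‖ ≤ R + 1 → |f x| ≤ M) {x v : EuclideanSpace ℝ (Fin n)} (hx : ‖x‖ ≤ R)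
    (hv : v ∈ subdiff (fun y => (f y : EReal)) x) : ‖v‖ ≤ 2 * M := by
  have h0 := abs_le.1 (hM x (by linarith))
  rcases eq_or_ne v 0 with rfl | hne
  · simp; linarith
  have hpos : 0 < ‖v‖ := norm_pos_iff.2 hne
  -- A unit step in the direction of `v` stays in the larger ball and raises the affine minorant by
  -- exactly `‖v‖`.
  have h1 := mem_subdiff_coe.1 hv (x + ‖v‖⁻¹ • v)
  rw [add_sub_cancel_left, inner_smul_right, real_inner_self_eq_norm_sq] at h1
  have h2 : ‖x + ‖v‖⁻¹ • v‖ ≤ R + 1 := by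
    refine (norm_add_le _ _).trans ?_
    rw [norm_smul, norm_inv, norm_norm, inv_mul_cancel₀ hpos.ne']
    linarith
  have h3 := abs_le.1 (hM _ h2)
  have h4 : ‖v‖⁻¹ * ‖v‖ ^ 2 = ‖v‖ := by field_simp
  linarith

/-- Jensen's inequality for extended valued convex functions. -/
theorem RhoConvex.map_sum_le {f : EuclideanSpace ℝ (Fin n) → EReal} (hf : RhoConvex 0 f)
    (hbot : ∀ x, f x ≠ ⊥) {ι : Type*} {t : Finset ι} {w : ι → ℝ}
    {x : ι → EuclideanSpace ℝ (Fin n)} (hw : ∀ i ∈ t, 0 ≤ w i) (hw1 : ∑ i ∈ t, w i = 1)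
    (hx : ∀ i ∈ t, f (x i) ≠ ⊤) :
    f (∑ i ∈ t, w i • x i) ≤ ((∑ i ∈ t, w i * (f (x i)).toReal : ℝ) : EReal) := by
  have hconv : ConvexOn ℝ {y | f y ≠ ⊤} (fun y => (f y).toReal) := by
    have key : ∀ y ∈ {y | f y ≠ ⊤}, ∀ y' ∈ {y | f y ≠ ⊤}, ∀ a b : ℝ, 0 ≤ a → 0 ≤ b → a + b = 1 →
        f (a • y + b • y') ≠ ⊤ ∧
        (f (a • y + b • y')).toReal ≤ a * (f y).toReal + b * (f y').toReal := by
      intro y hy y' hy' a b ha hb hab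
      obtain rfl : b = 1 - a := by linarith
      simpa using hf.toReal_le hbot hy hy' (t := a) ⟨ha, by linarith⟩
    exact ⟨fun y hy y' hy' a b ha hb hab => (key y hy y' hy' a b ha hb hab).1,
      fun y hy y' hy' a b ha hb hab => (key y hy y' hy' a b ha hb hab).2⟩
  have h1 := hconv.map_sum_le hw hw1 hx
  have h2 : f (∑ i ∈ t, w i • x i) ≠ ⊤ := hconv.1.sum_mem hw hw1 hx
  rw [← EReal.coe_toReal h2 (hbot _)]
  exact_mod_cast h1

end ConvexAnalysis

/-! ### Nets of bounded sets and their entropy -/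

section Covering

variable {n : ℕ}

theorem norm_le_sum_abs (v : EuclideanSpace ℝ (Fin n)) : ‖v‖ ≤ ∑ i, |v i| := by
  have h : v = ∑ i, v i • EuclideanSpace.basisFun (Fin n) ℝ i :=
    by simpa using ((EuclideanSpace.basisFun (Fin n) ℝ).sum_repr v).symm
  conv_lhs => rw [h]
  refine (norm_sum_le _ _).trans (Finset.sum_le_sum fun i _ => ?_)
  rw [norm_smul, OrthonormalBasis.norm_eq_one, mul_one, Real.norm_eq_abs]

theorem abs_coord_le_norm (v : EuclideanSpace ℝ (Fin n)) (i : Fin n) : |v i| ≤ ‖v‖ :=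
  PiLp.norm_apply_le v i

/-- A bounded set has nets of mesh `n / β` with logarithmic entropy in `β`. -/
theorem exists_net (R : ℝ) : ∃ c : ℝ, 0 ≤ c ∧ ∀ C ⊆ Metric.closedBall
    (0 : EuclideanSpace ℝ (Fin n)) R, ∀ β : ℝ, 1 ≤ β → ∃ T : Finset (EuclideanSpace ℝ (Fin n)),
      (↑T ⊆ C) ∧ (∀ x ∈ C, ∃ t ∈ T, ‖x - t‖ ≤ n / β) ∧
      2 * (T.card : ℝ) ≤ Real.exp (c * (1 + Real.log β)) := by
  classical
  wlog hR : 0 ≤ R generalizing R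
  · obtain ⟨c, hc, h⟩ := this 0 le_rfl
    refine ⟨c, hc, fun C hC => h C (hC.trans (Metric.closedBall_subset_closedBall (not_le.1 hR).le))⟩
  have h3 : 1 ≤ 2 * R + 3 := by linarith
  refine ⟨Real.log 2 + n * (Real.log (2 * R + 3) + 1), ?_, fun C hC β hβ => ?_⟩
  · have := Real.log_nonneg h3
    have := Real.log_nonneg one_le_two
    positivity
  have hβ0 : 0 < β := by linarith
  let m : ℤ := ⌈R * β⌉
  have hm0 : 0 ≤ m := Int.ceil_nonneg (by positivity)
  -- Cubes of side `1/β`. One point of `C` is picked in each cube that meets `C`: the net must lie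
  -- in `C`, because the uniform law assumes its bounds only there.
  let cell : EuclideanSpace ℝ (Fin n) → (Fin n → ℤ) := fun x i => ⌊β * x i⌋
  let box : Finset (Fin n → ℤ) := Fintype.piFinset fun _ => Finset.Icc (-m) m
  have hcell : ∀ x ∈ C, cell x ∈ box := by
    intro x hx
    rw [Fintype.mem_piFinset]
    intro i
    have h1 : |x i| ≤ R := (abs_coord_le_norm x i).trans (by simpa using hC hx)
    have h2 := abs_le.1 h1
    rw [Finset.mem_Icc]
    constructor
    · rw [Int.le_floor]
      have : R * β ≤ m := Int.le_ceil _
      push_cast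
      nlinarith
    · have h4 : β * x i ≤ m := le_trans (by nlinarith) (Int.le_ceil (R * β))
      exact_mod_cast (Int.floor_le (β * x i)).trans h4
  let J : Finset (Fin n → ℤ) := box.filter fun j => ∃ x ∈ C, cell x = j
  have hJ : ∀ j ∈ J, ∃ x ∈ C, cell x = j := fun j hj => (Finset.mem_filter.1 hj).2
  choose! pt hptC hpt using hJ
  refine ⟨J.image pt, ?_, ?_, ?_⟩
  · intro t ht
    obtain ⟨j, hj, rfl⟩ := Finset.mem_image.1 (Finset.mem_coe.1 ht)
    exact hptC j hj
  · intro x hx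
    have hj : cell x ∈ J := Finset.mem_filter.2 ⟨hcell x hx, x, hx, rfl⟩
    refine ⟨pt (cell x), Finset.mem_image_of_mem _ hj, ?_⟩
    have hc := hpt _ hj
    refine (norm_le_sum_abs _).trans ?_
    have : ∀ i ∈ (Finset.univ : Finset (Fin n)), |(x - pt (cell x)) i| ≤ 1 / β := by
      intro i _
      have h1 : ⌊β * (pt (cell x)) i⌋ = ⌊β * x i⌋ := congrFun hc i
      have h2 := Int.abs_sub_lt_one_of_floor_eq_floor h1.symm
      rw [PiLp.sub_apply, le_div_iff₀ hβ0]
      rw [← mul_sub, abs_mul, abs_of_pos hβ0] at h2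
      linarith
    refine (Finset.sum_le_card_nsmul _ _ _ this).trans ?_
    simp [div_eq_mul_inv]
  -- There are at most `(2m + 1) ^ n` cubes, and `2m + 1 ≤ (2R + 3) β` because `β ≥ 1`. The factor
  -- `2` in the entropy bound serves the two exponentials `exp (±λ X)` attached to each net point
  -- later.
  · have hcard : ((J.image pt).card : ℝ) ≤ ((2 * R + 3) * β) ^ n := by
      have h1 : (J.image pt).card ≤ (2 * m + 1).toNat ^ n := by
        refine Finset.card_image_le.trans ((Finset.card_filter_le _ _).trans ?_)
        rw [Fintype.card_piFinset]
        simp only [Int.card_Icc, Finset.prod_const, Finset.card_univ, Fintype.card_fin]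
        gcongr
        lia
      have h2 : ((2 * m + 1).toNat : ℝ) ≤ (2 * R + 3) * β := by
        have h4 : ((2 * m + 1).toNat : ℝ) = 2 * m + 1 := by
          exact_mod_cast Int.toNat_of_nonneg (by lia : 0 ≤ 2 * m + 1)
        rw [h4]
        have := Int.ceil_lt_add_one (R * β)
        change (m : ℝ) < _ at this
        nlinarith
      calc ((J.image pt).card : ℝ) ≤ ((2 * m + 1).toNat ^ n : ℕ) := by exact_mod_cast h1
        _ = ((2 * m + 1).toNat : ℝ) ^ n := by push_cast; rfl
        _ ≤ _ := by gcongr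
    have hexp : 2 * ((2 * R + 3) * β) ^ n
        = Real.exp (Real.log 2 + n * (Real.log (2 * R + 3) + Real.log β)) := by
      rw [← Real.log_mul (by positivity) (by positivity), Real.exp_add, Real.exp_log two_pos,
        Real.exp_nat_mul, Real.exp_log (by positivity)]
    calc 2 * ((J.image pt).card : ℝ) ≤ 2 * ((2 * R + 3) * β) ^ n := by gcongr
      _ = _ := hexp
      _ ≤ _ := by
        apply Real.exp_le_exp.2
        have a1 := Real.log_nonneg hβ
        have a2 := Real.log_nonneg h3
        have a3 := Real.log_nonneg one_le_two
        have a4 : (0:ℝ) ≤ n := Nat.cast_nonneg n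
        have : 0 ≤ Real.log 2 * Real.log β + n * (Real.log (2 * R + 3) * Real.log β) + n := by
          positivity
        nlinarith

end Covering

/-! ### Fresh samples: orthogonality and exponential moments -/

section Sampling

variable {Ω : Type*} [MeasurableSpace Ω] {P : Measure Ω} [IsProbabilityMeasure P]
  {Θ : Type*} [mΘ : MeasurableSpace Θ] {μ : Measure Θ} [IsProbabilityMeasure μ]

/-- A fresh sample integrates out: if `θ(x, ·)` is centred for each `x`, then `θ(x, s)` is
orthogonal to everything measurable with respect to the past. -/
theorem integral_mul_fresh_eq_zero {X : Type*} [MeasurableSpace X] {Θ : Type*}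
    {m mΘ : MeasurableSpace Θ} {μ : Measure Θ} [IsProbabilityMeasure μ] (hm : m ≤ mΘ) {s : Θ → Ω} (hs : Measurable s) (hlaw : μ.map s = P)
    (hind : Indep (MeasurableSpace.comap s inferInstance) m μ)
    {x : Θ → X} (hx : Measurable[m] x) {ξ : Θ → ℝ} (hξ : Measurable[m] ξ) {Mξ : ℝ}
    (hξb : ∀ ω, |ξ ω| ≤ Mξ) {θ : X → Ω → ℝ} (hθ : Measurable (Function.uncurry θ)) {M : ℝ}
    (hθb : ∀ y o, |θ y o| ≤ M) (hθ0 : ∀ y, ∫ o, θ y o ∂P = 0) :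
    ∫ ω, ξ ω * θ (x ω) (s ω) ∂μ = 0 := by
  have hx' : Measurable x := hx.mono hm le_rfl
  have hξ' : Measurable ξ := hξ.mono hm le_rfl
  have hpair : Measurable[m] (fun ω => (ξ ω, x ω)) := hξ.prodMk hx
  have hI : IndepFun (fun ω => (ξ ω, x ω)) s μ := by
    rw [IndepFun_iff_Indep]
    exact (indep_of_indep_of_le_right hind hpair.comap_le).symm
  -- By independence the joint law of `((ξ, x), s)` is a product, so the sample can be integrated
  -- first, which annihilates `θ`.
  have hprod := (indepFun_iff_map_prod_eq_prod_map_map (hpair.mono hm le_rfl).aemeasurable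
    hs.aemeasurable).1 hI
  rw [hlaw] at hprod
  have hpm : Measurable (fun ω => ((ξ ω, x ω), s ω)) := (hξ'.prodMk hx').prodMk hs
  let F : (ℝ × X) × Ω → ℝ := fun q => q.1.1 * θ q.1.2 q.2
  have hF : Measurable F := (measurable_fst.comp measurable_fst).mul
    (hθ.comp ((measurable_snd.comp measurable_fst).prodMk measurable_snd))
  have h1 : ∫ ω, ξ ω * θ (x ω) (s ω) ∂μ = ∫ q, F q ∂(μ.map fun ω => ((ξ ω, x ω), s ω)) := by
    rw [integral_map hpm.aemeasurable hF.aestronglyMeasurable]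
  have : IsProbabilityMeasure (μ.map fun ω => (ξ ω, x ω)) :=
    Measure.isProbabilityMeasure_map (hξ'.prodMk hx').aemeasurable
  have hFi : Integrable F ((μ.map fun ω => (ξ ω, x ω)).prod P) := by
    rw [← hprod, integrable_map_measure hF.aestronglyMeasurable hpm.aemeasurable]
    refine Integrable.of_bound (hF.comp hpm).aestronglyMeasurable (Mξ * M)
      (Eventually.of_forall fun ω => ?_)
    simp only [Function.comp, F, Real.norm_eq_abs, abs_mul]
    exact mul_le_mul (hξb ω) (hθb _ _) (abs_nonneg _) ((abs_nonneg _).trans (hξb ω))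
  rw [h1, hprod, integral_prod _ hFi]
  simp [F, integral_const_mul, hθ0]

theorem abs_integral_le_of_abs_le {θ : Ω → ℝ} {M : ℝ} (h : ∀ o, |θ o| ≤ M) :
    |∫ o, θ o ∂P| ≤ M := by
  have := norm_integral_le_of_norm_le_const (μ := P) (f := θ) (C := M)
    (Eventually.of_forall h)
  simpa using this

/-- Hoeffding's bound for weighted sums of fresh samples. -/
theorem integral_exp_sum_le {m : ℕ → MeasurableSpace Θ} (hm : ∀ k, m k ≤ mΘ) {s : ℕ → Θ → Ω}
    (hs : ∀ k, Measurable (s k)) (hlaw : ∀ k, μ.map (s k) = P)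
    (hind : ∀ k, Indep (MeasurableSpace.comap (s k) inferInstance) (m k) μ)
    (hsm : ∀ k, ∀ i < k, Measurable[m k] (s i))
    {θ : Ω → ℝ} (hθ : Measurable θ) {M : ℝ} (hM : ∀ o, |θ o| ≤ M) (c : ℕ → ℝ) (k : ℕ) :
    ∫ ω, Real.exp (∑ i ∈ Finset.range k, c i * (θ (s i ω) - ∫ o, θ o ∂P)) ∂μ
      ≤ Real.exp (M ^ 2 * (∑ i ∈ Finset.range k, c i ^ 2) / 2) := by
  induction k with
  | zero => simp
  | succ k ih =>
    have hM0 : 0 ≤ M := by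
      have := nonempty_of_isProbabilityMeasure P
      exact (abs_nonneg _).trans (hM (Classical.arbitrary Ω))
    -- Hoeffding's lemma: an interval of length `2M` gives the variance proxy `M ^ 2`.
    have hsub := hasSubgaussianMGF_of_mem_Icc (μ := P) hθ.aemeasurable (a := -M) (b := M)
      (Eventually.of_forall fun o => abs_le.1 (hM o))
    have h1 : ∫ ω, Real.exp (c k * (θ (s k ω) - ∫ o, θ o ∂P)) ∂μ ≤ Real.exp (M ^ 2 * c k ^ 2 / 2) := by
      have h2 := hsub.mgf_le (c k)
      have h3 : (((‖M - -M‖₊ / 2) ^ 2 : ℝ≥0) : ℝ) = M ^ 2 := by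
        push_cast
        rw [Real.norm_eq_abs, abs_of_nonneg (by linarith)]
        ring
      rw [h3] at h2
      rw [mgf, ← hlaw k, integral_map (hs k).aemeasurable] at h2
      · rw [hlaw k] at h2; exact h2
      · exact (by fun_prop : Measurable fun o => Real.exp (c k * (θ o - ∫ x, θ x ∂_))).aestronglyMeasurable
    have hmX : Measurable[m k] (fun ω => Real.exp
        (∑ i ∈ Finset.range k, c i * (θ (s i ω) - ∫ o, θ o ∂P))) := by
      refine Real.measurable_exp.comp (Finset.measurable_fun_sum _ fun i hi => ?_)
      have := hθ.comp (hsm k i (Finset.mem_range.1 hi))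
      exact (this.sub_const _).const_mul _
    have hmY : Measurable (fun o => Real.exp (c k * (θ o - ∫ o, θ o ∂P))) := by fun_prop
    -- The factor built from the earlier samples is past-measurable, hence independent of the new
    -- one, and expectations multiply.
    have hI : IndepFun (fun ω => Real.exp
        (∑ i ∈ Finset.range k, c i * (θ (s i ω) - ∫ o, θ o ∂P)))
        (fun ω => Real.exp (c k * (θ (s k ω) - ∫ o, θ o ∂P))) μ := by
      rw [IndepFun_iff_Indep]
      refine indep_of_indep_of_le_left (indep_of_indep_of_le_right (hind k).symm ?_) hmX.comap_le
      exact (hmY.comp (comap_measurable (s k))).comap_le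
    have h4 := hI.integral_mul_eq_mul_integral (hmX.mono (hm k) le_rfl).aestronglyMeasurable
      (hmY.comp (hs k)).aestronglyMeasurable
    simp only [Finset.sum_range_succ, Real.exp_add]
    simp only [Pi.mul_apply] at h4
    rw [h4, mul_add, add_div, Real.exp_add]
    exact mul_le_mul ih h1 (integral_nonneg fun _ => (Real.exp_pos _).le) (Real.exp_pos _).le

end Sampling

/-! ### Weighted averages and the series attached to the weights -/

section Weights

variable {α : ℕ → ℝ}

theorem weightSum_pos (hα : ∀ k, 0 < α k) (k : ℕ) : 0 < weightSum α k :=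
  Finset.sum_pos (fun i _ => hα i) ⟨0, by simp⟩

theorem weightSum_succ (k : ℕ) : weightSum α (k + 1) = weightSum α k + α (k + 1) :=
  Finset.sum_range_succ _ _

theorem sqrt_sum_sq_pos (hα : ∀ k, 0 < α k) (k : ℕ) :
    0 < √(∑ i ∈ Finset.range (k + 1), α i ^ 2) :=
  Real.sqrt_pos.2 (Finset.sum_pos (fun i _ => pow_pos (hα i) 2) ⟨0, by simp⟩)

theorem sqrt_sum_sq_le_weightSum (hα : ∀ k, 0 < α k) (k : ℕ) :
    √(∑ i ∈ Finset.range (k + 1), α i ^ 2) ≤ weightSum α k :=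
  Real.sqrt_le_iff.2 ⟨(weightSum_pos hα k).le,
    Finset.sum_sq_le_sq_sum_of_nonneg fun i _ => (hα i).le⟩

theorem one_le_beta (hα : ∀ k, 0 < α k) (k : ℕ) : 1 ≤ beta α k :=
  (one_le_div (sqrt_sum_sq_pos hα k)).2 (sqrt_sum_sq_le_weightSum hα k)

theorem weightedAvg_real_eq (v : ℕ → ℝ) (k : ℕ) :
    weightedAvg α v k = ∑ i ∈ Finset.range (k + 1), α i / weightSum α k * v i := by
  simp only [weightedAvg, smul_eq_mul, Finset.mul_sum]
  exact Finset.sum_congr rfl fun i _ => by ring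

theorem weightedAvg_eq_sum {V : Type*} [AddCommGroup V] [Module ℝ V] (v : ℕ → V) (k : ℕ) :
    weightedAvg α v k = ∑ i ∈ Finset.range (k + 1), (α i / weightSum α k) • v i := by
  simp only [weightedAvg, Finset.smul_sum, smul_smul]
  exact Finset.sum_congr rfl fun i _ => by rw [mul_comm, div_eq_mul_inv]

theorem sum_div_weightSum (hα : ∀ k, 0 < α k) (k : ℕ) :
    ∑ i ∈ Finset.range (k + 1), α i / weightSum α k = 1 := by
  rw [← Finset.sum_div]; exact div_self (weightSum_pos hα k).ne'

theorem weightedAvg_const {V : Type*} [AddCommGroup V] [Module ℝ V] (hα : ∀ k, 0 < α k) (c : V)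
    (k : ℕ) : weightedAvg α (fun _ => c) k = c := by
  rw [weightedAvg_eq_sum, ← Finset.sum_smul, sum_div_weightSum hα, one_smul]

theorem weightedAvg_add {V : Type*} [AddCommGroup V] [Module ℝ V] (v w : ℕ → V) (k : ℕ) :
    weightedAvg α (fun i => v i + w i) k = weightedAvg α v k + weightedAvg α w k := by
  simp only [weightedAvg, smul_add, Finset.sum_add_distrib]

theorem weightedAvg_sub {V : Type*} [AddCommGroup V] [Module ℝ V] (v w : ℕ → V) (k : ℕ) :
    weightedAvg α (fun i => v i - w i) k = weightedAvg α v k - weightedAvg α w k := by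
  simp only [weightedAvg, smul_sub, Finset.sum_sub_distrib]

theorem weightedAvg_map {V W : Type*} [AddCommGroup V] [Module ℝ V] [AddCommGroup W] [Module ℝ W]
    (F : V →ₗ[ℝ] W) (v : ℕ → V) (k : ℕ) :
    weightedAvg α (fun i => F (v i)) k = F (weightedAvg α v k) := by
  simp only [weightedAvg, map_smul, map_sum]

theorem weightedAvg_const_mul (c : ℝ) (v : ℕ → ℝ) (k : ℕ) :
    weightedAvg α (fun i => c * v i) k = c * weightedAvg α v k :=
  weightedAvg_map (LinearMap.mulLeft ℝ c) v k

theorem weightedAvg_inner {n : ℕ} (v : ℕ → EuclideanSpace ℝ (Fin n)) (y : EuclideanSpace ℝ (Fin n))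
    (k : ℕ) : weightedAvg α (fun i => (inner ℝ (v i) y : ℝ)) k = inner ℝ (weightedAvg α v k) y := by
  have := weightedAvg_map (α := α) (innerSL ℝ y).toLinearMap v k
  simpa [real_inner_comm] using this

theorem weightedAvg_mono (hα : ∀ k, 0 < α k) {v w : ℕ → ℝ} {k : ℕ} (h : ∀ i ≤ k, v i ≤ w i) :
    weightedAvg α v k ≤ weightedAvg α w k := by
  rw [weightedAvg_real_eq, weightedAvg_real_eq]
  refine Finset.sum_le_sum fun i hi => ?_
  have := weightSum_pos hα k
  have := hα i
  exact mul_le_mul_of_nonneg_left (h i (by simpa [Nat.lt_succ_iff] using hi)) (by positivity)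

theorem norm_weightedAvg_le {V : Type*} [SeminormedAddCommGroup V] [NormedSpace ℝ V]
    (hα : ∀ k, 0 < α k) (v : ℕ → V) (k : ℕ) :
    ‖weightedAvg α v k‖ ≤ weightedAvg α (fun i => ‖v i‖) k := by
  rw [weightedAvg_eq_sum, weightedAvg_real_eq]
  refine (norm_sum_le _ _).trans (Finset.sum_le_sum fun i _ => ?_)
  have := weightSum_pos hα k
  have := hα i
  rw [norm_smul, Real.norm_eq_abs, abs_of_pos (by positivity)]

theorem weightedAvg_nonneg (hα : ∀ k, 0 < α k) {v : ℕ → ℝ} {k : ℕ} (h : ∀ i ≤ k, 0 ≤ v i) :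
    0 ≤ weightedAvg α v k := by
  simpa [weightedAvg_const hα] using weightedAvg_mono hα (v := fun _ => 0) h

/-- The average of a nonnegative sequence squared is at most the average of the squares. -/
theorem sq_weightedAvg_le (hα : ∀ k, 0 < α k) (v : ℕ → ℝ) (k : ℕ) :
    weightedAvg α v k ^ 2 ≤ weightedAvg α (fun i => v i ^ 2) k := by
  have h : 0 ≤ weightedAvg α (fun i => (v i - weightedAvg α v k) ^ 2) k :=
    weightedAvg_nonneg hα fun i _ => sq_nonneg _
  have h2 : (fun i => (v i - weightedAvg α v k) ^ 2)
      = fun i => (v i ^ 2 - 2 * weightedAvg α v k * v i) + weightedAvg α v k ^ 2 := by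
    funext i; ring
  rw [h2, weightedAvg_add, weightedAvg_sub, weightedAvg_const_mul, weightedAvg_const hα] at h
  nlinarith

/-- The new average moves by the fraction `α (k+1) / A (k+1)` towards the new value; these fractions
are the weights in all series below. -/
theorem weightedAvg_succ (hα : ∀ k, 0 < α k) (v : ℕ → ℝ) (k : ℕ) :
    weightedAvg α v (k + 1) = weightedAvg α v k
      + α (k + 1) / weightSum α (k + 1) * (v (k + 1) - weightedAvg α v k) := by
  have h0 := (weightSum_pos hα k).ne'
  have h1 := (weightSum_pos hα (k + 1)).ne'
  simp only [weightedAvg, smul_eq_mul, Finset.sum_range_succ _ (k + 1)]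
  rw [weightSum_succ] at *
  field_simp
  ring

/-- The accuracy of a sample average of effective size `β²`. -/
noncomputable def sampleRate (β : ℝ) : ℝ := (1 + √(Real.log β)) / β

theorem sampleRate_pos {β : ℝ} (hβ : 1 ≤ β) : 0 < sampleRate β := by
  have := Real.sqrt_nonneg (Real.log β)
  unfold sampleRate
  positivity

theorem sampleRate_le_two {β : ℝ} (hβ : 1 ≤ β) : sampleRate β ≤ 2 := by
  have h0 : 0 < β := by linarith
  rw [sampleRate, div_le_iff₀ h0]
  have h1 : Real.log β ≤ β := (Real.log_le_sub_one_of_pos h0).trans (by linarith)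
  have h2 : √(Real.log β) ≤ β := Real.sqrt_le_iff.2 ⟨h0.le, by nlinarith⟩
  linarith

theorem sampleRate_sq_le {β : ℝ} (hβ : 1 ≤ β) : sampleRate β ^ 2 ≤ 2 * sampleRate β := by
  nlinarith [sampleRate_le_two hβ, sampleRate_pos hβ]

/-- Factors the assumed series as step fraction times sampling accuracy, the form in which it
controls the noise. -/
theorem AdmissibleWeights.summable_sampleRate (h : AdmissibleWeights α) :
    Summable fun k => α (k + 1) / weightSum α (k + 1) * sampleRate (beta α k) := by
  refine h.summable.congr fun k => ?_
  have := one_le_beta h.pos k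
  have := weightSum_pos h.pos (k + 1)
  unfold sampleRate
  field_simp

/-- Abel–Dini argument: a tail after `m` of sum below `1/2` is contradicted by the block from `m` to
an `l` with `A l ≥ 2 A m`, whose sum is at least `(A l - A m) / A l ≥ 1/2`. -/
theorem not_summable_div_weightSum (hα : ∀ k, 0 < α k)
    (hdiv : Tendsto (weightSum α) atTop atTop) :
    ¬ Summable fun k => α (k + 1) / weightSum α (k + 1) := by
  intro hs
  have hpos : ∀ k, 0 ≤ α (k + 1) / weightSum α (k + 1) := fun k =>
    (div_pos (hα _) (weightSum_pos hα _)).le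
  obtain ⟨m, hm⟩ := ((tendsto_sum_nat_add fun k => α (k + 1) / weightSum α (k + 1)).eventually
    (gt_mem_nhds one_half_pos)).exists
  obtain ⟨l, hl, hml⟩ := ((hdiv.eventually_ge_atTop (2 * weightSum α m)).and
    (eventually_ge_atTop m)).exists
  have hAl := weightSum_pos hα l
  have key : ∀ j, m + j ≤ l → (weightSum α (m + j) - weightSum α m) / weightSum α l
      ≤ ∑ i ∈ Finset.range j, α (i + m + 1) / weightSum α (i + m + 1) := by
    intro j
    induction j with
    | zero => simp
    | succ j ih =>
      intro hj
      rw [Finset.sum_range_succ, ← add_assoc m j 1, weightSum_succ]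
      have h1 := ih (by lia)
      have h2 : α (m + j + 1) / weightSum α l ≤ α (j + m + 1) / weightSum α (j + m + 1) := by
        rw [add_comm j m]
        refine div_le_div_of_nonneg_left (hα _).le (weightSum_pos hα _) ?_
        exact Finset.sum_le_sum_of_subset_of_nonneg
          (Finset.range_subset_range.2 (by lia)) fun i _ _ => (hα i).le
      calc _ = (weightSum α (m + j) - weightSum α m) / weightSum α l
            + α (m + j + 1) / weightSum α l := by ring
        _ ≤ _ := add_le_add h1 h2
  obtain ⟨j, rfl⟩ := Nat.exists_eq_add_of_le hml
  have h1 := key j le_rfl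
  have h2 := ((summable_nat_add_iff m).2 hs).sum_le_tsum (Finset.range j) fun i _ => hpos _
  have h3 : (1 / 2 : ℝ) ≤ (weightSum α (m + j) - weightSum α m) / weightSum α (m + j) := by
    rw [le_div_iff₀ hAl]; linarith
  linarith

/-- With `T` the root of the partial sums of `α²`, half of the squared fraction is at most `(T (k+1)
- T k) / A (k+1)`. This is an increment of `T / A = 1 / β ≤ 1` plus `w k / β k`; the increments
telescope and the rest is dominated by the summable `w k * sampleRate (β k)`. -/
theorem AdmissibleWeights.summable_sq (h : AdmissibleWeights α) :
    Summable fun k => (α (k + 1) / weightSum α (k + 1)) ^ 2 := by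
  set T : ℕ → ℝ := fun k => √(∑ i ∈ Finset.range (k + 1), α i ^ 2) with hT
  have hT0 := sqrt_sum_sq_pos h.pos
  have hTA := sqrt_sum_sq_le_weightSum h.pos
  have hA := weightSum_pos h.pos
  set a : ℕ → ℝ := fun k => α (k + 1) / weightSum α (k + 1) * sampleRate (beta α k) with ha
  have ha0 : ∀ k, 0 ≤ a k := fun k => mul_nonneg
    (div_pos (h.pos _) (hA _)).le (sampleRate_pos (one_le_beta h.pos k)).le
  have step : ∀ k, (α (k + 1) / weightSum α (k + 1)) ^ 2 / 2
      ≤ a k + T (k + 1) / weightSum α (k + 1) - T k / weightSum α k := by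
    intro k
    have h1 : T k / weightSum α k - T k / weightSum α (k + 1) ≤ a k := by
      have e1 : T k / weightSum α k - T k / weightSum α (k + 1)
          = α (k + 1) / weightSum α (k + 1) * (1 / beta α k) := by
        have := (hA k).ne'
        have := (hA (k + 1)).ne'
        have := (hT0 k).ne'
        have e2 := weightSum_succ (α := α) k
        unfold beta
        rw [hT]
        field_simp
        rw [e2]; ring
      rw [e1]
      refine mul_le_mul_of_nonneg_left ?_ (div_pos (h.pos _) (hA _)).le
      have := one_le_beta h.pos k
      unfold sampleRate
      gcongr
      linarith [Real.sqrt_nonneg (Real.log (beta α k))]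
    have h2 : (α (k + 1) / weightSum α (k + 1)) ^ 2 / 2
        ≤ (T (k + 1) - T k) / weightSum α (k + 1) := by
      have e1 : T (k + 1) ^ 2 = T k ^ 2 + α (k + 1) ^ 2 := by
        simp only [hT]
        rw [Real.sq_sqrt (Finset.sum_nonneg fun i _ => sq_nonneg _),
          Real.sq_sqrt (Finset.sum_nonneg fun i _ => sq_nonneg _), Finset.sum_range_succ _ (k + 1)]
      have t0 : 0 < T k := hT0 k
      have t1 : 0 < T (k + 1) := hT0 (k + 1)
      have e2 : T k ≤ T (k + 1) := by nlinarith [sq_nonneg (α (k + 1))]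
      have e3 : T (k + 1) ≤ weightSum α (k + 1) := hTA (k + 1)
      rw [div_pow, div_div, div_le_div_iff₀ (by have := hA (k+1); positivity) (hA _)]
      have e4 : α (k + 1) ^ 2 = (T (k + 1) - T k) * (T (k + 1) + T k) := by linarith
      rw [e4]
      have e5 := hA (k + 1)
      have e6 : T (k + 1) + T k ≤ 2 * weightSum α (k + 1) := by linarith
      have e7 : 0 ≤ (T (k + 1) - T k) * weightSum α (k + 1) := mul_nonneg (by linarith) e5.le
      nlinarith
    have h3 : (T (k + 1) - T k) / weightSum α (k + 1)
        = T (k + 1) / weightSum α (k + 1) - T k / weightSum α (k + 1) := by ring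
    linarith
  have bound : ∀ K, ∑ k ∈ Finset.range K, (α (k + 1) / weightSum α (k + 1)) ^ 2
      ≤ 2 * (∑' k, a k + 1) := by
    intro K
    have h1 : ∑ k ∈ Finset.range K, (α (k + 1) / weightSum α (k + 1)) ^ 2 / 2
        ≤ ∑ k ∈ Finset.range K, a k + T K / weightSum α K - T 0 / weightSum α 0 := by
      induction K with
      | zero => simp
      | succ K ih =>
        rw [Finset.sum_range_succ, Finset.sum_range_succ]
        linarith [step K]
    have h2 := h.summable_sampleRate.sum_le_tsum (Finset.range K) fun k _ => ha0 k
    have h3 : T K / weightSum α K ≤ 1 := (div_le_one (hA K)).2 (hTA K)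
    have h4 : 0 ≤ T 0 / weightSum α 0 := div_nonneg (hT0 0).le (hA 0).le
    rw [← Finset.sum_div] at h1
    linarith
  exact summable_of_sum_range_le (fun k => sq_nonneg _) bound

end Weights

/-! ### A uniform law of large numbers in mean, with rate -/

section UniformLaw

variable {n : ℕ} {Ω : Type*} [MeasurableSpace Ω] {P : Measure Ω} [IsProbabilityMeasure P]
  {Θ : Type*} [mΘ : MeasurableSpace Θ] {μ : Measure Θ} [IsProbabilityMeasure μ]

/-- The inequality `t + 1 ≤ exp t` at `t = λ (±X - a)`. Summed over a net, the right side dominates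
every `|X|` simultaneously, so the expected maximum is bounded without integrating tails. -/
theorem abs_le_add_exp {lam : ℝ} (hl : 0 < lam) (a X : ℝ) (_ : 0 ≤ a) :
    |X| ≤ a + lam⁻¹ * Real.exp (-(lam * a)) * (Real.exp (lam * X) + Real.exp (-lam * X)) := by
  have key : ∀ Y, Y ≤ a + lam⁻¹ * (Real.exp (-(lam * a)) * Real.exp (lam * Y)) := by
    intro Y
    rw [← Real.exp_add]
    have h := Real.add_one_le_exp (-(lam * a) + lam * Y)
    have h2 : lam⁻¹ * (-(lam * a) + lam * Y + 1) ≤ lam⁻¹ * Real.exp (-(lam * a) + lam * Y) := by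
      gcongr
    have h3 : lam⁻¹ * (-(lam * a) + lam * Y + 1) = Y - a + lam⁻¹ := by field_simp; ring
    have := inv_pos.2 hl
    linarith
  have p1 : 0 < lam⁻¹ * (Real.exp (-(lam * a)) * Real.exp (lam * X)) := by positivity
  have p2 : 0 < lam⁻¹ * (Real.exp (-(lam * a)) * Real.exp (-lam * X)) := by positivity
  have k1 := key X
  have k2 := key (-X)
  rw [show lam * -X = -lam * X by ring] at k2
  rw [abs_le]
  constructor <;> nlinarith

/-- A uniform law of large numbers in mean with rate, for weighted averages of fresh samples of a
bounded family of functions that are equi-Lipschitz on a bounded set. -/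
theorem exists_uniform_bound {m : ℕ → MeasurableSpace Θ} (hm : ∀ k, m k ≤ mΘ) {s : ℕ → Θ → Ω}
    (hs : ∀ k, Measurable (s k)) (hlaw : ∀ k, μ.map (s k) = P)
    (hind : ∀ k, Indep (MeasurableSpace.comap (s k) inferInstance) (m k) μ)
    (hsm : ∀ k, ∀ i < k, Measurable[m k] (s i)) {α : ℕ → ℝ} (hα : ∀ k, 0 < α k)
    {φ : EuclideanSpace ℝ (Fin n) → Ω → ℝ} {C : Set (EuclideanSpace ℝ (Fin n))} {R M K : ℝ}
    (hK0 : 0 ≤ K) (hC : C ⊆ Metric.closedBall 0 R) (hφ : ∀ x ∈ C, Measurable (φ x))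
    (hM : ∀ x ∈ C, ∀ o, |φ x o| ≤ M)
    (hK : ∀ x ∈ C, ∀ y ∈ C, ∀ o, |φ x o - φ y o| ≤ K * ‖x - y‖) :
    ∃ K' : ℝ, 0 ≤ K' ∧ ∃ B : ℕ → Θ → ℝ, ∀ k, Measurable (B k) ∧ Integrable (B k) μ ∧
      (∀ ω, 0 ≤ B k ω) ∧
      (∀ ω, ∀ x ∈ C, |weightedAvg α (fun i => φ x (s i ω)) k - ∫ o, φ x o ∂P| ≤ B k ω) ∧
      ∫ ω, B k ω ∂μ ≤ K' * sampleRate (beta α k) := by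
  obtain ⟨c, hc, hnet⟩ := exists_net (n := n) R
  refine ⟨c + M ^ 2 / 2 + 1 + 2 * K * n, by positivity, ?_⟩
  suffices H : ∀ k, ∃ B : Θ → ℝ, Measurable B ∧ Integrable B μ ∧ (∀ ω, 0 ≤ B ω) ∧
      (∀ ω, ∀ x ∈ C, |weightedAvg α (fun i => φ x (s i ω)) k - ∫ o, φ x o ∂P| ≤ B ω) ∧
      ∫ ω, B ω ∂μ ≤ (c + M ^ 2 / 2 + 1 + 2 * K * n) * sampleRate (beta α k) by
    choose B hB using H
    exact ⟨B, hB⟩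
  intro k
  set β := beta α k with hβdef
  have hβ : 1 ≤ β := one_le_beta hα k
  have hβ0 : 0 < β := by linarith
  obtain ⟨T, hTC, hTnet, hTcard⟩ := hnet C hC β hβ
  set ℓ : ℝ := 1 + Real.log β with hℓ
  have hℓ1 : 1 ≤ ℓ := by linarith [Real.log_nonneg hβ]
  have hq : √ℓ ^ 2 = ℓ := Real.sq_sqrt (by linarith)
  have hq1 : 1 ≤ √ℓ := Real.one_le_sqrt.2 hℓ1
  -- Since `∑ (α i / A k)² = 1 / β²`, this choice turns the Hoeffding exponent into `M² ℓ / 2`. Then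
  -- `a` is chosen so that `lam * a` equals the entropy `c ℓ` plus this exponent.
  set lam : ℝ := β * √ℓ with hlam
  have hlam0 : 0 < lam := by positivity
  set a : ℝ := (c + M ^ 2 / 2) * √ℓ / β with ha
  have ha0 : 0 ≤ a := by positivity
  have hA := weightSum_pos hα k
  let X : EuclideanSpace ℝ (Fin n) → Θ → ℝ := fun t ω =>
    weightedAvg α (fun i => φ t (s i ω)) k - ∫ o, φ t o ∂P
  have hXeq : ∀ t ω (b : ℝ), b * X t ω = ∑ i ∈ Finset.range (k + 1),
      (b * (α i / weightSum α k)) * (φ t (s i ω) - ∫ o, φ t o ∂P) := by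
    intro t ω b
    have h1 : X t ω = weightedAvg α (fun i => φ t (s i ω) - ∫ o, φ t o ∂P) k := by
      rw [weightedAvg_sub, weightedAvg_const hα]
    rw [h1, weightedAvg_real_eq, Finset.mul_sum]
    exact Finset.sum_congr rfl fun i _ => by ring
  have hXm : ∀ t ∈ T, Measurable (X t) := by
    intro t ht
    have := hφ t (hTC ht)
    refine Measurable.sub_const ?_ _
    simp only [weightedAvg_real_eq]
    exact Finset.measurable_fun_sum _ fun i _ => (this.comp (hs i)).const_mul _
  have hXb : ∀ t ∈ T, ∀ ω, |X t ω| ≤ M + M := by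
    intro t ht ω
    have h1 := hM t (hTC ht)
    refine (abs_sub _ _).trans (add_le_add ?_ (abs_integral_le_of_abs_le h1))
    have h2 := norm_weightedAvg_le hα (fun i => φ t (s i ω)) k
    refine h2.trans ((weightedAvg_mono hα (w := fun _ => M) fun i _ => h1 _).trans ?_)
    rw [weightedAvg_const hα]
  have hint : ∀ t ∈ T, ∀ b : ℝ, Integrable (fun ω => Real.exp (b * X t ω)) μ := by
    intro t ht b
    refine Integrable.of_bound (Real.measurable_exp.comp
      ((hXm t ht).const_mul b)).aestronglyMeasurable (Real.exp (|b| * (M + M)))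
      (Eventually.of_forall fun ω => ?_)
    rw [Real.norm_eq_abs, Real.abs_exp]
    refine Real.exp_le_exp.2 ((le_abs_self _).trans ?_)
    rw [abs_mul]
    exact mul_le_mul_of_nonneg_left (hXb t ht ω) (abs_nonneg _)
  have hsumsq : ∀ b : ℝ, b ^ 2 = lam ^ 2 →
      ∑ i ∈ Finset.range (k + 1), (b * (α i / weightSum α k)) ^ 2 = ℓ := by
    intro b hb
    have h1 : ∀ i, (b * (α i / weightSum α k)) ^ 2 = lam ^ 2 / weightSum α k ^ 2 * α i ^ 2 := by
      intro i; rw [mul_pow, hb]; ring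
    simp only [h1]
    rw [← Finset.mul_sum, hlam, mul_pow, hq, hβdef, beta, div_pow,
      Real.sq_sqrt (Finset.sum_nonneg fun i _ => sq_nonneg _)]
    have h2 : (∑ i ∈ Finset.range (k + 1), α i ^ 2) ≠ 0 :=
      (Finset.sum_pos (fun i _ => pow_pos (hα i) 2) ⟨0, by simp⟩).ne'
    field_simp
  have hexp : ∀ t ∈ T, ∀ b : ℝ, b ^ 2 = lam ^ 2 →
      ∫ ω, Real.exp (b * X t ω) ∂μ ≤ Real.exp (M ^ 2 / 2 * ℓ) := by
    intro t ht b hb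
    simp only [hXeq]
    refine (integral_exp_sum_le hm hs hlaw hind hsm (hφ t (hTC ht)) (hM t (hTC ht)) _ _).trans ?_
    rw [hsumsq b hb]
    exact Real.exp_le_exp.2 (by linarith)
  let S : Θ → ℝ := fun ω => ∑ t ∈ T, (Real.exp (lam * X t ω) + Real.exp (-lam * X t ω))
  have hSm : Measurable S := Finset.measurable_fun_sum _ fun t ht =>
    (Real.measurable_exp.comp ((hXm t ht).const_mul _)).add
      (Real.measurable_exp.comp ((hXm t ht).const_mul _))
  have hTi : ∀ t ∈ T, Integrable (fun ω => Real.exp (lam * X t ω) + Real.exp (-lam * X t ω)) μ :=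
    fun t ht => (hint t ht _).add (hint t ht _)
  have hSi : Integrable S μ := integrable_finsetSum _ hTi
  have hS0 : ∀ ω, 0 ≤ S ω := fun ω => Finset.sum_nonneg fun t _ => by positivity
  have hSE : ∫ ω, S ω ∂μ ≤ Real.exp (lam * a) := by
    have h1 : ∫ ω, S ω ∂μ = ∑ t ∈ T, (∫ ω, Real.exp (lam * X t ω) ∂μ
        + ∫ ω, Real.exp (-lam * X t ω) ∂μ) := by
      change ∫ ω, ∑ t ∈ T, (Real.exp (lam * X t ω) + Real.exp (-lam * X t ω)) ∂μ = _
      rw [integral_finsetSum _ hTi]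
      exact Finset.sum_congr rfl fun t ht => integral_add (hint t ht _) (hint t ht _)
    rw [h1]
    calc _ ≤ ∑ t ∈ T, (2 * Real.exp (M ^ 2 / 2 * ℓ)) := Finset.sum_le_sum fun t ht => by
            have := hexp t ht lam rfl
            have := hexp t ht (-lam) (by ring)
            linarith
      _ = 2 * T.card * Real.exp (M ^ 2 / 2 * ℓ) := by
            rw [Finset.sum_const, nsmul_eq_mul]; ring
      _ ≤ Real.exp (c * ℓ) * Real.exp (M ^ 2 / 2 * ℓ) := by gcongr
      _ = Real.exp (lam * a) := by
            rw [← Real.exp_add]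
            congr 1
            rw [hlam, ha]
            field_simp
            rw [hq]
            ring
  have hBi : Integrable (fun ω => lam⁻¹ * Real.exp (-(lam * a)) * S ω) μ := hSi.const_mul _
  -- The first two terms bound the deviation on the net, where `E[S] ≤ exp (lam * a)`. The last term
  -- is the mesh error `K n / β`, counted once for the sample average and once for the expectation.
  refine ⟨fun ω => a + lam⁻¹ * Real.exp (-(lam * a)) * S ω + 2 * K * n / β, ?_, ?_, ?_, ?_, ?_⟩
  · exact ((hSm.const_mul _).const_add _).add_const _
  · exact ((integrable_const a).add hBi).add (integrable_const _)
  · intro ω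
    have := hS0 ω
    positivity
  · intro ω x hx
    obtain ⟨t, ht, hxt⟩ := hTnet x hx
    have htC := hTC ht
    have h1 : |X t ω| ≤ a + lam⁻¹ * Real.exp (-(lam * a)) * S ω := by
      refine (abs_le_add_exp hlam0 a _ ha0).trans ?_
      gcongr
      exact Finset.single_le_sum
        (f := fun t => Real.exp (lam * X t ω) + Real.exp (-lam * X t ω))
        (fun t _ => by positivity) ht
    have hclose : ∀ o, |φ x o - φ t o| ≤ K * n / β := fun o =>
      (hK x hx t htC o).trans (by
        rw [mul_div_assoc]; exact mul_le_mul_of_nonneg_left hxt hK0)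
    have hi : ∀ y ∈ C, Integrable (φ y) P := fun y hy =>
      Integrable.of_bound (hφ y hy).aestronglyMeasurable M (Eventually.of_forall (hM y hy))
    have h2 : |∫ o, φ x o ∂P - ∫ o, φ t o ∂P| ≤ K * n / β := by
      rw [← integral_sub (hi x hx) (hi t htC)]
      exact abs_integral_le_of_abs_le hclose
    have h3 : |weightedAvg α (fun i => φ x (s i ω)) k - weightedAvg α (fun i => φ t (s i ω)) k|
        ≤ K * n / β := by
      rw [← weightedAvg_sub]
      refine (norm_weightedAvg_le hα (fun i => φ x (s i ω) - φ t (s i ω)) k).trans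
        ((weightedAvg_mono hα (w := fun _ => K * n / β) fun i _ => hclose _).trans ?_)
      rw [weightedAvg_const hα]
    have h4 : 2 * K * n / β = K * n / β + K * n / β := by ring
    change |weightedAvg α (fun i => φ t (s i ω)) k - ∫ o, φ t o ∂P| ≤ _ at h1
    rw [h4]
    rw [abs_le] at h1 h2 h3 ⊢
    constructor <;> linarith
  · have hBa : Integrable (fun ω => a + lam⁻¹ * Real.exp (-(lam * a)) * S ω) μ :=
      (integrable_const a).add hBi
    rw [integral_add hBa (integrable_const _), integral_add (integrable_const a) hBi, integral_const_mul]
    simp only [integral_const, probReal_univ, one_smul]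
    have h1 : lam⁻¹ * Real.exp (-(lam * a)) * ∫ ω, S ω ∂μ ≤ lam⁻¹ := by
      calc _ ≤ lam⁻¹ * Real.exp (-(lam * a)) * Real.exp (lam * a) := by gcongr
        _ = lam⁻¹ := by rw [mul_assoc, ← Real.exp_add]; simp
    have h2 : lam⁻¹ ≤ √ℓ / β := by
      rw [hlam, inv_le_comm₀ (by positivity) (by positivity), inv_div]
      rw [div_le_iff₀ (by positivity)]
      nlinarith
    have h3 : 2 * K * n / β ≤ 2 * K * n * (√ℓ / β) := by
      rw [div_eq_mul_one_div]
      gcongr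
    have h4 : √ℓ / β ≤ sampleRate β := by
      unfold sampleRate
      gcongr
      rw [Real.sqrt_le_iff]
      have := Real.sqrt_nonneg (Real.log β)
      refine ⟨by positivity, ?_⟩
      nlinarith [Real.sq_sqrt (Real.log_nonneg hβ)]
    have h5 : a = (c + M ^ 2 / 2) * (√ℓ / β) := by rw [ha]; ring
    calc _ ≤ (c + M ^ 2 / 2 + 1 + 2 * K * n) * (√ℓ / β) := by linarith
      _ ≤ _ := by gcongr

end UniformLaw

/-! ### Regular families of convex functions -/

section Families

variable {n : ℕ} {Ω : Type*} [MeasurableSpace Ω] {P : Measure Ω}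

/-- A family of convex functions, measurable in the parameter, pointwise bounded and
equicontinuous. -/
structure RegularFamily (φ : EuclideanSpace ℝ (Fin n) → Ω → ℝ) : Prop where
  convex : ∀ s, ConvexOn ℝ univ fun x => φ x s
  measurable : ∀ x, Measurable (φ x)
  equicontinuous : BoundedEquicontinuous φ

theorem continuous_of_convexOn {f : EuclideanSpace ℝ (Fin n) → ℝ} (hf : ConvexOn ℝ univ f) :
    Continuous f := by
  rw [← continuousOn_univ]; exact hf.continuousOn isOpen_univ

theorem convexOn_integral {φ : EuclideanSpace ℝ (Fin n) → Ω → ℝ}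
    (hconv : ∀ s, ConvexOn ℝ univ fun x => φ x s) (hint : ∀ x, Integrable (φ x) P) :
    ConvexOn ℝ univ fun x => ∫ s, φ x s ∂P := by
  refine ⟨convex_univ, fun x _ y _ a b ha hb hab => ?_⟩
  simp only [smul_eq_mul]
  rw [← integral_const_mul, ← integral_const_mul,
    ← integral_add ((hint x).const_mul a) ((hint y).const_mul b)]
  refine integral_mono (hint _) (((hint x).const_mul a).add ((hint y).const_mul b)) fun s => ?_
  exact (hconv s).2 (mem_univ x) (mem_univ y) ha hb hab

variable {φ : EuclideanSpace ℝ (Fin n) → Ω → ℝ}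

omit [MeasurableSpace Ω] in
-- Equicontinuity with `ε = 1` spreads each pointwise bound to a small ball; compactness does the
-- rest.
theorem BoundedEquicontinuous.exists_bound (h : BoundedEquicontinuous φ) (R : ℝ) :
    ∃ M : ℝ, 0 ≤ M ∧ ∀ x, ‖x‖ ≤ R → ∀ s, |φ x s| ≤ M := by
  have hK := isCompact_closedBall (0 : EuclideanSpace ℝ (Fin n)) R
  obtain ⟨M, hM0, hM⟩ := hK.induction_on
    (p := fun S => ∃ M : ℝ, 0 ≤ M ∧ ∀ x ∈ S, ∀ s, |φ x s| ≤ M) ⟨0, le_rfl, by simp⟩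
    (fun S T hST ⟨M, hM0, hM⟩ => ⟨M, hM0, fun x hx => hM x (hST hx)⟩)
    (fun S T ⟨M, hM0, hM⟩ ⟨N, hN0, hN⟩ => ⟨max M N, le_max_of_le_left hM0, fun x hx s =>
      hx.elim (fun h => (hM x h s).trans (le_max_left _ _))
        (fun h => (hN x h s).trans (le_max_right _ _))⟩)
    (fun x _ => by
      obtain ⟨M, hM⟩ := h.1 x
      obtain ⟨δ, hδ, hφ⟩ := h.2 x 1 one_pos
      refine ⟨Metric.ball x δ, mem_nhdsWithin_of_mem_nhds (Metric.ball_mem_nhds x hδ),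
        |M| + 1, by positivity, fun z hz s => ?_⟩
      have h1 := hφ z hz s
      have h2 := (hM s).trans (le_abs_self M)
      have h3 := abs_sub_abs_le_abs_sub (φ z s) (φ x s)
      linarith)
  exact ⟨M, hM0, fun x hx => hM x (by simpa using hx)⟩

namespace RegularFamily

/-- A convex function bounded on a ball is Lipschitz on a smaller concentric one, with a constant
depending only on the bound, hence uniform in `s`. Of the radius `R + 2`, one unit is lost to this
estimate; the other fits the closed ball into an open one. -/
theorem exists_lipschitz (h : RegularFamily φ) (R : ℝ) :
    ∃ K : ℝ, 0 ≤ K ∧ ∀ x, ‖x‖ ≤ R → ∀ y, ‖y‖ ≤ R → ∀ s, |φ x s - φ y s| ≤ K * ‖x - y‖ := by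
  obtain ⟨M, hM0, hM⟩ := h.equicontinuous.exists_bound (R + 2)
  refine ⟨2 * M / 1, by positivity, fun x hx y hy s => ?_⟩
  have hc : ConvexOn ℝ (Metric.ball 0 (R + 2)) fun x => φ x s :=
    (h.convex s).subset (subset_univ _) (convex_ball _ _)
  have hL := hc.lipschitzOnWith_of_abs_le (ε := 1) (M := M) one_pos fun a ha =>
    hM a (by simpa using ha.le) s
  have := hL.dist_le_mul x (by simp; linarith) y (by simp; linarith)
  rwa [Real.dist_eq, dist_eq_norm, Real.coe_toNNReal _ (by positivity)] at this

theorem integrable [IsProbabilityMeasure P] (h : RegularFamily φ) (x : EuclideanSpace ℝ (Fin n)) :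
    Integrable (φ x) P := by
  obtain ⟨M, hM⟩ := h.equicontinuous.1 x
  exact Integrable.of_bound (h.measurable x).aestronglyMeasurable M (Eventually.of_forall hM)

theorem measurable_uncurry (h : RegularFamily φ) : Measurable (Function.uncurry φ) :=
  measurable_uncurry_of_continuous_of_measurable (fun s => continuous_of_convexOn (h.convex s))
    h.measurable

theorem convexOn_integral [IsProbabilityMeasure P] (h : RegularFamily φ) : ConvexOn ℝ univ fun x => ∫ s, φ x s ∂P :=
  SDCA.convexOn_integral h.convex h.integrable

end RegularFamily

namespace Program

variable (p : Program n P)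

/-- The family whose weighted averages the algorithm uses as first component. -/
noncomputable def firstFamily : Variant → EuclideanSpace ℝ (Fin n) → Ω → ℝ
  | .sdca1 => fun x _ => p.G x
  | .sdca2 => p.g

theorem convexOn_G : ConvexOn ℝ univ p.G := convexOn_integral p.g_convex p.g_integrable

theorem convexOn_H : ConvexOn ℝ univ p.H := convexOn_integral p.h_convex p.h_integrable

theorem regularFamily_h {v : Variant} (hA : BasicAssumption p v) : RegularFamily p.h :=
  ⟨p.h_convex, p.h_measurable, by cases v; exacts [hA, hA.2]⟩

/-- For `sdca1` the family is constant in the sample, so both algorithms can be treated as using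
sample averages. -/
theorem regularFamily_firstFamily {v : Variant} (hA : BasicAssumption p v) :
    RegularFamily (p.firstFamily v) := by
  cases v with
  | sdca1 =>
    refine ⟨fun _ => p.convexOn_G, fun x => measurable_const,
      fun x => ⟨|p.G x|, fun _ => le_rfl⟩, fun x ε hε => ?_⟩
    obtain ⟨δ, hδ, h⟩ := Metric.continuous_iff.1 (continuous_of_convexOn p.convexOn_G) x ε hε
    exact ⟨δ, hδ, fun z hz _ => (h z hz).le⟩
  | sdca2 => exact ⟨p.g_convex, p.g_measurable, hA.1⟩

theorem integral_firstFamily [IsProbabilityMeasure P] (v : Variant) (x : EuclideanSpace ℝ (Fin n)) :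
    ∫ s, p.firstFamily v x s ∂P = p.G x := by
  cases v <;> simp [firstFamily, G]

theorem firstComponent_eq {α : ℕ → ℝ} (hα : ∀ k, 0 < α k) (s : ℕ → Ω) (k : ℕ)
    (x : EuclideanSpace ℝ (Fin n)) (v : Variant) :
    firstComponent p α s k x v = weightedAvg α (fun i => p.firstFamily v x (s i)) k := by
  cases v
  · simp only [firstComponent, firstFamily, weightedAvg_const hα]
  · rfl

/-- The integrand `g̃ - h`, where `g̃` is the first component used by the algorithm. -/
noncomputable def diffFamily (v : Variant) (x : EuclideanSpace ℝ (Fin n)) (s : Ω) : ℝ :=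
  p.firstFamily v x s - p.h x s

theorem f_eq {x : EuclideanSpace ℝ (Fin n)} (h1 : p.r₁ x ≠ ⊤) (h2 : p.r₂ x ≠ ⊤) :
    p.f x = ((p.G x - p.H x + ((p.r₁ x).toReal - (p.r₂ x).toReal) : ℝ) : EReal) := by
  rw [f, r, if_neg h1, integral_sub (p.g_integrable x) (p.h_integrable x)]
  rw [← EReal.coe_toReal h1 (p.r₁_ne_bot x), ← EReal.coe_toReal h2 (p.r₂_ne_bot x)]
  simp only [EReal.toReal_coe]
  exact_mod_cast rfl

end Program

end Families

/-! ### Deterministic descent along a single outcome -/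

section Paths

variable {n : ℕ} {Ω : Type*} [MeasurableSpace Ω] {P : Measure Ω}

/-- A single outcome of the algorithm. -/
structure IsPath (p : Program n P) (v : Variant) (α : ℕ → ℝ) (x₀ : EuclideanSpace ℝ (Fin n))
    (s : ℕ → Ω) (x z u : ℕ → EuclideanSpace ℝ (Fin n)) : Prop where
  init_dom : p.r₁ x₀ < ⊤
  init : x 0 = x₀
  z_mem : ∀ k, z k ∈ subdiff (fun y => (p.h y (s k) : EReal)) (x k)
  u_mem : ∀ k, u k ∈ subdiff p.r₂ (x k)
  step : ∀ k, IsMinOn (fun y => ((firstComponent p α s k y v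
      - inner ℝ (weightedAvg α z k + weightedAvg α u k) y : ℝ) : EReal) + p.r₁ y) univ (x (k + 1))

/-- The mean squared displacement `(1/A_k) ∑_{i ≤ k} α_i ‖x_{k+1} - x_i‖²`. -/
noncomputable def spread (α : ℕ → ℝ) (x : ℕ → EuclideanSpace ℝ (Fin n)) (k : ℕ) : ℝ :=
  weightedAvg α (fun i => ‖x (k + 1) - x i‖ ^ 2) k

theorem spread_nonneg {α : ℕ → ℝ} (hα : ∀ k, 0 < α k) (x : ℕ → EuclideanSpace ℝ (Fin n)) (k : ℕ) :
    0 ≤ spread α x k :=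
  weightedAvg_nonneg hα fun _ _ => sq_nonneg _

theorem weightedAvg_dist_le {α : ℕ → ℝ} (hα : ∀ k, 0 < α k) (x : ℕ → EuclideanSpace ℝ (Fin n))
    (k : ℕ) : weightedAvg α (fun i => ‖x (k + 1) - x i‖) k ≤ √(spread α x k) :=
  Real.le_sqrt_of_sq_le (sq_weightedAvg_le hα _ k)

variable {p : Program n P} {v : Variant} {α : ℕ → ℝ} {x₀ : EuclideanSpace ℝ (Fin n)}
  {s : ℕ → Ω} {x z u : ℕ → EuclideanSpace ℝ (Fin n)}

namespace IsPath

theorem r₂_ne_top (h : IsPath p v α x₀ s x z u) (k : ℕ) : p.r₂ (x k) ≠ ⊤ := (h.u_mem k).1.ne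

/-- `x₀` is a competitor of finite value in every subproblem. -/
theorem r₁_ne_top (h : IsPath p v α x₀ s x z u) (k : ℕ) : p.r₁ (x k) ≠ ⊤ := by
  cases k with
  | zero => rw [h.init]; exact h.init_dom.ne
  | succ k =>
    intro htop
    have h1 := isMinOn_iff.1 (h.step k) x₀ (mem_univ _)
    rw [htop, EReal.coe_add_top, ← EReal.coe_toReal h.init_dom.ne (p.r₁_ne_bot x₀),
      ← EReal.coe_add] at h1
    exact absurd h1 (not_le.2 (EReal.coe_lt_top _))

theorem minimizes (hα : ∀ k, 0 < α k) (h : IsPath p v α x₀ s x z u) (k : ℕ)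
    (y : EuclideanSpace ℝ (Fin n)) (hy : p.r₁ y ≠ ⊤) :
    weightedAvg α (fun i => p.firstFamily v (x (k + 1)) (s i)) k
        - inner ℝ (weightedAvg α z k + weightedAvg α u k) (x (k + 1)) + (p.r₁ (x (k + 1))).toReal
      ≤ weightedAvg α (fun i => p.firstFamily v y (s i)) k
        - inner ℝ (weightedAvg α z k + weightedAvg α u k) y + (p.r₁ y).toReal := by
  have h1 := isMinOn_iff.1 (h.step k) y (mem_univ _)
  rw [← EReal.coe_toReal hy (p.r₁_ne_bot y),
    ← EReal.coe_toReal (h.r₁_ne_top (k + 1)) (p.r₁_ne_bot _)] at h1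
  rw [← p.firstComponent_eq hα, ← p.firstComponent_eq hα]
  exact_mod_cast h1

variable (p v s x z u) in
/-- The convex majorant of the sampled objective contributed by step `i`. -/
noncomputable def surrogate (i : ℕ) (y : EuclideanSpace ℝ (Fin n)) : ℝ :=
  p.firstFamily v y (s i) + (p.r₁ y).toReal - p.h (x i) (s i) - inner ℝ (z i) (y - x i)
    - (p.r₂ (x i)).toReal - inner ℝ (u i) (y - x i)

/-- Up to a term independent of `y`, the averaged surrogate is the objective of the `k`-th
subproblem on the domain of `r₁`. -/
theorem surrogate_min (hα : ∀ k, 0 < α k) (h : IsPath p v α x₀ s x z u) (k : ℕ)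
    (y : EuclideanSpace ℝ (Fin n)) (hy : p.r₁ y ≠ ⊤) :
    weightedAvg α (fun i => surrogate p v s x z u i (x (k + 1))) k
      ≤ weightedAvg α (fun i => surrogate p v s x z u i y) k := by
  have key : ∀ y, weightedAvg α (fun i => surrogate p v s x z u i y) k
      = weightedAvg α (fun i => p.firstFamily v y (s i)) k
        - inner ℝ (weightedAvg α z k + weightedAvg α u k) y + (p.r₁ y).toReal
        - weightedAvg α (fun i => p.h (x i) (s i) - inner ℝ (z i) (x i)
            + ((p.r₂ (x i)).toReal - inner ℝ (u i) (x i))) k := by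
    intro y
    have e : (fun i => surrogate p v s x z u i y) = fun i => (p.firstFamily v y (s i)
        - (inner ℝ (z i) y + inner ℝ (u i) y) + (p.r₁ y).toReal)
        - (p.h (x i) (s i) - inner ℝ (z i) (x i)
            + ((p.r₂ (x i)).toReal - inner ℝ (u i) (x i))) := by
      funext i
      simp only [surrogate, inner_sub_right]
      ring
    rw [e, weightedAvg_sub, weightedAvg_add, weightedAvg_sub, weightedAvg_add, weightedAvg_const hα,
      weightedAvg_inner, weightedAvg_inner, inner_add_left]
  rw [key, key]
  linarith [h.minimizes hα k y hy]

/-- The strong subgradient inequalities of `h(·, s i)` and `r₂` at `x i`; their quadratic terms are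
what later sums to the spread. -/
theorem le_surrogate {ρ₁ ρ₂ : ℝ≥0} (h : IsPath p v α x₀ s x z u)
    (h1 : ∀ o, RhoConvex ρ₁ (fun y => (p.h y o : EReal))) (h2 : RhoConvex ρ₂ p.r₂) (i j : ℕ) :
    p.diffFamily v (x j) (s i) + ((p.r₁ (x j)).toReal - (p.r₂ (x j)).toReal)
      + (ρ₁ + ρ₂) / 2 * ‖x j - x i‖ ^ 2 ≤ surrogate p v s x z u i (x j) := by
  have a1 := (h1 (s i)).subdiff_toReal_le (by simp) (h.z_mem i) (y := x j) (by simp)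
  have a2 := h2.subdiff_toReal_le p.r₂_ne_bot (h.u_mem i) (h.r₂_ne_top j)
  simp only [EReal.toReal_coe] at a1
  simp only [surrogate, Program.diffFamily]
  linarith

/-- The descent inequality along a path. -/
theorem descent (hα : ∀ k, 0 < α k) {ρ₁ ρ₂ : ℝ≥0} (h : IsPath p v α x₀ s x z u)
    (h1 : ∀ o, RhoConvex ρ₁ (fun y => (p.h y o : EReal))) (h2 : RhoConvex ρ₂ p.r₂) (K : ℕ) :
    (ρ₁ + ρ₂) / 2 * ∑ k ∈ Finset.range K, α (k + 1) / weightSum α (k + 1) * spread α x k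
      + (weightedAvg α (fun i => p.diffFamily v (x (K + 1)) (s i)) K
        + ((p.r₁ (x (K + 1))).toReal - (p.r₂ (x (K + 1))).toReal))
    ≤ p.diffFamily v (x 0) (s 0) + ((p.r₁ (x 0)).toReal - (p.r₂ (x 0)).toReal)
      + ∑ k ∈ Finset.range K, α (k + 1) / weightSum α (k + 1) *
        (p.diffFamily v (x (k + 1)) (s (k + 1))
          - weightedAvg α (fun i => p.diffFamily v (x (k + 1)) (s i)) k) := by
  -- `W k` is the minimal value of the averaged surrogate at step `k`, the quantity that is
  -- telescoped.
  set W : ℕ → ℝ := fun k => weightedAvg α (fun i => surrogate p v s x z u i (x (k + 1))) k with hW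
  set r : ℕ → ℝ := fun k => (p.r₁ (x k)).toReal - (p.r₂ (x k)).toReal with hr
  have hself : ∀ k, surrogate p v s x z u k (x k) = p.diffFamily v (x k) (s k) + r k := by
    intro k
    simp only [surrogate, Program.diffFamily, sub_self, inner_zero_right, hr]
    ring
  have hlow : ∀ k, weightedAvg α (fun i => p.diffFamily v (x (k + 1)) (s i)) k + r (k + 1)
      + (ρ₁ + ρ₂) / 2 * spread α x k ≤ W k := by
    intro k
    have := weightedAvg_mono hα (k := k) fun i _ => h.le_surrogate h1 h2 i (k + 1)
    rwa [weightedAvg_add, weightedAvg_add, weightedAvg_const hα, weightedAvg_const_mul] at this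
  -- The minimizer `x (k+1)` competes in the next subproblem. There the one new surrogate has `x
  -- (k+1)` as its base point, so it equals the sampled objective by `hself`.
  have hstep : ∀ k, W (k + 1) ≤ W k + α (k + 1) / weightSum α (k + 1) *
      (p.diffFamily v (x (k + 1)) (s (k + 1))
        - weightedAvg α (fun i => p.diffFamily v (x (k + 1)) (s i)) k
        - (ρ₁ + ρ₂) / 2 * spread α x k) := by
    intro k
    have a1 := h.surrogate_min hα (k + 1) (x (k + 1)) (h.r₁_ne_top _)
    rw [weightedAvg_succ hα (fun i => surrogate p v s x z u i (x (k + 1))), hself] at a1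
    refine a1.trans ?_
    have a2 := hlow k
    have a3 : 0 < α (k + 1) / weightSum α (k + 1) := div_pos (hα _) (weightSum_pos hα _)
    change W k + _ * (_ - W k) ≤ _
    exact add_le_add le_rfl (mul_le_mul_of_nonneg_left (by linarith) a3.le)
  have h0 : W 0 ≤ p.diffFamily v (x 0) (s 0) + r 0 := by
    have a1 := h.surrogate_min hα 0 (x 0) (h.r₁_ne_top _)
    have a2 : weightedAvg α (fun i => surrogate p v s x z u i (x 0)) 0
        = surrogate p v s x z u 0 (x 0) := by
      have := (hα 0).ne'
      simp [weightedAvg, weightSum, this]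
    rw [a2, hself] at a1
    exact a1
  have htel : (ρ₁ + ρ₂) / 2 * ∑ k ∈ Finset.range K, α (k + 1) / weightSum α (k + 1) * spread α x k
      + W K ≤ p.diffFamily v (x 0) (s 0) + r 0
      + ∑ k ∈ Finset.range K, α (k + 1) / weightSum α (k + 1) *
        (p.diffFamily v (x (k + 1)) (s (k + 1))
          - weightedAvg α (fun i => p.diffFamily v (x (k + 1)) (s i)) k) := by
    induction K with
    | zero => simpa using h0
    | succ K ih =>
      rw [Finset.sum_range_succ, Finset.sum_range_succ]
      linarith [hstep K]
  have hlowK := hlow K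
  have : 0 ≤ (ρ₁ + ρ₂ : ℝ) / 2 * spread α x K := mul_nonneg (by positivity) (spread_nonneg hα x K)
  linarith

end IsPath

end Paths

/-! ### The random iterates as paths adapted to the past -/

section Sampler

variable {n : ℕ} {Ω : Type*} [MeasurableSpace Ω] {P : Measure Ω}
  {Θ : Type*} [mΘ : MeasurableSpace Θ] {μ : Measure Θ}

/-- `s k` is a sample of `P` that is independent of the past `m k`, which contains the samples
`s i`, `i < k`. -/
structure FreshSampling (P : Measure Ω) (μ : Measure Θ) (m : ℕ → MeasurableSpace Θ)
    (s : ℕ → Θ → Ω) : Prop where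
  le : ∀ k, m k ≤ mΘ
  measurable : ∀ k, Measurable (s k)
  law : ∀ k, μ.map (s k) = P
  indep : ∀ k, Indep (MeasurableSpace.comap (s k) inferInstance) (m k) μ
  past : ∀ k, ∀ i < k, Measurable[m k] (s i)

omit mΘ in
theorem measurable_past_x (s : ℕ → Θ → Ω) (x z u : ℕ → Θ → EuclideanSpace ℝ (Fin n)) {i k : ℕ}
    (h : i ≤ k) : Measurable[past s x z u k] (x i) := by
  refine Measurable.of_comap_le ?_
  refine le_trans ?_ (le_sup_left.trans le_sup_left)
  exact le_trans (le_iSup₂_of_le i h le_rfl) le_sup_right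

omit mΘ in
theorem measurable_past_s (s : ℕ → Θ → Ω) (x z u : ℕ → Θ → EuclideanSpace ℝ (Fin n)) {i k : ℕ}
    (h : i < k) : Measurable[past s x z u k] (s i) := by
  refine Measurable.of_comap_le ?_
  refine le_trans ?_ (le_sup_left.trans le_sup_left)
  exact le_trans (le_iSup₂_of_le i h le_rfl) le_sup_left

variable {p : Program n P} {v : Variant} {α : ℕ → ℝ} {x₀ : EuclideanSpace ℝ (Fin n)}
  {s : ℕ → Θ → Ω} {x z u : ℕ → Θ → EuclideanSpace ℝ (Fin n)}

theorem IsGenerated.freshSampling (h : IsGenerated p v α μ x₀ s x z u) :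
    FreshSampling P μ (past s x z u) s where
  le k := by
    refine sup_le (sup_le (sup_le ?_ ?_) ?_) ?_
    · exact iSup₂_le fun i _ => (h.measurable_s i).comap_le
    · exact iSup₂_le fun i _ => (h.measurable_x i).comap_le
    · exact iSup₂_le fun i _ => (h.measurable_z i).comap_le
    · exact iSup₂_le fun i _ => (h.measurable_u i).comap_le
  measurable := h.measurable_s
  law := h.law
  indep := h.fresh
  past k i hi := measurable_past_s s x z u hi

theorem IsGenerated.ae_isPath (h : IsGenerated p v α μ x₀ s x z u) :
    ∀ᵐ ω ∂μ, IsPath p v α x₀ (fun i => s i ω) (fun i => x i ω) (fun i => z i ω)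
      (fun i => u i ω) := by
  filter_upwards [h.init, h.z_mem, h.u_mem, h.step] with ω h1 h2 h3 h4
  exact ⟨h.init_dom, h1, h2, h3, h4⟩

theorem measurable_spread (hx : ∀ k, Measurable (x k)) (k : ℕ) :
    Measurable fun ω => spread α (fun i => x i ω) k := by
  simp only [spread, weightedAvg_real_eq]
  exact Finset.measurable_fun_sum _ fun i _ =>
    (((hx (k + 1)).sub (hx i)).norm.pow_const 2).const_mul _

end Sampler

/-! ### Martingale noise and almost sure consequences of mean bounds -/

section Noise

variable {n : ℕ} {Ω : Type*} [MeasurableSpace Ω] {P : Measure Ω} [IsProbabilityMeasure P]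
  {Θ : Type*} [mΘ : MeasurableSpace Θ] {μ : Measure Θ} [IsProbabilityMeasure μ]

/-- Weighted sums of centred functions of fresh samples have mean zero and bounded second
moments. -/
theorem noise_moments {X : Type*} [MeasurableSpace X] {m : ℕ → MeasurableSpace Θ} {s : ℕ → Θ → Ω}
    (hF : FreshSampling P μ m s) {x : ℕ → Θ → X} (hx : ∀ k, ∀ i ≤ k, Measurable[m k] (x i))
    {θ : X → Ω → ℝ} (hθ : Measurable (Function.uncurry θ)) {M : ℝ} (hM : ∀ y o, |θ y o| ≤ M)
    (hθ0 : ∀ y, ∫ o, θ y o ∂P = 0) (w : ℕ → ℝ) (K : ℕ) :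
    let N : Θ → ℝ := fun ω => ∑ k ∈ Finset.range K, w k * θ (x (k + 1) ω) (s (k + 1) ω)
    Measurable N ∧ Integrable N μ ∧ Integrable (fun ω => N ω ^ 2) μ ∧ ∫ ω, N ω ∂μ = 0 ∧
      ∫ ω, N ω ^ 2 ∂μ ≤ M ^ 2 * ∑ k ∈ Finset.range K, w k ^ 2 := by
  intro N
  let T : ℕ → Θ → ℝ := fun k ω => θ (x (k + 1) ω) (s (k + 1) ω)
  let S : ℕ → Θ → ℝ := fun K ω => ∑ k ∈ Finset.range K, w k * T k ω
  have hxm : ∀ k, Measurable (x k) := fun k => (hx k k le_rfl).mono (hF.le k) le_rfl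
  have hTm : ∀ k, Measurable (T k) := fun k => hθ.comp ((hxm _).prodMk (hF.measurable _))
  have hTb : ∀ k ω, |T k ω| ≤ M := fun k ω => hM _ _
  -- Index shift: `S K` involves samples up to index `K` only, so it is known before `s (K + 1)`,
  -- the sample in `T K`, is drawn.
  have hSpast : ∀ K, Measurable[m (K + 1)] (S K) := by
    intro K
    refine Finset.measurable_fun_sum _ fun k hk => ?_
    have hk' := Finset.mem_range.1 hk
    have : Measurable[m (K + 1)] (T k) :=
      hθ.comp ((hx (K + 1) (k + 1) (by lia)).prodMk (hF.past (K + 1) (k + 1) (by lia)))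
    exact this.const_mul _
  have hSm : ∀ K, Measurable (S K) := fun K => (hSpast K).mono (hF.le _) le_rfl
  have hSb : ∀ K ω, |S K ω| ≤ ∑ k ∈ Finset.range K, |w k| * M := by
    intro K ω
    refine (Finset.abs_sum_le_sum_abs _ _).trans (Finset.sum_le_sum fun k _ => ?_)
    rw [abs_mul]
    exact mul_le_mul_of_nonneg_left (hTb k ω) (abs_nonneg _)
  have hSi : ∀ K, Integrable (S K) μ := fun K =>
    Integrable.of_bound (hSm K).aestronglyMeasurable _ (Eventually.of_forall (hSb K))
  have hSi2 : ∀ K, Integrable (fun ω => S K ω ^ 2) μ := fun K => by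
    refine Integrable.of_bound ((hSm K).pow_const 2).aestronglyMeasurable
      ((∑ k ∈ Finset.range K, |w k| * M) ^ 2) (Eventually.of_forall fun ω => ?_)
    rw [norm_pow]
    exact pow_le_pow_left₀ (norm_nonneg _) (hSb K ω) 2
  have horth : ∀ K, ∀ ξ : Θ → ℝ, Measurable[m (K + 1)] ξ → ∀ c : ℝ, (∀ ω, |ξ ω| ≤ c) →
      ∫ ω, ξ ω * T K ω ∂μ = 0 := fun K ξ hξ c hc =>
    integral_mul_fresh_eq_zero (hF.le (K + 1)) (hF.measurable (K + 1)) (hF.law (K + 1))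
      (hF.indep (K + 1)) (hx (K + 1) (K + 1) le_rfl) hξ hc hθ hM hθ0
  have hTi : ∀ k, Integrable (T k) μ := fun k =>
    Integrable.of_bound (hTm k).aestronglyMeasurable _ (Eventually.of_forall (hTb k))
  have hTi2 : ∀ k, Integrable (fun ω => T k ω ^ 2) μ := fun k => by
    refine Integrable.of_bound ((hTm k).pow_const 2).aestronglyMeasurable
      (M ^ 2) (Eventually.of_forall fun ω => ?_)
    rw [norm_pow]
    exact pow_le_pow_left₀ (norm_nonneg _) (hTb k ω) 2
  have hT2 : ∀ k, ∫ ω, T k ω ^ 2 ∂μ ≤ M ^ 2 := fun k => by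
    have := integral_mono (hTi2 k) (integrable_const (M ^ 2)) fun ω =>
      sq_le_sq' (abs_le.1 (hTb k ω)).1 (abs_le.1 (hTb k ω)).2
    simpa using this
  refine ⟨hSm K, hSi K, hSi2 K, ?_, ?_⟩
  · change ∫ ω, ∑ k ∈ Finset.range K, w k * T k ω ∂μ = 0
    rw [integral_finsetSum _ fun k _ => (hTi k).const_mul _]
    refine Finset.sum_eq_zero fun k _ => ?_
    have := horth k (fun _ => w k) measurable_const |w k| fun _ => le_rfl
    exact this
  · change ∫ ω, S K ω ^ 2 ∂μ ≤ _
    induction K with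
    | zero => simp [S]
    | succ K ih =>
      have e : (fun ω => S (K + 1) ω ^ 2) = fun ω =>
          (S K ω ^ 2 + 2 * w K * (S K ω * T K ω)) + w K ^ 2 * T K ω ^ 2 := by
        funext ω
        simp only [S, Finset.sum_range_succ]
        ring
      have hSTi : Integrable (fun ω => S K ω * T K ω) μ :=
        (hTi K).bdd_mul (hSm K).aestronglyMeasurable (Eventually.of_forall (hSb K))
      have hi1 : Integrable (fun ω => S K ω ^ 2 + 2 * w K * (S K ω * T K ω)) μ :=
        (hSi2 K).add (hSTi.const_mul _)
      rw [e, integral_add hi1 ((hTi2 K).const_mul _),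
        integral_add (hSi2 K) (hSTi.const_mul _), integral_const_mul, integral_const_mul,
        horth K (S K) (hSpast K) _ (hSb K), Finset.sum_range_succ]
      have := mul_le_mul_of_nonneg_left (hT2 K) (sq_nonneg (w K))
      have ih' := ih
      linarith

omit [IsProbabilityMeasure μ] in
/-- Nonnegative functions with bounded integrals are, almost surely, frequently bounded. -/
theorem ae_frequently_le_of_integral_le {Q : ℕ → Θ → ℝ} (hm : ∀ k, Measurable (Q k))
    (h0 : ∀ k ω, 0 ≤ Q k ω) (hi : ∀ k, Integrable (Q k) μ) {c : ℝ} (hc : ∀ k, ∫ ω, Q k ω ∂μ ≤ c) :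
    ∀ᵐ ω ∂μ, ∃ b : ℝ, ∃ᶠ k in atTop, Q k ω ≤ b := by
  have hmE : ∀ k, Measurable fun ω => ENNReal.ofReal (Q k ω) := fun k => (hm k).ennreal_ofReal
  have h1 : ∫⁻ ω, liminf (fun k => ENNReal.ofReal (Q k ω)) atTop ∂μ ≤ ENNReal.ofReal c := by
    refine (lintegral_liminf_le hmE).trans ?_
    refine liminf_le_of_frequently_le (Frequently.of_forall fun k => ?_) (by isBoundedDefault)
    rw [← ofReal_integral_eq_lintegral_ofReal (hi k) (Eventually.of_forall (h0 k))]
    exact ENNReal.ofReal_le_ofReal (hc k)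
  have h2 := ae_lt_top (Measurable.liminf hmE) (h1.trans_lt ENNReal.ofReal_lt_top).ne
  filter_upwards [h2] with ω hω
  obtain ⟨b, hb1, hb2⟩ := exists_between hω
  refine ⟨b.toReal, (frequently_lt_of_liminf_lt (by isBoundedDefault) hb1).mono fun k hk => ?_⟩
  rw [← ENNReal.toReal_ofReal (h0 k ω)]
  exact ENNReal.toReal_mono hb2.ne hk.le

omit [IsProbabilityMeasure μ] in
/-- Nonnegative functions with summable integrals tend to zero almost surely. -/
theorem ae_tendsto_zero_of_tsum_lintegral {F : ℕ → Θ → ℝ≥0∞} (hm : ∀ j, Measurable (F j))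
    (h : ∑' j, ∫⁻ ω, F j ω ∂μ ≠ ⊤) : ∀ᵐ ω ∂μ, Tendsto (fun j => F j ω) atTop (𝓝 0) := by
  rw [← lintegral_tsum fun j => (hm j).aemeasurable] at h
  filter_upwards [ae_lt_top (Measurable.tsum hm) h] with ω hω
  have := ENNReal.tendsto_cofinite_zero_of_tsum_ne_top hω.ne
  rwa [Nat.cofinite_eq_atTop] at this

end Noise

/-! ### Control of the weighted spreads -/

section Spread

variable {n : ℕ} {Ω : Type*} [MeasurableSpace Ω] {P : Measure Ω} [IsProbabilityMeasure P]
  {Θ : Type*} [mΘ : MeasurableSpace Θ] {μ : Measure Θ} [IsProbabilityMeasure μ]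
  {p : Program n P} {v : Variant} {α : ℕ → ℝ} {x₀ : EuclideanSpace ℝ (Fin n)}
  {s : ℕ → Θ → Ω} {x z u : ℕ → Θ → EuclideanSpace ℝ (Fin n)}

theorem RegularFamily.exists_uniform_bound {φ : EuclideanSpace ℝ (Fin n) → Ω → ℝ}
    (h : RegularFamily φ) {m : ℕ → MeasurableSpace Θ} (hF : FreshSampling P μ m s)
    (hα : ∀ k, 0 < α k) (R : ℝ) :
    ∃ K' : ℝ, 0 ≤ K' ∧ ∃ B : ℕ → Θ → ℝ, ∀ k, Measurable (B k) ∧ Integrable (B k) μ ∧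
      (∀ ω, 0 ≤ B k ω) ∧
      (∀ ω, ∀ x, ‖x‖ ≤ R → |weightedAvg α (fun i => φ x (s i ω)) k - ∫ o, φ x o ∂P| ≤ B k ω) ∧
      ∫ ω, B k ω ∂μ ≤ K' * sampleRate (beta α k) := by
  obtain ⟨M, hM0, hM⟩ := h.equicontinuous.exists_bound R
  obtain ⟨K, hK0, hK⟩ := h.exists_lipschitz R
  obtain ⟨K', hK', B, hB⟩ := SDCA.exists_uniform_bound (P := P) (μ := μ) hF.le hF.measurable hF.law
    hF.indep hF.past hα (φ := φ) (C := Metric.closedBall 0 R) hK0 subset_rfl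
    (fun x _ => h.measurable x) (fun x hx => hM x (by simpa using hx))
    (fun x hx y hy => hK x (by simpa using hx) y (by simpa using hy))
  refine ⟨K', hK', B, fun k => ?_⟩
  obtain ⟨h1, h2, h3, h4, h5⟩ := hB k
  exact ⟨h1, h2, h3, fun ω x hx => h4 ω x (by simpa using hx), h5⟩

/-- On a ball, the weighted sum of the spreads is controlled by random variables with bounded
means. -/
theorem exists_spread_control (hα : AdmissibleWeights α) (hA : BasicAssumption p v)
    {ρ₁ ρ₂ : ℝ≥0} (h1 : ∀ o, RhoConvex ρ₁ (fun y => (p.h y o : EReal))) (h2 : RhoConvex ρ₂ p.r₂)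
    {a : ℝ} (ha : ∀ y, (a : EReal) ≤ p.f y) (hgen : IsGenerated p v α μ x₀ s x z u) (R : ℝ) :
    ∃ c : ℝ, ∃ Q N : ℕ → Θ → ℝ, (∀ K, Measurable (Q K) ∧ Measurable (N K) ∧ (∀ ω, 0 ≤ Q K ω) ∧
      Integrable (Q K) μ ∧ Integrable (N K) μ ∧ ∫ ω, N K ω ∂μ = 0 ∧ ∫ ω, |N K ω| ∂μ ≤ c ∧
      ∫ ω, Q K ω ∂μ ≤ c) ∧
      ∀ᵐ ω ∂μ, (∀ k, ‖x k ω‖ ≤ R) → ∀ K, (ρ₁ + ρ₂) / 2 * ∑ k ∈ Finset.range K,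
        α (k + 1) / weightSum α (k + 1) * spread α (fun i => x i ω) k ≤ c + Q K ω + N K ω := by
  have hF := hgen.freshSampling
  have hg := p.regularFamily_firstFamily hA
  have hh := p.regularFamily_h hA
  obtain ⟨Mg, hMg0, hMg⟩ := hg.equicontinuous.exists_bound R
  obtain ⟨Mh, hMh0, hMh⟩ := hh.equicontinuous.exists_bound R
  obtain ⟨Kg, hKg0, Bg, hBg⟩ := hg.exists_uniform_bound hF hα.pos R
  obtain ⟨Kh, hKh0, Bh, hBh⟩ := hh.exists_uniform_bound hF hα.pos R
  set w : ℕ → ℝ := fun k => α (k + 1) / weightSum α (k + 1) with hw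
  have hw0 : ∀ k, 0 < w k := fun k => div_pos (hα.pos _) (weightSum_pos hα.pos _)
  -- The cutoff gives a centred function bounded on the whole space, so the martingale estimates
  -- hold without assuming bounded iterates; on paths inside the ball it changes nothing.
  set θ : EuclideanSpace ℝ (Fin n) → Ω → ℝ := fun y o =>
    if ‖y‖ ≤ R then p.diffFamily v y o - (p.G y - p.H y) else 0 with hθ
  have hGc := continuous_of_convexOn p.convexOn_G
  have hHc := continuous_of_convexOn p.convexOn_H
  have hdm : Measurable (Function.uncurry (p.diffFamily v)) :=
    hg.measurable_uncurry.sub hh.measurable_uncurry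
  have hθm : Measurable (Function.uncurry θ) := by
    refine Measurable.ite (measurableSet_le measurable_fst.norm measurable_const) ?_
      measurable_const
    exact hdm.sub ((hGc.measurable.sub hHc.measurable).comp measurable_fst)
  have hdint : ∀ y, Integrable (p.diffFamily v y) P := fun y => (hg.integrable y).sub (hh.integrable y)
  have hdI : ∀ y, ∫ o, p.diffFamily v y o ∂P = p.G y - p.H y := by
    intro y
    simp only [Program.diffFamily]
    rw [integral_sub (hg.integrable y) (hh.integrable y), p.integral_firstFamily]
    rfl
  have hdb : ∀ y, ‖y‖ ≤ R → ∀ o, |p.diffFamily v y o| ≤ Mg + Mh := fun y hy o =>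
    (abs_sub _ _).trans (add_le_add (hMg y hy o) (hMh y hy o))
  have hθb : ∀ y o, |θ y o| ≤ 2 * (Mg + Mh) := by
    intro y o
    simp only [hθ]
    split_ifs with hy
    · refine (abs_sub _ _).trans ?_
      have a1 := hdb y hy o
      have a2 := abs_integral_le_of_abs_le (P := P) (hdb y hy)
      rw [hdI] at a2
      linarith
    · rw [abs_zero]; positivity
  have hθ0 : ∀ y, ∫ o, θ y o ∂P = 0 := by
    intro y
    simp only [hθ]
    split_ifs with hy
    · rw [integral_sub (hdint y) (integrable_const _), hdI]; simp
    · simp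
  have hN := noise_moments hF (fun k i hi => measurable_past_x s x z u hi) hθm hθb hθ0 w
  set N : ℕ → Θ → ℝ := fun K ω => ∑ k ∈ Finset.range K, w k * θ (x (k + 1) ω) (s (k + 1) ω)
    with hNdef
  set B : ℕ → Θ → ℝ := fun k ω => Bg k ω + Bh k ω with hB
  have hBi : ∀ k, Integrable (B k) μ := fun k => (hBg k).2.1.add (hBh k).2.1
  have hBm : ∀ k, Measurable (B k) := fun k => (hBg k).1.add (hBh k).1
  have hB0 : ∀ k ω, 0 ≤ B k ω := fun k ω => add_nonneg ((hBg k).2.2.1 ω) ((hBh k).2.2.1 ω)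
  have hBE : ∀ k, ∫ ω, B k ω ∂μ ≤ (Kg + Kh) * sampleRate (beta α k) := by
    intro k
    rw [integral_add (hBg k).2.1 (hBh k).2.1, add_mul]
    exact add_le_add (hBg k).2.2.2.2 (hBh k).2.2.2.2
  have hBu : ∀ k ω y, ‖y‖ ≤ R →
      |weightedAvg α (fun i => p.diffFamily v y (s i ω)) k - (p.G y - p.H y)| ≤ B k ω := by
    intro k ω y hy
    have a1 := (hBg k).2.2.2.1 ω y hy
    have a2 := (hBh k).2.2.2.1 ω y hy
    rw [p.integral_firstFamily] at a1
    simp only [Program.diffFamily]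
    rw [weightedAvg_sub]
    change |_ - p.H y| ≤ _ at a2
    rw [abs_le] at a1 a2 ⊢
    simp only [hB]
    constructor <;> linarith
  -- The sum collects the uniform deviations in the telescoped noise; the extra `B K` pays for
  -- replacing the final sample average by the true objective, which is at least `a`.
  set Q : ℕ → Θ → ℝ := fun K ω => ∑ k ∈ Finset.range K, w k * B k ω + B K ω with hQ
  have hsi : ∀ K, Integrable (fun ω => ∑ k ∈ Finset.range K, w k * B k ω) μ := fun K =>
    integrable_finsetSum _ fun k _ => (hBi k).const_mul _
  set E : ℝ := ∑' k, w k * sampleRate (beta α k) with hE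
  set V : ℝ := ∑' k, w k ^ 2 with hV
  set c₁ : ℝ := Mg + Mh + ((p.r₁ x₀).toReal - (p.r₂ x₀).toReal) - a with hc₁
  set c₂ : ℝ := (Kg + Kh) * (E + 2) with hc₂
  set c₃ : ℝ := 1 + (2 * (Mg + Mh)) ^ 2 * V with hc₃
  have hr0 : ∀ k, 0 < sampleRate (beta α k) := fun k => sampleRate_pos (one_le_beta hα.pos k)
  refine ⟨max c₁ (max c₂ c₃), Q, N, fun K => ⟨?_, (hN K).1, ?_, ?_, (hN K).2.1, (hN K).2.2.2.1,
    ?_, ?_⟩, ?_⟩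
  · exact (Finset.measurable_fun_sum _ fun k _ => (hBm k).const_mul _).add (hBm K)
  · intro ω
    exact add_nonneg (Finset.sum_nonneg fun k _ => mul_nonneg (hw0 k).le (hB0 k ω)) (hB0 K ω)
  · exact (hsi K).add (hBi K)
  · refine le_trans ?_ ((le_max_right c₂ c₃).trans (le_max_right _ _))
    have hi : Integrable (fun ω => 1 + N K ω ^ 2) μ := (integrable_const _).add (hN K).2.2.1
    refine (integral_mono (hN K).2.1.abs hi fun ω => ?_).trans ?_
    · have : |N K ω| ≤ 1 + N K ω ^ 2 := by
        rw [← sq_abs]; nlinarith [sq_nonneg (|N K ω| - 1), abs_nonneg (N K ω)]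
      exact this
    · rw [integral_add (integrable_const _) (hN K).2.2.1]
      simp only [integral_const, probReal_univ, one_smul]
      have a1 := (hN K).2.2.2.2
      have a2 := hα.summable_sq.sum_le_tsum (Finset.range K) fun k _ => sq_nonneg _
      have a3 := mul_le_mul_of_nonneg_left a2 (sq_nonneg (2 * (Mg + Mh)))
      exact add_le_add le_rfl (a1.trans a3)
  · refine le_trans ?_ ((le_max_left c₂ c₃).trans (le_max_right _ _))
    simp only [hQ]
    rw [integral_add (hsi K) (hBi K), integral_finsetSum _ fun k _ => (hBi k).const_mul _]
    have a1 : ∑ k ∈ Finset.range K, ∫ ω, w k * B k ω ∂μ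
        ≤ (Kg + Kh) * ∑ k ∈ Finset.range K, w k * sampleRate (beta α k) := by
      rw [Finset.mul_sum]
      refine Finset.sum_le_sum fun k _ => ?_
      rw [integral_const_mul]
      have := mul_le_mul_of_nonneg_left (hBE k) (hw0 k).le
      linarith
    have a2 := hα.summable_sampleRate.sum_le_tsum (Finset.range K) fun k _ =>
      (mul_pos (hw0 k) (hr0 k)).le
    have a3 := mul_le_mul_of_nonneg_left a2 (add_nonneg hKg0 hKh0)
    have a4 := mul_le_mul_of_nonneg_left (sampleRate_le_two (one_le_beta hα.pos K))
      (add_nonneg hKg0 hKh0)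
    have a5 := hBE K
    rw [hc₂, mul_add]
    exact add_le_add (a1.trans a3) (a5.trans a4)
  · filter_upwards [hgen.ae_isPath] with ω hω hR K
    have a1 := hω.descent hα.pos h1 h2 K
    have a2 := ha (x (K + 1) ω)
    rw [p.f_eq (hω.r₁_ne_top _) (hω.r₂_ne_top _)] at a2
    have a3 := EReal.coe_le_coe_iff.1 a2
    have a4 := (abs_le.1 (hBu K ω _ (hR (K + 1)))).1
    have a5 := (abs_le.1 (hdb _ (hR 0) (s 0 ω))).2
    have a6 : x 0 ω = x₀ := hω.init
    -- Each noise term is split at `G - H`: sample minus expectation goes to `N`, expectation minus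
    -- sample average to `B`.
    have a7 : ∑ k ∈ Finset.range K, w k *
        (p.diffFamily v (x (k + 1) ω) (s (k + 1) ω)
          - weightedAvg α (fun i => p.diffFamily v (x (k + 1) ω) (s i ω)) k)
        ≤ N K ω + ∑ k ∈ Finset.range K, w k * B k ω := by
      simp only [hNdef]
      rw [← Finset.sum_add_distrib]
      refine Finset.sum_le_sum fun k _ => ?_
      rw [← mul_add]
      refine mul_le_mul_of_nonneg_left ?_ (hw0 k).le
      simp only [hθ, if_pos (hR (k + 1))]
      have := (abs_le.1 (hBu k ω _ (hR (k + 1)))).1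
      linarith
    have a8 : c₁ ≤ max c₁ (max c₂ c₃) := le_max_left _ _
    simp only [hQ]
    rw [a6] at a1 a5
    linarith

end Spread

/-! ### Limit points along good indices are critical -/

section Limits

variable {n : ℕ} {Ω : Type*} [MeasurableSpace Ω] {P : Measure Ω}

theorem exists_norm_le_of_limsup {x : ℕ → EuclideanSpace ℝ (Fin n)}
    (h : limsup (fun k => ‖x k‖ₑ) atTop < ⊤) : ∃ R : ℕ, ∀ k, ‖x k‖ ≤ R := by
  obtain ⟨b, hb1, hb2⟩ := exists_between h
  have h1 : IsBoundedUnder (· ≤ ·) atTop fun k => ‖x k‖ := by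
    refine ⟨b.toReal, ?_⟩
    rw [eventually_map]
    filter_upwards [eventually_lt_of_limsup_lt hb1 (by isBoundedDefault)] with k hk
    rw [← toReal_enorm]
    exact ENNReal.toReal_mono hb2.ne hk.le
  obtain ⟨R, hR⟩ := h1.bddAbove_range
  obtain ⟨N, hN⟩ := exists_nat_ge R
  exact ⟨N, fun k => (hR (mem_range_self k)).trans hN⟩

theorem le_of_lowerSemicontinuous_of_tendsto {f : EuclideanSpace ℝ (Fin n) → EReal}
    (hf : LowerSemicontinuous f) {a : ℕ → EuclideanSpace ℝ (Fin n)}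
    {y : EuclideanSpace ℝ (Fin n)} (ha : Tendsto a atTop (𝓝 y)) {c : ℕ → ℝ} {c₀ : ℝ}
    (hc : Tendsto c atTop (𝓝 c₀)) (h : ∀ j, f (a j) ≤ c j) : f y ≤ c₀ := by
  refine le_of_forall_lt_imp_le_of_dense fun b hb => ?_
  refine ge_of_tendsto (continuous_coe_real_ereal.continuousAt.tendsto.comp hc) ?_
  filter_upwards [ha.eventually (hf y b hb)] with j hj
  exact hj.le.trans (h j)

variable {p : Program n P} {v : Variant} {α : ℕ → ℝ} {x₀ : EuclideanSpace ℝ (Fin n)}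
  {s : ℕ → Ω} {x z u : ℕ → EuclideanSpace ℝ (Fin n)}

/-- Along indices for which the spread vanishes and the sample averages converge, limit points of
the path are critical. -/
theorem IsPath.isCritical (hα : ∀ k, 0 < α k) (hA : BasicAssumption p v)
    (h : IsPath p v α x₀ s x z u) {k : ℕ → ℕ}
    (hspread : Tendsto (fun j => spread α x (k j)) atTop (𝓝 0))
    (hunif : ∀ R : ℕ, ∃ B : ℕ → ℝ, Tendsto B atTop (𝓝 0) ∧ ∀ j y, ‖y‖ ≤ R →
      |weightedAvg α (fun i => p.firstFamily v y (s i)) (k j) - p.G y| ≤ B j ∧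
      |weightedAvg α (fun i => p.h y (s i)) (k j) - p.H y| ≤ B j)
    {R : ℕ} (hx : ∀ i, ‖x i‖ ≤ R) {U : ℝ} (hu : ∀ i, ‖u i‖ ≤ U)
    {y : EuclideanSpace ℝ (Fin n)} (hy : MapClusterPt y atTop fun j => x (k j + 1)) :
    p.IsCritical y := by
  have hh := p.regularFamily_h hA
  obtain ⟨Mh, hMh0, hMh⟩ := hh.equicontinuous.exists_bound (R + 1)
  obtain ⟨K, hK0, hK⟩ := hh.exists_lipschitz R
  have hz : ∀ i, ‖z i‖ ≤ 2 * Mh := fun i =>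
    norm_le_of_mem_subdiff (fun x hx' => hMh x hx' (s i)) (hx i) (h.z_mem i)
  have hu0 : 0 ≤ U := (norm_nonneg _).trans (hu 0)
  obtain ⟨ψ₁, hψ₁, hy₁⟩ := hy.tendsto_subseq
  have havg : ∀ (a : ℕ → EuclideanSpace ℝ (Fin n)) (M : ℝ), (∀ i, ‖a i‖ ≤ M) → ∀ l,
      ‖weightedAvg α a l‖ ≤ M := fun a M ha l =>
    (norm_weightedAvg_le hα a l).trans ((weightedAvg_mono hα (w := fun _ => M) fun i _ =>
      ha i).trans (weightedAvg_const hα M l).le)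
  obtain ⟨⟨ŷ, ŵ⟩, -, ψ₂, hψ₂, hzw⟩ := tendsto_subseq_of_bounded
    (Metric.isBounded_closedBall (x := (0 : EuclideanSpace ℝ (Fin n) × EuclideanSpace ℝ (Fin n)))
      (r := max (2 * Mh) U))
    (x := fun j => (weightedAvg α z (k (ψ₁ j)), weightedAvg α u (k (ψ₁ j)))) (fun j => by
      rw [mem_closedBall_zero_iff, Prod.norm_def]
      exact max_le_max (havg z _ hz _) (havg u _ hu _))
  set ψ : ℕ → ℕ := fun j => ψ₁ (ψ₂ j) with hψ
  have hψt : Tendsto ψ atTop atTop := hψ₁.tendsto_atTop.comp hψ₂.tendsto_atTop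
  set X : ℕ → EuclideanSpace ℝ (Fin n) := fun j => x (k (ψ j) + 1) with hX
  have hXy : Tendsto X atTop (𝓝 y) := hy₁.comp hψ₂.tendsto_atTop
  have hzy : Tendsto (fun j => weightedAvg α z (k (ψ j))) atTop (𝓝 ŷ) :=
    (continuous_fst.tendsto _).comp hzw
  have huw : Tendsto (fun j => weightedAvg α u (k (ψ j))) atTop (𝓝 ŵ) :=
    (continuous_snd.tendsto _).comp hzw
  -- The mean displacement, at most the root of the spread; every error made by moving from `x i` to
  -- `X j` is a multiple of it.
  set d : ℕ → ℝ := fun j => weightedAvg α (fun i => ‖x (k (ψ j) + 1) - x i‖) (k (ψ j)) with hd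
  have hd0 : Tendsto d atTop (𝓝 0) := by
    have h1 : Tendsto (fun j => √(spread α x (k (ψ j)))) atTop (𝓝 0) := by
      have := (Real.continuous_sqrt.tendsto 0).comp (hspread.comp hψt)
      rw [Real.sqrt_zero] at this
      exact this
    exact squeeze_zero (fun j => weightedAvg_nonneg hα fun i _ => norm_nonneg _)
      (fun j => weightedAvg_dist_le hα x _) h1
  have hGc := continuous_of_convexOn p.convexOn_G
  have hHc := continuous_of_convexOn p.convexOn_H
  have hlim : ∀ q : ℕ → EuclideanSpace ℝ (Fin n), ∀ q₀, Tendsto q atTop (𝓝 q₀) →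
      ∀ R : ℕ, (∀ j, ‖q j‖ ≤ R) →
      Tendsto (fun j => weightedAvg α (fun i => p.firstFamily v (q j) (s i)) (k (ψ j))) atTop
        (𝓝 (p.G q₀)) ∧
      Tendsto (fun j => weightedAvg α (fun i => p.h (q j) (s i)) (k (ψ j))) atTop
        (𝓝 (p.H q₀)) := by
    intro q q₀ hq R hR
    obtain ⟨B, hB, hBu⟩ := hunif R
    have hB' := hB.comp hψt
    have aux : ∀ (a : ℕ → ℝ) (F : EuclideanSpace ℝ (Fin n) → ℝ), Continuous F →
        (∀ j, |a j - F (q j)| ≤ B (ψ j)) → Tendsto a atTop (𝓝 (F q₀)) := by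
      intro a F hF ha
      have h1 : Tendsto (fun j => a j - F (q j)) atTop (𝓝 0) :=
        squeeze_zero_norm ha hB'
      have h2 := h1.add ((hF.tendsto q₀).comp hq)
      simpa using h2
    exact ⟨aux _ _ hGc fun j => (hBu (ψ j) (q j) (hR j)).1,
      aux _ _ hHc fun j => (hBu (ψ j) (q j) (hR j)).2⟩
  have hconst : ∀ q : EuclideanSpace ℝ (Fin n),
      Tendsto (fun j => weightedAvg α (fun i => p.firstFamily v q (s i)) (k (ψ j))) atTop
        (𝓝 (p.G q)) ∧
      Tendsto (fun j => weightedAvg α (fun i => p.h q (s i)) (k (ψ j))) atTop (𝓝 (p.H q)) := by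
    intro q
    obtain ⟨N, hN⟩ := exists_nat_ge ‖q‖
    exact hlim (fun _ => q) q tendsto_const_nhds N fun _ => hN
  obtain ⟨hXG, hXH⟩ := hlim X y hXy R fun j => hx _
  -- the limit of the averages of the `z i`
  have hŷ : ŷ ∈ subdiff (fun y => (p.H y : EReal)) y := by
    refine mem_subdiff_coe.2 fun q => ?_
    -- Average the subgradient inequalities at the `x i`. Moving the base point to `X j` costs `K`
    -- per unit of displacement in the value of `h` and `2 * Mh` in the inner product.
    have h1 : ∀ j, weightedAvg α (fun i => p.h (X j) (s i)) (k (ψ j))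
        + inner ℝ (weightedAvg α z (k (ψ j))) (q - X j) - (K + 2 * Mh) * d j
        ≤ weightedAvg α (fun i => p.h q (s i)) (k (ψ j)) := by
      intro j
      rw [← weightedAvg_inner, hd, ← weightedAvg_const_mul, ← weightedAvg_add, ← weightedAvg_sub]
      refine weightedAvg_mono hα fun i _ => ?_
      have a1 := mem_subdiff_coe.1 (h.z_mem i) q
      have a2 := (abs_le.1 (hK _ (hx (k (ψ j) + 1)) _ (hx i) (s i))).2
      have a3 := (abs_le.1 (abs_real_inner_le_norm (z i) (X j - x i))).1
      have a4 : ‖z i‖ * ‖X j - x i‖ ≤ 2 * Mh * ‖X j - x i‖ := by gcongr; exact hz i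
      have a5 : inner ℝ (z i) (q - x i) = inner ℝ (z i) (q - X j) + inner ℝ (z i) (X j - x i) := by
        rw [← inner_add_right]; congr 1; abel
      simp only [hX] at *
      linarith
    have h2 : Tendsto (fun j => weightedAvg α (fun i => p.h (X j) (s i)) (k (ψ j))
        + inner ℝ (weightedAvg α z (k (ψ j))) (q - X j) - (K + 2 * Mh) * d j) atTop
        (𝓝 (p.H y + inner ℝ ŷ (q - y) - (K + 2 * Mh) * 0)) :=
      (hXH.add (hzy.inner (tendsto_const_nhds.sub hXy))).sub (hd0.const_mul _)
    have h3 := le_of_tendsto_of_tendsto' h2 (hconst q).2 h1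
    simpa using h3
  -- the limit of the averages of the `u i`
  have hxavg : Tendsto (fun j => weightedAvg α x (k (ψ j))) atTop (𝓝 y) := by
    have h1 : Tendsto (fun j => X j - weightedAvg α x (k (ψ j))) atTop (𝓝 0) := by
      refine squeeze_zero_norm (fun j => ?_) hd0
      have e : X j - weightedAvg α x (k (ψ j))
          = weightedAvg α (fun i => X j - x i) (k (ψ j)) := by
        rw [weightedAvg_sub, weightedAvg_const hα]
      rw [e]
      exact norm_weightedAvg_le hα _ _
    simpa using hXy.sub h1
  have hr₂ : ∀ q, p.r₂ q ≠ ⊤ →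
      p.r₂ y ≤ (((p.r₂ q).toReal - inner ℝ ŵ (q - y) : ℝ) : EReal) := by
    intro q hq
    have h1 : ∀ j, p.r₂ (weightedAvg α x (k (ψ j))) ≤ (((p.r₂ q).toReal
        - inner ℝ (weightedAvg α u (k (ψ j))) (q - X j) + U * d j : ℝ) : EReal) := by
      intro j
      -- As `r₂` is only lower semicontinuous, its values at `x i` and `X j` cannot be compared.
      -- Jensen's inequality moves them to the averaged iterate, which also converges to `y`.
      have hJ := p.r₂_convex.map_sum_le p.r₂_ne_bot (t := Finset.range (k (ψ j) + 1))
        (w := fun i => α i / weightSum α (k (ψ j))) (x := x)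
        (fun i _ => (div_pos (hα i) (weightSum_pos hα _)).le) (sum_div_weightSum hα _)
        (fun i _ => h.r₂_ne_top i)
      rw [← weightedAvg_eq_sum, ← weightedAvg_real_eq] at hJ
      refine hJ.trans (EReal.coe_le_coe_iff.2 ?_)
      have e : (p.r₂ q).toReal = weightedAvg α (fun _ => (p.r₂ q).toReal) (k (ψ j)) :=
        (weightedAvg_const hα _ _).symm
      rw [e, ← weightedAvg_inner, hd, ← weightedAvg_const_mul, ← weightedAvg_sub, ← weightedAvg_add]
      refine weightedAvg_mono hα fun i _ => ?_
      have a1 := subdiff_toReal_le p.r₂_ne_bot (h.u_mem i) hq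
      have a3 := (abs_le.1 (abs_real_inner_le_norm (u i) (X j - x i))).1
      have a4 : ‖u i‖ * ‖X j - x i‖ ≤ U * ‖X j - x i‖ := by gcongr; exact hu i
      have a5 : inner ℝ (u i) (q - x i) = inner ℝ (u i) (q - X j) + inner ℝ (u i) (X j - x i) := by
        rw [← inner_add_right]; congr 1; abel
      simp only [hX] at *
      linarith
    have h2 := le_of_lowerSemicontinuous_of_tendsto p.r₂_lsc hxavg
      (((tendsto_const_nhds (x := (p.r₂ q).toReal)).sub
        (huw.inner ((tendsto_const_nhds (x := q)).sub hXy))).add (hd0.const_mul U)) h1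
    simpa using h2
  have hr₂y : p.r₂ y ≠ ⊤ := ((hr₂ (x 0) (h.r₂_ne_top 0)).trans_lt (EReal.coe_lt_top _)).ne
  have hŵ : ŵ ∈ subdiff p.r₂ y := by
    refine mem_subdiff_of_toReal_le p.r₂_ne_bot hr₂y fun q hq => ?_
    have h1 := hr₂ q hq
    rw [← EReal.coe_toReal hr₂y (p.r₂_ne_bot y)] at h1
    have := EReal.coe_le_coe_iff.1 h1
    linarith
  -- the limit of the convex subproblems
  have hr₁ : ∀ q, p.r₁ q ≠ ⊤ → p.r₁ y ≤ ((p.G q - inner ℝ (ŷ + ŵ) q + (p.r₁ q).toReal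
      - p.G y + inner ℝ (ŷ + ŵ) y : ℝ) : EReal) := by
    intro q hq
    have hq' : Tendsto (fun j => weightedAvg α z (k (ψ j)) + weightedAvg α u (k (ψ j))) atTop
        (𝓝 (ŷ + ŵ)) := hzy.add huw
    refine le_of_lowerSemicontinuous_of_tendsto p.r₁_lsc hXy
      (((((hconst q).1.sub (hq'.inner tendsto_const_nhds)).add
        (tendsto_const_nhds (x := (p.r₁ q).toReal))).sub hXG).add (hq'.inner hXy)) fun j => ?_
    have h1 := h.minimizes hα (k (ψ j)) q hq
    rw [← EReal.coe_toReal (h.r₁_ne_top (k (ψ j) + 1)) (p.r₁_ne_bot _)]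
    refine EReal.coe_le_coe_iff.2 ?_
    simp only [hX]
    linarith
  have hr₁y : p.r₁ y ≠ ⊤ := ((hr₁ (x 0) (h.r₁_ne_top 0)).trans_lt (EReal.coe_lt_top _)).ne
  -- By `hr₁` the limit `y` minimizes the limiting subproblem `G + r₁ - ⟨ŷ + ŵ, ·⟩`.
  obtain ⟨ξ, hξ, η, hη, hξη⟩ := exists_subdiff_add_eq_of_isMinOn p.convexOn_G p.r₁_convex
    p.r₁_ne_bot (q := ŷ + ŵ) hr₁y fun q hq => by
      have h1 := hr₁ q hq
      rw [← EReal.coe_toReal hr₁y (p.r₁_ne_bot y)] at h1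
      have := EReal.coe_le_coe_iff.1 h1
      linarith
  refine ⟨(ξ + η) - ŷ, ⟨ξ + η, ⟨ξ, hξ, η, hη, rfl⟩, ŷ, hŷ, rfl⟩, ŵ, hŵ, ?_⟩
  change (ξ + η) - ŷ - ŵ = 0
  rw [hξη]; abel

end Limits

/-! ### A subsequence independent of the outcome -/

section Subsequence

variable {n : ℕ} {Ω : Type*} [MeasurableSpace Ω] {P : Measure Ω} [IsProbabilityMeasure P]
  {Θ : Type*} [mΘ : MeasurableSpace Θ] {μ : Measure Θ} [IsProbabilityMeasure μ]
  {p : Program n P} {v : Variant} {α : ℕ → ℝ} {x₀ : EuclideanSpace ℝ (Fin n)}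
  {s : ℕ → Θ → Ω} {x z u : ℕ → Θ → EuclideanSpace ℝ (Fin n)}

/-- Fatou's lemma bounds `Q K + |N K|` for infinitely many `K` only, which suffices because the
partial sums of the spreads are monotone. The radius may depend on the outcome; countably many
integer radii cover all cases. -/
theorem ae_summable_spread (hα : AdmissibleWeights α) (hA : BasicAssumption p v)
    {ρ₁ ρ₂ : ℝ≥0} (hρ : 0 < ρ₁ + ρ₂) (h1 : ∀ o, RhoConvex ρ₁ (fun y => (p.h y o : EReal)))
    (h2 : RhoConvex ρ₂ p.r₂) {a : ℝ} (ha : ∀ y, (a : EReal) ≤ p.f y)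
    (hgen : IsGenerated p v α μ x₀ s x z u)
    (hx : ∀ᵐ ω ∂μ, ∃ R : ℕ, ∀ k, ‖x k ω‖ ≤ R) :
    ∀ᵐ ω ∂μ, Summable fun k =>
      α (k + 1) / weightSum α (k + 1) * spread α (fun i => x i ω) k := by
  have key : ∀ R : ℕ, ∀ᵐ ω ∂μ, (∀ k, ‖x k ω‖ ≤ R) → Summable fun k =>
      α (k + 1) / weightSum α (k + 1) * spread α (fun i => x i ω) k := by
    intro R
    obtain ⟨c, Q, N, hQN, hmain⟩ := exists_spread_control hα hA h1 h2 ha hgen R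
    have hfr := ae_frequently_le_of_integral_le (μ := μ) (Q := fun K ω => Q K ω + |N K ω|)
      (fun K => (hQN K).1.add (hQN K).2.1.abs)
      (fun K ω => add_nonneg ((hQN K).2.2.1 ω) (abs_nonneg _))
      (fun K => (hQN K).2.2.2.1.add (hQN K).2.2.2.2.1.abs) (c := c + c) (fun K => by
        obtain ⟨-, -, -, hi, hi', -, hc, hc'⟩ := hQN K
        rw [integral_add hi hi'.abs]
        exact add_le_add hc' hc)
    filter_upwards [hmain, hfr] with ω hω ⟨b, hb⟩ hR
    have hpos : (0 : ℝ) < (ρ₁ + ρ₂) / 2 := by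
      have : (0 : ℝ) < ρ₁ + ρ₂ := by exact_mod_cast hρ
      linarith
    have hterm : ∀ k, 0 ≤ α (k + 1) / weightSum α (k + 1) * spread α (fun i => x i ω) k := fun k =>
      mul_nonneg (div_pos (hα.pos _) (weightSum_pos hα.pos _)).le (spread_nonneg hα.pos _ k)
    refine summable_of_sum_range_le hterm (c := (c + b) / ((ρ₁ + ρ₂) / 2)) fun K => ?_
    obtain ⟨K', hK', hb'⟩ := (frequently_atTop.1 hb) K
    rw [le_div_iff₀' hpos]
    have a1 := hω hR K'
    have a2 : ∑ k ∈ Finset.range K, α (k + 1) / weightSum α (k + 1) * spread α (fun i => x i ω) k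
        ≤ ∑ k ∈ Finset.range K', α (k + 1) / weightSum α (k + 1) * spread α (fun i => x i ω) k :=
      Finset.sum_le_sum_of_subset_of_nonneg (Finset.range_subset_range.2 hK') fun k _ _ => hterm k
    have a3 := mul_le_mul_of_nonneg_left a2 hpos.le
    have a4 := le_abs_self (N K' ω)
    linarith
  filter_upwards [hx, ae_all_iff.2 key] with ω ⟨R, hR⟩ hω
  exact hω R hR

/-- If `∑ w k = ∞` and `∑ w k * b k < ∞`, then `b` is frequently small. -/
theorem frequently_lt_of_tsum_mul {w : ℕ → ℝ} (hw0 : ∀ k, 0 ≤ w k) (hw : ¬ Summable w)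
    {b : ℕ → ℝ≥0∞} (hb : ∑' k, ENNReal.ofReal (w k) * b k ≠ ⊤) {ε : ℝ≥0∞} (hε : ε ≠ 0) :
    ∃ᶠ k in atTop, b k < ε := by
  by_contra hcon
  rw [not_frequently] at hcon
  obtain ⟨m, hm⟩ := eventually_atTop.1 hcon
  apply hw
  rw [← summable_nat_add_iff m]
  have h1 : ∑' k, ENNReal.ofReal (w (k + m)) * ε ≠ ⊤ := by
    refine ne_top_of_le_ne_top hb ?_
    refine le_trans (ENNReal.tsum_le_tsum fun k => ?_)
      (ENNReal.tsum_comp_le_tsum_of_injective (add_left_injective m)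
        fun k => ENNReal.ofReal (w k) * b k)
    exact mul_le_mul_right (not_lt.1 (hm (k + m) (by lia))) _
  rw [ENNReal.tsum_mul_right] at h1
  have h2 : ∑' k, ENNReal.ofReal (w (k + m)) ≠ ⊤ := by
    intro htop
    rw [htop, ENNReal.top_mul hε] at h1
    exact h1 rfl
  exact (ENNReal.summable_toReal h2).congr fun k => ENNReal.toReal_ofReal (hw0 _)

/-- A deterministic subsequence of steps along which the spread vanishes and the sample averages
converge locally uniformly. -/
theorem exists_subsequence (hα : AdmissibleWeights α) (hA : BasicAssumption p v)
    (hgen : IsGenerated p v α μ x₀ s x z u)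
    (hsum : ∀ᵐ ω ∂μ, Summable fun k =>
      α (k + 1) / weightSum α (k + 1) * spread α (fun i => x i ω) k) :
    ∃ k : ℕ → ℕ, StrictMono k ∧ ∀ᵐ ω ∂μ,
      Tendsto (fun j => spread α (fun i => x i ω) (k j)) atTop (𝓝 0) ∧
      ∀ R : ℕ, ∃ B : ℕ → ℝ, Tendsto B atTop (𝓝 0) ∧ ∀ j y, ‖y‖ ≤ R →
        |weightedAvg α (fun i => p.firstFamily v y (s i ω)) (k j) - p.G y| ≤ B j ∧
        |weightedAvg α (fun i => p.h y (s i ω)) (k j) - p.H y| ≤ B j := by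
  have hF := hgen.freshSampling
  have hg := p.regularFamily_firstFamily hA
  have hh := p.regularFamily_h hA
  set w : ℕ → ℝ := fun k => α (k + 1) / weightSum α (k + 1) with hw
  have hw0 : ∀ k, 0 ≤ w k := fun k => (div_pos (hα.pos _) (weightSum_pos hα.pos _)).le
  have hDm := fun k => measurable_spread (α := α) (x := x) hgen.measurable_x k
  set D : ℕ → Θ → ℝ≥0∞ := fun k ω => ENNReal.ofReal (spread α (fun i => x i ω) k) with hD
  have hDm' : ∀ k, Measurable (D k) := fun k => (hDm k).ennreal_ofReal
  set Z : Θ → ℝ≥0∞ := fun ω => ∑' k, ENNReal.ofReal (w k) * D k ω with hZ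
  have hZm : Measurable Z := Measurable.tsum fun k => (hDm' k).const_mul _
  have hZfin : ∀ᵐ ω ∂μ, Z ω ≠ ⊤ := by
    filter_upwards [hsum] with ω hω
    simp only [hZ, hD, ← ENNReal.ofReal_mul (hw0 _)]
    exact hω.tsum_ofReal_ne_top
  -- `Z` is finite almost surely but perhaps not integrable. Dividing by `1 + Z` makes the expected
  -- weighted sum at most `1`, so one deterministic sequence governs the spreads; the added rate
  -- governs the uniform deviations at the same indices.
  set b : ℕ → ℝ≥0∞ := fun k => (∫⁻ ω, (1 + Z ω)⁻¹ * D k ω ∂μ)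
    + ENNReal.ofReal (sampleRate (beta α k)) with hb
  have hYm : Measurable fun ω => (1 + Z ω)⁻¹ := (hZm.const_add 1).inv
  have hYDm : ∀ k, Measurable fun ω => (1 + Z ω)⁻¹ * D k ω := fun k => hYm.mul (hDm' k)
  have hYwDm : ∀ k, Measurable fun ω => (1 + Z ω)⁻¹ * (ENNReal.ofReal (w k) * D k ω) := fun k =>
    hYm.mul ((hDm' k).const_mul _)
  have hbsum : ∑' k, ENNReal.ofReal (w k) * b k ≠ ⊤ := by
    simp only [hb, mul_add]
    rw [ENNReal.tsum_add]
    refine ENNReal.add_ne_top.2 ⟨?_, ?_⟩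
    · have e : ∀ k, ENNReal.ofReal (w k) * ∫⁻ ω, (1 + Z ω)⁻¹ * D k ω ∂μ
          = ∫⁻ ω, (1 + Z ω)⁻¹ * (ENNReal.ofReal (w k) * D k ω) ∂μ := by
        intro k
        rw [← lintegral_const_mul _ (hYDm k)]
        exact lintegral_congr fun ω => by ring
      simp only [e]
      rw [← lintegral_tsum fun k => (hYwDm k).aemeasurable]
      have hle : ∫⁻ ω, ∑' k, (1 + Z ω)⁻¹ * (ENNReal.ofReal (w k) * D k ω) ∂μ ≤ ∫⁻ _, 1 ∂μ := by
        refine lintegral_mono fun ω => ?_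
        rw [ENNReal.tsum_mul_left]
        refine le_trans (mul_le_mul_right (le_add_self : Z ω ≤ 1 + Z ω) _) ?_
        rw [mul_comm]
        exact ENNReal.mul_inv_le_one _
      exact ne_top_of_le_ne_top (by simp) hle
    · simp only [← ENNReal.ofReal_mul (hw0 _)]
      exact hα.summable_sampleRate.tsum_ofReal_ne_top
  -- Geometric smallness makes the selected means summable, which upgrades convergence in mean to
  -- almost sure convergence.
  obtain ⟨k, hk, hkb⟩ := extraction_forall_of_frequently
    (P := fun j k => b k < (2⁻¹ : ℝ≥0∞) ^ j) fun j =>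
    frequently_lt_of_tsum_mul hw0 (not_summable_div_weightSum hα.pos hα.diverges) hbsum
      (by simp)
  have hbk : ∑' j, b (k j) ≠ ⊤ := by
    refine ne_top_of_le_ne_top ?_ (ENNReal.tsum_le_tsum fun j => (hkb j).le)
    rw [ENNReal.tsum_geometric]
    simp
  have hspread : ∀ᵐ ω ∂μ, Tendsto (fun j => spread α (fun i => x i ω) (k j)) atTop (𝓝 0) := by
    have h1 := ae_tendsto_zero_of_tsum_lintegral (μ := μ)
      (F := fun j ω => (1 + Z ω)⁻¹ * D (k j) ω) (fun j => hYDm _)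
      (ne_top_of_le_ne_top hbk (ENNReal.tsum_le_tsum fun j => le_self_add))
    filter_upwards [h1, hZfin] with ω hω hZω
    -- The normalizing factor is now undone outcome by outcome.
    have hfin : 1 + Z ω ≠ ⊤ := by simp [hZω]
    have h2 := ENNReal.Tendsto.const_mul (a := 1 + Z ω) hω (Or.inr hfin)
    simp only [mul_zero] at h2
    have h3 : Tendsto (fun j => D (k j) ω) atTop (𝓝 0) := by
      refine h2.congr fun j => ?_
      rw [← mul_assoc, ENNReal.mul_inv_cancel (by simp) hfin, one_mul]
    have h4 := (ENNReal.tendsto_toReal ENNReal.zero_ne_top).comp h3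
    simp only [ENNReal.toReal_zero] at h4
    exact h4.congr fun j => ENNReal.toReal_ofReal (spread_nonneg hα.pos _ _)
  have hunif : ∀ {φ : EuclideanSpace ℝ (Fin n) → Ω → ℝ}, RegularFamily φ → ∀ R : ℕ,
      ∀ᵐ ω ∂μ, ∃ B : ℕ → ℝ, Tendsto B atTop (𝓝 0) ∧ ∀ j y, ‖y‖ ≤ R →
        |weightedAvg α (fun i => φ y (s i ω)) (k j) - ∫ o, φ y o ∂P| ≤ B j := by
    intro φ hφ R
    obtain ⟨K', hK', B, hB⟩ := hφ.exists_uniform_bound hF hα.pos (R : ℝ)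
    have h1 := ae_tendsto_zero_of_tsum_lintegral (μ := μ)
      (F := fun j ω => ENNReal.ofReal (B (k j) ω)) (fun j => (hB _).1.ennreal_ofReal) (by
        refine ne_top_of_le_ne_top (b := ENNReal.ofReal K' * ∑' j, b (k j))
          (ENNReal.mul_ne_top ENNReal.ofReal_ne_top hbk) ?_
        rw [← ENNReal.tsum_mul_left]
        refine ENNReal.tsum_le_tsum fun j => ?_
        rw [← ofReal_integral_eq_lintegral_ofReal (hB _).2.1
          (Eventually.of_forall (hB _).2.2.1)]
        refine (ENNReal.ofReal_le_ofReal (hB _).2.2.2.2).trans ?_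
        rw [ENNReal.ofReal_mul hK']
        exact mul_le_mul_right le_add_self _)
    filter_upwards [h1] with ω hω
    refine ⟨fun j => B (k j) ω, ?_, fun j y hy => (hB (k j)).2.2.2.1 ω y hy⟩
    have h4 := (ENNReal.tendsto_toReal ENNReal.zero_ne_top).comp hω
    simp only [ENNReal.toReal_zero] at h4
    exact h4.congr fun j => ENNReal.toReal_ofReal ((hB _).2.2.1 ω)
  refine ⟨k, hk, ?_⟩
  filter_upwards [hspread, ae_all_iff.2 (hunif hg), ae_all_iff.2 (hunif hh)] with ω h1 h2 h3
  refine ⟨h1, fun R => ?_⟩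
  obtain ⟨B₁, hB₁, hu₁⟩ := h2 R
  obtain ⟨B₂, hB₂, hu₂⟩ := h3 R
  refine ⟨fun j => max (B₁ j) (B₂ j), by simpa using hB₁.max hB₂, fun j y hy => ⟨?_, ?_⟩⟩
  · have := hu₁ j y hy
    rw [p.integral_firstFamily] at this
    exact this.trans (le_max_left _ _)
  · exact (hu₂ j y hy).trans (le_max_right _ _)

end Subsequence

/-! ### Uniform law of large numbers for gradients -/

section Gradients

variable {n : ℕ} {Ω : Type*} [MeasurableSpace Ω] {P : Measure Ω} [IsProbabilityMeasure P]
  {Θ : Type*} [mΘ : MeasurableSpace Θ] {μ : Measure Θ} [IsProbabilityMeasure μ]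

theorem inner_basisFun (v : EuclideanSpace ℝ (Fin n)) (j : Fin n) :
    inner ℝ v (EuclideanSpace.basisFun (Fin n) ℝ j) = v j := by
  rw [EuclideanSpace.basisFun_apply, EuclideanSpace.inner_single_right]; simp

/-- Gradients of a measurable family are measurable in the parameter. -/
theorem measurable_gradient {φ : EuclideanSpace ℝ (Fin n) → Ω → ℝ} (hφ : ∀ x, Measurable (φ x))
    {x : EuclideanSpace ℝ (Fin n)} (hd : ∀ o, DifferentiableAt ℝ (fun y => φ y o) x) :
    Measurable fun o => gradient (fun y => φ y o) x := by
  have hcoord : ∀ j, Measurable fun o => gradient (fun y => φ y o) x j := by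
    intro j
    set e := EuclideanSpace.basisFun (Fin n) ℝ j
    have ht : Tendsto (fun m : ℕ => 1 / ((m : ℝ) + 1)) atTop (𝓝[>] 0) :=
      tendsto_nhdsWithin_iff.2 ⟨tendsto_one_div_add_atTop_nhds_zero_nat,
        Eventually.of_forall fun m => mem_Ioi.2 Nat.one_div_pos_of_nat⟩
    refine measurable_of_tendsto_metrizable (f := fun (m : ℕ) o =>
      (1 / ((m : ℝ) + 1))⁻¹ * (φ (x + (1 / ((m : ℝ) + 1)) • e) o - φ x o)) (fun m =>
        ((hφ _).sub (hφ _)).const_mul _) ?_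
    rw [tendsto_pi_nhds]
    intro o
    have hder : HasDerivAt (fun t : ℝ => φ (x + t • e) o)
        (inner ℝ (gradient (fun y => φ y o) x) e) 0 := by
      have h0 : HasFDerivAt (fun y => φ y o)
          (InnerProductSpace.toDual ℝ _ (gradient (fun y => φ y o) x)) (x + (0:ℝ) • e) := by
        simpa using (hd o).hasGradientAt.hasFDerivAt
      have h1 : HasDerivAt (fun t : ℝ => x + t • e) e 0 := by
        simpa using ((hasDerivAt_id (0:ℝ)).smul_const e).const_add x
      have h2 := h0.comp_hasDerivAt (0:ℝ) h1
      rw [InnerProductSpace.toDual_apply_apply] at h2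
      exact h2
    have hs := hder.tendsto_slope_zero_right.comp ht
    rw [show inner ℝ (gradient (fun y => φ y o) x) e = _ from inner_basisFun _ j] at hs
    simpa [Function.comp_def] using hs
  have h1 : Measurable fun o => (WithLp.toLp 2 fun j => gradient (fun y => φ y o) x j :
      EuclideanSpace ℝ (Fin n)) :=
    (MeasurableEquiv.toLp 2 (Fin n → ℝ)).measurable.comp (measurable_pi_iff.2 hcoord)
  exact h1

theorem GradLipschitzOn.differentiableAt {K : ℝ≥0} {f : EuclideanSpace ℝ (Fin n) → ℝ}
    {C : Set (EuclideanSpace ℝ (Fin n))} (h : GradLipschitzOn K (fun y => (f y : EReal)) C)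
    {x : EuclideanSpace ℝ (Fin n)} (hx : x ∈ C) : DifferentiableAt ℝ f x := by
  simpa using (h.1 x hx).2

theorem GradLipschitzOn.norm_sub_le {K : ℝ≥0} {f : EuclideanSpace ℝ (Fin n) → EReal}
    {C : Set (EuclideanSpace ℝ (Fin n))} (h : GradLipschitzOn K f C)
    {x y v w : EuclideanSpace ℝ (Fin n)} (hx : x ∈ C) (hy : y ∈ C) (hv : v ∈ subdiff f x)
    (hw : w ∈ subdiff f y) : ‖v - w‖ ≤ K * ‖x - y‖ := by
  rw [eq_gradient_of_mem_subdiff (h.1 x hx).1 (h.1 x hx).2 hv,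
    eq_gradient_of_mem_subdiff (h.1 y hy).1 (h.1 y hy).2 hw, ← dist_eq_norm, ← dist_eq_norm]
  exact h.2.dist_le_mul x hx y hy

/-- A uniform law of large numbers for the gradients of a regular family with equi-Lipschitz
gradients. -/
theorem RegularFamily.exists_gradient_bound {φ : EuclideanSpace ℝ (Fin n) → Ω → ℝ}
    (h : RegularFamily φ) {m : ℕ → MeasurableSpace Θ} {s : ℕ → Θ → Ω}
    (hF : FreshSampling P μ m s) {α : ℕ → ℝ} (hα : ∀ k, 0 < α k) {R : ℝ}
    {C : Set (EuclideanSpace ℝ (Fin n))} (hC : ∀ x ∈ C, ‖x‖ ≤ R) {K : ℝ≥0}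
    (hL : ∀ o, GradLipschitzOn K (fun y => (φ y o : EReal)) C) :
    ∃ V : EuclideanSpace ℝ (Fin n) → EuclideanSpace ℝ (Fin n),
      (∀ x ∈ C, V x ∈ subdiff (fun y => ((∫ o, φ y o ∂P : ℝ) : EReal)) x) ∧
      ∃ K' : ℝ, 0 ≤ K' ∧ ∃ B : ℕ → Θ → ℝ, ∀ k, Measurable (B k) ∧ Integrable (B k) μ ∧
        (∀ ω, 0 ≤ B k ω) ∧
        (∀ ω, ∀ x ∈ C,
          ‖weightedAvg α (fun i => gradient (fun y => φ y (s i ω)) x) k - V x‖ ≤ B k ω) ∧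
        ∫ ω, B k ω ∂μ ≤ K' * sampleRate (beta α k) := by
  obtain ⟨M, hM0, hM⟩ := h.equicontinuous.exists_bound (R + 1)
  set D : EuclideanSpace ℝ (Fin n) → Ω → EuclideanSpace ℝ (Fin n) := fun x o =>
    gradient (fun y => φ y o) x with hD
  have hDsub : ∀ x ∈ C, ∀ o, D x o ∈ subdiff (fun y => (φ y o : EReal)) x := fun x hx o =>
    gradient_mem_subdiff (h.convex o) ((hL o).differentiableAt hx)
  have hDm : ∀ x ∈ C, Measurable (D x) := fun x hx =>
    measurable_gradient h.measurable fun o => (hL o).differentiableAt hx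
  have hDb : ∀ x ∈ C, ∀ o, ‖D x o‖ ≤ 2 * M := fun x hx o =>
    norm_le_of_mem_subdiff (fun y hy => hM y hy o) (hC x hx) (hDsub x hx o)
  have hDi : ∀ x ∈ C, Integrable (D x) P := fun x hx =>
    Integrable.of_bound (hDm x hx).aestronglyMeasurable (2 * M) (Eventually.of_forall (hDb x hx))
  -- The mean gradient is a subgradient of the expectation by integrating the subgradient
  -- inequalities; no differentiation under the integral is needed.
  refine ⟨fun x => ∫ o, D x o ∂P, fun x hx => mem_subdiff_coe.2 fun y => ?_, ?_⟩
  · have h1 : inner ℝ (∫ o, D x o ∂P) (y - x) = ∫ o, inner ℝ (D x o) (y - x) ∂P := by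
      rw [real_inner_comm, ← integral_inner (hDi x hx)]
      simp only [real_inner_comm]
    rw [h1, ← integral_add (h.integrable x) ((hDi x hx).inner_const _)]
    exact integral_mono ((h.integrable x).add ((hDi x hx).inner_const _)) (h.integrable y)
      fun o => mem_subdiff_coe.1 (hDsub x hx o) y
  -- The scalar law is applied to each coordinate, on `C` only, where the gradients are Lipschitz.
  · have hcoord : ∀ j : Fin n, ∃ K' : ℝ, 0 ≤ K' ∧ ∃ B : ℕ → Θ → ℝ, ∀ k, Measurable (B k) ∧
        Integrable (B k) μ ∧ (∀ ω, 0 ≤ B k ω) ∧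
        (∀ ω, ∀ x ∈ C, |weightedAvg α (fun i => D x (s i ω) j) k - ∫ o, D x o j ∂P| ≤ B k ω) ∧
        ∫ ω, B k ω ∂μ ≤ K' * sampleRate (beta α k) := by
      intro j
      refine SDCA.exists_uniform_bound hF.le hF.measurable hF.law hF.indep hF.past hα
        (φ := fun x o => D x o j) (R := R) (M := 2 * M) (K := K) K.2 (fun x hx => by simpa using hC x hx)
        (fun x hx => ?_) (fun x hx o => (abs_coord_le_norm _ j).trans (hDb x hx o))
        (fun x hx y hy o => ?_)
      · have e : (fun o => D x o j)
            = fun o => inner ℝ (D x o) (EuclideanSpace.basisFun (Fin n) ℝ j) := by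
          funext o; rw [inner_basisFun]
        rw [e]
        exact (hDm x hx).inner measurable_const
      · rw [← PiLp.sub_apply]
        exact (abs_coord_le_norm _ j).trans
          ((hL o).norm_sub_le hx hy (hDsub x hx o) (hDsub y hy o))
    choose K' hK' B hB using hcoord
    refine ⟨∑ j, K' j, Finset.sum_nonneg fun j _ => hK' j, fun k ω => ∑ j, B j k ω, fun k =>
      ⟨Finset.measurable_fun_sum _ fun j _ => (hB j k).1,
        integrable_finsetSum _ fun j _ => (hB j k).2.1,
        fun ω => Finset.sum_nonneg fun j _ => (hB j k).2.2.1 ω, fun ω x hx => ?_, ?_⟩⟩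
    · refine (norm_le_sum_abs _).trans (Finset.sum_le_sum fun j _ => ?_)
      refine le_trans (le_of_eq ?_) ((hB j k).2.2.2.1 ω x hx)
      have e1 : ∀ v : EuclideanSpace ℝ (Fin n), v j = EuclideanSpace.proj (𝕜 := ℝ) j v := fun v => rfl
      congr 1
      rw [PiLp.sub_apply]
      congr 1
      · rw [e1, ← ContinuousLinearMap.coe_coe, ← weightedAvg_map]
        rfl
      · rw [e1, ← ContinuousLinearMap.integral_comp_comm _ (hDi x hx)]
        rfl
    · rw [integral_finsetSum _ fun j _ => (hB j k).2.1, Finset.sum_mul]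
      exact Finset.sum_le_sum fun j _ => (hB j k).2.2.2.2

end Gradients

/-! ### Distance to criticality and the rate -/

section Rate

variable {n : ℕ} {Ω : Type*} [MeasurableSpace Ω] {P : Measure Ω}

/-- Prices the transfer of averaged gradients from the past points `x i` to `x (k+1)` at `K *
√spread`. -/
theorem weightedAvg_norm_sub_le {α : ℕ → ℝ} (hα : ∀ k, 0 < α k) {K : ℝ}
    {a b x : ℕ → EuclideanSpace ℝ (Fin n)} {k : ℕ}
    (h : ∀ i, ‖a i - b i‖ ≤ K * ‖x (k + 1) - x i‖) (hK : 0 ≤ K) :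
    ‖weightedAvg α a k - weightedAvg α b k‖ ≤ K * √(spread α x k) := by
  rw [← weightedAvg_sub]
  refine (norm_weightedAvg_le hα _ k).trans ((weightedAvg_mono hα fun i _ => h i).trans ?_)
  rw [weightedAvg_const_mul]
  exact mul_le_mul_of_nonneg_left (weightedAvg_dist_le hα x k) hK

theorem convexOn_weightedAvg {α : ℕ → ℝ} (hα : ∀ k, 0 < α k)
    {f : ℕ → EuclideanSpace ℝ (Fin n) → ℝ} (hf : ∀ i, ConvexOn ℝ univ (f i)) (k : ℕ) :
    ConvexOn ℝ univ fun y => weightedAvg α (fun i => f i y) k := by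
  refine ⟨convex_univ, fun x _ y _ a b ha hb hab => ?_⟩
  simp only [smul_eq_mul]
  rw [← weightedAvg_const_mul, ← weightedAvg_const_mul, ← weightedAvg_add]
  exact weightedAvg_mono hα fun i _ => (hf i).2 (mem_univ x) (mem_univ y) ha hb hab

/-- A subgradient of an average of differentiable functions is the average of the gradients. -/
theorem eq_weightedAvg_gradient {α : ℕ → ℝ} {f : ℕ → EuclideanSpace ℝ (Fin n) → ℝ} {k : ℕ}
    {x ξ : EuclideanSpace ℝ (Fin n)} (hd : ∀ i, DifferentiableAt ℝ (f i) x)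
    (hξ : ξ ∈ subdiff (fun y => ((weightedAvg α (fun i => f i y) k : ℝ) : EReal)) x) :
    ξ = weightedAvg α (fun i => gradient (f i) x) k := by
  have h1 : HasGradientAt (fun y => weightedAvg α (fun i => f i y) k)
      (weightedAvg α (fun i => gradient (f i) x) k) x := by
    rw [hasGradientAt_iff_hasFDerivAt]
    simp only [weightedAvg_real_eq]
    have h2 := HasFDerivAt.fun_sum (u := Finset.range (k + 1)) fun i _ =>
      (hd i).hasGradientAt.hasFDerivAt.const_mul (α i / weightSum α k)
    rw [weightedAvg_eq_sum, map_sum]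
    simpa only [map_smulₛₗ, conj_trivial] using h2
  have h2 := eq_gradient_of_mem_subdiff (f := fun y =>
    ((weightedAvg α (fun i => f i y) k : ℝ) : EReal)) (by simp)
    (by simpa using h1.differentiableAt) hξ
  simp only [EReal.toReal_coe] at h2
  rw [h2, h1.gradient]

variable {p : Program n P} {v : Variant} {α : ℕ → ℝ}
  {x₀ : EuclideanSpace ℝ (Fin n)}

/-- The distance to criticality at a point of a path is controlled by explicit subgradients. -/
theorem IsPath.distToCriticality_le (hα : ∀ k, 0 < α k) {s : ℕ → Ω}
    {x z u : ℕ → EuclideanSpace ℝ (Fin n)} (h : IsPath p v α x₀ s x z u) {K : ℝ≥0}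
    {C : Set (EuclideanSpace ℝ (Fin n))} (hx : ∀ i, x i ∈ C) (hr : GradLipschitzOn K p.r₂ C)
    (hh : ∀ o, GradLipschitzOn K (fun y => (p.h y o : EReal)) C)
    {Vh : EuclideanSpace ℝ (Fin n)} {k : ℕ} {bh bg : ℝ}
    (hVh : Vh ∈ subdiff (fun y => (p.H y : EReal)) (x (k + 1)))
    (hbh : ‖weightedAvg α (fun i => gradient (fun y => p.h y (s i)) (x (k + 1))) k - Vh‖ ≤ bh)
    (hg : ∀ ξ ∈ subdiff (fun y => ((weightedAvg α (fun i => p.firstFamily v y (s i)) k : ℝ)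
      : EReal)) (x (k + 1)), ∃ ξ' ∈ subdiff (fun y => (p.G y : EReal)) (x (k + 1)),
        ‖ξ - ξ'‖ ≤ bg)
    (hconv : ∀ o, ConvexOn ℝ univ fun y => p.firstFamily v y o) :
    p.distToCriticality (x (k + 1)) ≤ ENNReal.ofReal (2 * K * √(spread α x k) + (bh + bg)) := by
  obtain ⟨ξ, hξ, η, hη, hξη⟩ := exists_subdiff_add_eq_of_isMinOn
    (convexOn_weightedAvg hα (fun i => hconv (s i)) k) p.r₁_convex
    p.r₁_ne_bot (q := weightedAvg α z k + weightedAvg α u k) (h.r₁_ne_top (k + 1))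
    (h.minimizes hα k)
  obtain ⟨ξ', hξ', hξξ⟩ := hg ξ hξ
  have hmem : (ξ' + η) - Vh - u (k + 1) ∈ p.criticalitySet (x (k + 1)) :=
    ⟨(ξ' + η) - Vh, ⟨ξ' + η, ⟨ξ', hξ', η, hη, rfl⟩, Vh, hVh, rfl⟩, u (k + 1), h.u_mem (k + 1), rfl⟩
  refine (Metric.infEDist_le_edist_of_mem hmem).trans ?_
  rw [edist_comm, edist_zero_right, ← ofReal_norm]
  refine ENNReal.ofReal_le_ofReal ?_
  set gr : ℕ → EuclideanSpace ℝ (Fin n) := fun i => gradient (fun y => p.h y (s i)) (x (k + 1))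
  have hgr : ∀ i, gr i ∈ subdiff (fun y => (p.h y (s i) : EReal)) (x (k + 1)) := fun i =>
    gradient_mem_subdiff (p.h_convex (s i)) ((hh (s i)).differentiableAt (hx _))
  have hz : ‖weightedAvg α z k - weightedAvg α gr k‖ ≤ K * √(spread α x k) :=
    weightedAvg_norm_sub_le hα (fun i => by
      rw [norm_sub_rev (x (k + 1))]
      exact (hh (s i)).norm_sub_le (hx i) (hx (k + 1)) (h.z_mem i) (hgr i)) K.2
  have hu : ‖weightedAvg α u k - u (k + 1)‖ ≤ K * √(spread α x k) := by
    have := weightedAvg_norm_sub_le hα (a := u) (b := fun _ => u (k + 1)) (x := x) (k := k)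
      (fun i => by
        rw [norm_sub_rev (x (k + 1))]
        exact hr.norm_sub_le (hx i) (hx (k + 1)) (h.u_mem i) (h.u_mem (k + 1))) K.2
    rwa [weightedAvg_const hα] at this
  -- Substituting the optimality condition for `η` leaves two displacement errors, for `h` and `r₂`,
  -- each at most `K * √spread`, and two sampling errors, `bh` and `bg`.
  have e : (ξ' + η) - Vh - u (k + 1) = (weightedAvg α z k - weightedAvg α gr k)
      + (weightedAvg α gr k - Vh) + (weightedAvg α u k - u (k + 1)) - (ξ - ξ') := by
    have : η = weightedAvg α z k + weightedAvg α u k - ξ := by rw [← hξη]; abel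
    rw [this]; abel
  rw [e]
  refine (norm_sub_le _ _).trans ?_
  have := norm_add₃_le (a := weightedAvg α z k - weightedAvg α gr k)
    (b := weightedAvg α gr k - Vh) (c := weightedAvg α u k - u (k + 1))
  linarith

variable [IsProbabilityMeasure P] {Θ : Type*} [mΘ : MeasurableSpace Θ] {μ : Measure Θ}
  [IsProbabilityMeasure μ] {s : ℕ → Θ → Ω} {x z u : ℕ → Θ → EuclideanSpace ℝ (Fin n)}

/-- For `sdca1` the first component is exact, so `bg = 0`. For `sdca2` differentiability forces its
subgradient to be the averaged gradient of `g`, which the uniform law compares with a subgradient of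
`G`. -/
theorem exists_distToCriticality_control (hα : ∀ k, 0 < α k) (hA : BasicAssumption p v)
    (hgen : IsGenerated p v α μ x₀ s x z u) {C : Set (EuclideanSpace ℝ (Fin n))} {R : ℝ}
    (hC : ∀ x ∈ C, ‖x‖ ≤ R) (hx : ∀ᵐ ω ∂μ, ∀ k, x k ω ∈ C) {L : ℝ≥0}
    (hL : EquiLipschitzGradients p L C v) :
    ∃ K' : ℝ, 0 ≤ K' ∧ ∃ B : ℕ → Θ → ℝ, ∀ k, Integrable (B k) μ ∧ (∀ ω, 0 ≤ B k ω) ∧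
      ∫ ω, B k ω ∂μ ≤ K' * sampleRate (beta α k) ∧
      ∀ᵐ ω ∂μ, p.distToCriticality (x (k + 1) ω)
        ≤ ENNReal.ofReal (L * √(spread α (fun i => x i ω) k) + B k ω) := by
  have hF := hgen.freshSampling
  have hh := p.regularFamily_h hA
  have hcoe : 2 * ((L / 2 : ℝ≥0) : ℝ) = L := by push_cast; ring
  cases v with
  | sdca1 =>
    obtain ⟨Vh, hVh, Kh, hKh, Bh, hBh⟩ := hh.exists_gradient_bound hF hα hC hL.2
    refine ⟨Kh, hKh, Bh, fun k => ⟨(hBh k).2.1, (hBh k).2.2.1, (hBh k).2.2.2.2, ?_⟩⟩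
    filter_upwards [hgen.ae_isPath, hx] with ω hω hxω
    have := hω.distToCriticality_le hα hxω hL.1 hL.2 (hVh _ (hxω (k + 1)))
      ((hBh k).2.2.2.1 ω _ (hxω (k + 1))) (bg := 0) (fun ξ hξ => ⟨ξ, by
        simpa only [Program.firstFamily, weightedAvg_const hα] using hξ, by simp⟩)
      (p.regularFamily_firstFamily hA).convex
    rwa [hcoe, add_zero] at this
  | sdca2 =>
    obtain ⟨Vh, hVh, Kh, hKh, Bh, hBh⟩ := hh.exists_gradient_bound hF hα hC fun o => (hL.2 o).2
    have hg : RegularFamily p.g := p.regularFamily_firstFamily hA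
    obtain ⟨Vg, hVg, Kg, hKg, Bg, hBg⟩ := hg.exists_gradient_bound hF hα hC fun o => (hL.2 o).1
    refine ⟨Kh + Kg, add_nonneg hKh hKg, fun k ω => Bh k ω + Bg k ω, fun k =>
      ⟨(hBh k).2.1.add (hBg k).2.1,
        fun ω => add_nonneg ((hBh k).2.2.1 ω) ((hBg k).2.2.1 ω), ?_, ?_⟩⟩
    · rw [integral_add (hBh k).2.1 (hBg k).2.1, add_mul]
      exact add_le_add (hBh k).2.2.2.2 (hBg k).2.2.2.2
    · filter_upwards [hgen.ae_isPath, hx] with ω hω hxω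
      have := hω.distToCriticality_le hα hxω hL.1 (fun o => (hL.2 o).2) (hVh _ (hxω (k + 1)))
        ((hBh k).2.2.2.1 ω _ (hxω (k + 1))) (bg := Bg k ω) (fun ξ hξ => ⟨Vg (x (k + 1) ω),
          hVg _ (hxω (k + 1)), by
            rw [eq_weightedAvg_gradient (f := fun i y => p.g y (s i ω))
              (fun i => (hL.2 (s i ω)).1.differentiableAt (hxω (k + 1))) hξ]
            exact (hBg k).2.2.2.1 ω _ (hxω (k + 1))⟩)
        hg.convex
      rwa [hcoe] at this

/-- The weighted sum of the mean spreads is bounded if the iterates are. -/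
theorem exists_sum_integral_spread_le (hα : AdmissibleWeights α) (hA : BasicAssumption p v)
    {ρ₁ ρ₂ : ℝ≥0} (hρ : 0 < ρ₁ + ρ₂) (h1 : ∀ o, RhoConvex ρ₁ (fun y => (p.h y o : EReal)))
    (h2 : RhoConvex ρ₂ p.r₂) {a : ℝ} (ha : ∀ y, (a : EReal) ≤ p.f y)
    (hgen : IsGenerated p v α μ x₀ s x z u) {R : ℝ} (hx : ∀ᵐ ω ∂μ, ∀ k, ‖x k ω‖ ≤ R) :
    (∀ k, Integrable (fun ω => spread α (fun i => x i ω) k) μ) ∧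
    ∃ c : ℝ, ∀ K, ∑ k ∈ Finset.range K, α (k + 1) / weightSum α (k + 1) *
      ∫ ω, spread α (fun i => x i ω) k ∂μ ≤ c := by
  have hDi : ∀ k, Integrable (fun ω => spread α (fun i => x i ω) k) μ := by
    intro k
    refine Integrable.of_bound (measurable_spread hgen.measurable_x k).aestronglyMeasurable
      ((R + R) ^ 2) ?_
    filter_upwards [hx] with ω hω
    rw [Real.norm_eq_abs, abs_of_nonneg (spread_nonneg hα.pos _ k)]
    refine (weightedAvg_mono hα.pos (w := fun _ => (R + R) ^ 2) fun i _ => ?_).trans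
      (weightedAvg_const hα.pos _ k).le
    exact pow_le_pow_left₀ (norm_nonneg _)
      ((norm_sub_le _ _).trans (add_le_add (hω _) (hω _))) 2
  refine ⟨hDi, ?_⟩
  obtain ⟨c, Q, N, hQN, hmain⟩ := exists_spread_control hα hA h1 h2 ha hgen R
  have hpos : (0 : ℝ) < (ρ₁ + ρ₂) / 2 := by
    have : (0 : ℝ) < ρ₁ + ρ₂ := by exact_mod_cast hρ
    linarith
  refine ⟨(c + c) / ((ρ₁ + ρ₂) / 2), fun K => ?_⟩
  obtain ⟨-, -, -, hQi, hNi, hN0, -, hQc⟩ := hQN K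
  rw [le_div_iff₀' hpos]
  have hSi : Integrable (fun ω => ∑ k ∈ Finset.range K, α (k + 1) / weightSum α (k + 1) *
      spread α (fun i => x i ω) k) μ := integrable_finsetSum _ fun k _ => (hDi k).const_mul _
  have hcQ : Integrable (fun ω => c + Q K ω) μ := (integrable_const c).add hQi
  -- Taking expectations removes the martingale term, which has mean zero.
  have h3 := integral_mono_ae (hSi.const_mul ((ρ₁ + ρ₂ : ℝ) / 2)) (hcQ.add hNi) (by
    filter_upwards [hmain, hx] with ω hω hxω using hω hxω K)
  rw [integral_const_mul, integral_finsetSum _ fun k _ => (hDi k).const_mul _] at h3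
  simp only [integral_const_mul] at h3
  refine h3.trans ?_
  change ∫ ω, (c + Q K ω) + N K ω ∂μ ≤ _
  rw [integral_add hcQ hNi, integral_add (integrable_const c) hQi, hN0]
  simp only [integral_const, probReal_univ, one_smul, add_zero]
  linarith

/-- Jensen's inequality for the square root, from the nonnegativity of `E[(√D - m)²]` with `m =
E[√D]`. -/
theorem integral_sqrt_le {D : Θ → ℝ} (hD0 : ∀ ω, 0 ≤ D ω) (hDi : Integrable D μ) :
    Integrable (fun ω => √(D ω)) μ ∧ ∫ ω, √(D ω) ∂μ ≤ √(∫ ω, D ω ∂μ) := by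
  have hi : Integrable (fun ω => √(D ω)) μ := by
    refine Integrable.mono' ((integrable_const 1).add hDi)
      (Real.continuous_sqrt.comp_aestronglyMeasurable hDi.aestronglyMeasurable)
      (Eventually.of_forall fun ω => ?_)
    rw [Real.norm_eq_abs, abs_of_nonneg (Real.sqrt_nonneg _)]
    change _ ≤ 1 + D ω
    nlinarith [Real.sq_sqrt (hD0 ω), sq_nonneg (√(D ω) - 1), Real.sqrt_nonneg (D ω)]
  refine ⟨hi, Real.le_sqrt_of_sq_le ?_⟩
  set m := ∫ ω, √(D ω) ∂μ with hm
  have h1 : 0 ≤ ∫ ω, (D ω - 2 * m * √(D ω)) + m ^ 2 ∂μ := integral_nonneg fun ω => by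
    have := Real.sq_sqrt (hD0 ω)
    change 0 ≤ (D ω - 2 * m * √(D ω)) + m ^ 2
    nlinarith [sq_nonneg (√(D ω) - m)]
  have hi2 : Integrable (fun ω => D ω - 2 * m * √(D ω)) μ := hDi.sub (hi.const_mul _)
  rw [integral_add hi2 (integrable_const _), integral_sub hDi (hi.const_mul _),
    integral_const_mul, ← hm] at h1
  simp only [integral_const, probReal_univ, one_smul] at h1
  nlinarith

theorem expectedDist_rate (hα : AdmissibleWeights α) (hA : BasicAssumption p v)
    {ρ₁ ρ₂ : ℝ≥0} (hρ : 0 < ρ₁ + ρ₂) (h1 : ∀ o, RhoConvex ρ₁ (fun y => (p.h y o : EReal)))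
    (h2 : RhoConvex ρ₂ p.r₂) {a : ℝ} (ha : ∀ y, (a : EReal) ≤ p.f y)
    (hgen : IsGenerated p v α μ x₀ s x z u) {C : Set (EuclideanSpace ℝ (Fin n))}
    (hC : IsCompact C) (hx : ∀ᵐ ω ∂μ, ∀ k, x k ω ∈ C) {L : ℝ≥0}
    (hL : EquiLipschitzGradients p L C v) :
    (∀ k, 1 ≤ k → expectedDist p μ x k < ⊤) ∧
      (fun k => (expectedDist p μ x k).toReal) =O[atTop]
        fun k => 1 / √(∑ i ∈ Finset.range (k + 1), α i / weightSum α i) := by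
  obtain ⟨R, hR⟩ := hC.isBounded.exists_norm_le
  obtain ⟨hDi, c, hc⟩ := exists_sum_integral_spread_le hα hA hρ h1 h2 ha hgen (R := R) (by
    filter_upwards [hx] with ω hω k using hR _ (hω k))
  obtain ⟨K', hK', B, hB⟩ := exists_distToCriticality_control hα.pos hA hgen hR hx hL
  set w : ℕ → ℝ := fun k => α (k + 1) / weightSum α (k + 1) with hw
  have hw0 : ∀ k, 0 < w k := fun k => div_pos (hα.pos _) (weightSum_pos hα.pos _)
  have hr := fun k => one_le_beta hα.pos k
  set d : ℕ → ℝ := fun k => ∫ ω, spread α (fun i => x i ω) k ∂μ with hd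
  have hd0 : ∀ k, 0 ≤ d k := fun k => integral_nonneg fun ω => spread_nonneg hα.pos _ k
  set q : ℕ → ℝ := fun k => L * √(d k) + K' * sampleRate (beta α k) with hq
  have hq0 : ∀ k, 0 ≤ q k := fun k => by
    have := (sampleRate_pos (hr k)).le
    positivity
  have hint : ∀ k, ∫⁻ ω, p.distToCriticality (x (k + 1) ω) ∂μ ≤ ENNReal.ofReal (q k) := by
    intro k
    obtain ⟨hBi, hB0, hBE, hBd⟩ := hB k
    obtain ⟨hsi, hs⟩ := integral_sqrt_le (μ := μ) (D := fun ω => spread α (fun i => x i ω) k)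
      (fun ω => spread_nonneg hα.pos _ k) (hDi k)
    have hsum : Integrable (fun ω => L * √(spread α (fun i => x i ω) k) + B k ω) μ :=
      (hsi.const_mul (L : ℝ)).add hBi
    refine (lintegral_mono_ae hBd).trans ?_
    rw [← ofReal_integral_eq_lintegral_ofReal hsum
      (Eventually.of_forall fun ω => add_nonneg (by positivity) (hB0 ω))]
    refine ENNReal.ofReal_le_ofReal ?_
    rw [integral_add (hsi.const_mul _) hBi, integral_const_mul]
    exact add_le_add (mul_le_mul_of_nonneg_left hs L.2) hBE
  -- `q k` bounds the mean distance at iterate `k + 1`, so `k < K` covers the indices `1, …, K` of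
  -- the minimum.
  have hdist : ∀ K, ∀ k < K, expectedDist p μ x K ≤ ENNReal.ofReal (q k) := fun K k hk =>
    (iInf₂_le (k + 1) (Finset.mem_Icc.2 ⟨by lia, by lia⟩)).trans (hint k)
  have hfin : ∀ k, 1 ≤ k → expectedDist p μ x k < ⊤ := fun k hk =>
    (hdist k 0 (by lia)).trans_lt ENNReal.ofReal_lt_top
  refine ⟨hfin, ?_⟩
  have hreal : ∀ K, ∀ k < K, (expectedDist p μ x K).toReal ≤ q k := fun K k hk =>
    ENNReal.toReal_le_of_le_ofReal (hq0 k) (hdist K k hk)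
  set E : ℝ := ∑' k, w k * sampleRate (beta α k) with hE
  set c' : ℝ := 2 * L ^ 2 * c + 4 * K' ^ 2 * E with hc'
  -- The minimum is at most every `q k`. In `q k ^ 2` the spread part is summable against `w`, and
  -- the sampling part is reduced to first order by `sampleRate ≤ 2`.
  have hsum : ∀ K, (expectedDist p μ x K).toReal ^ 2 * ∑ k ∈ Finset.range K, w k ≤ c' := by
    intro K
    rw [Finset.mul_sum]
    have hstep : ∀ k ∈ Finset.range K, (expectedDist p μ x K).toReal ^ 2 * w k
        ≤ 2 * L ^ 2 * (w k * d k) + 4 * K' ^ 2 * (w k * sampleRate (beta α k)) := by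
      intro k hk
      have b1 := pow_le_pow_left₀ ENNReal.toReal_nonneg (hreal K k (Finset.mem_range.1 hk)) 2
      have b2 : q k ^ 2 ≤ 2 * L ^ 2 * d k + 4 * K' ^ 2 * sampleRate (beta α k) := by
        have b3 := Real.sq_sqrt (hd0 k)
        have b4 := mul_le_mul_of_nonneg_left (sampleRate_sq_le (hr k)) (sq_nonneg K')
        have b5 := sq_nonneg (L * √(d k) - K' * sampleRate (beta α k))
        calc q k ^ 2 ≤ 2 * (L ^ 2 * √(d k) ^ 2) + 2 * (K' ^ 2 * sampleRate (beta α k) ^ 2) := by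
              simp only [hq]; nlinarith
          _ ≤ _ := by rw [b3]; linarith
      have := mul_le_mul_of_nonneg_right (b1.trans b2) (hw0 k).le
      linarith
    refine (Finset.sum_le_sum hstep).trans ?_
    rw [Finset.sum_add_distrib, ← Finset.mul_sum, ← Finset.mul_sum]
    have b1 := hα.summable_sampleRate.sum_le_tsum (Finset.range K) fun k _ =>
      (mul_pos (hw0 k) (sampleRate_pos (hr k))).le
    exact add_le_add (mul_le_mul_of_nonneg_left (hc K) (by positivity))
      (mul_le_mul_of_nonneg_left b1 (by positivity))
  refine Asymptotics.IsBigO.of_bound (√(c' * (1 + 1 / w 0))) ?_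
  filter_upwards [eventually_ge_atTop 1] with K hK
  set S : ℝ := ∑ i ∈ Finset.range (K + 1), α i / weightSum α i with hS
  -- The stated sum has the additional term `α 0 / A 0 = 1`, absorbed for `K ≥ 1` by the factor `1 +
  -- 1 / w 0`.
  have hS1 : S = 1 + ∑ k ∈ Finset.range K, w k := by
    have : α 0 / weightSum α 0 = 1 := by
      have := (hα.pos 0).ne'
      simp [weightSum, this]
    rw [hS, Finset.sum_range_succ', this, add_comm]
  have hw1 : w 0 ≤ ∑ k ∈ Finset.range K, w k :=
    Finset.single_le_sum (f := w) (fun k _ => (hw0 k).le) (Finset.mem_range.2 (by lia))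
  have hSpos : 0 < S := by rw [hS1]; linarith [hw0 0]
  have hSle : S ≤ (1 + 1 / w 0) * ∑ k ∈ Finset.range K, w k := by
    rw [hS1, add_mul, one_mul, add_comm]
    refine add_le_add le_rfl ?_
    rw [one_div, ← div_eq_inv_mul, one_le_div (hw0 0)]
    exact hw1
  have hcoef : 0 ≤ 1 + 1 / w 0 := by have := hw0 0; positivity
  have hfinal : (expectedDist p μ x K).toReal ^ 2 * S ≤ c' * (1 + 1 / w 0) := by
    have b1 := mul_le_mul_of_nonneg_left hSle (sq_nonneg (expectedDist p μ x K).toReal)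
    have b2 := mul_le_mul_of_nonneg_right (hsum K) hcoef
    linarith
  rw [Real.norm_eq_abs, abs_of_nonneg ENNReal.toReal_nonneg, Real.norm_eq_abs,
    abs_of_nonneg (by positivity), mul_one_div, le_div_iff₀ (Real.sqrt_pos.2 hSpos)]
  refine Real.le_sqrt_of_sq_le ?_
  rw [mul_pow, Real.sq_sqrt hSpos.le]
  exact hfinal

theorem isBigO_one_div_sqrt_log (hα : ∀ k, α k = 1) :
    (fun k => 1 / √(∑ i ∈ Finset.range (k + 1), α i / weightSum α i)) =O[atTop]
      fun k : ℕ => 1 / √(Real.log k) := by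
  refine Asymptotics.IsBigO.of_bound 1 ?_
  filter_upwards [eventually_ge_atTop 2] with k hk
  have hlog : 0 < Real.log k := Real.log_pos (by exact_mod_cast hk)
  have hA : ∀ i, weightSum α i = i + 1 := fun i => by simp [weightSum, hα]
  have hS : Real.log k ≤ ∑ i ∈ Finset.range (k + 1), α i / weightSum α i := by
    have h1 := log_add_one_le_harmonic (k + 1)
    have h2 : ((harmonic (k + 1) : ℚ) : ℝ) = ∑ i ∈ Finset.range (k + 1), α i / weightSum α i := by
      simp [harmonic, hA, hα]
    rw [← h2]
    refine le_trans (Real.log_le_log (by positivity) ?_) h1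
    push_cast
    linarith
  rw [one_mul, Real.norm_eq_abs, Real.norm_eq_abs, abs_of_nonneg (by positivity),
    abs_of_nonneg (by positivity)]
  have := Real.sqrt_pos.2 hlog
  gcongr

end Rate

end SDCA

/-! ### Assembly of the theorem -/

theorem mainTheorem1 {n : ℕ} {Ω : Type*} [MeasurableSpace Ω] (P : Measure Ω)
    [IsProbabilityMeasure P] (p : Program n P) (v : Variant)
    (α : ℕ → ℝ) (hα : AdmissibleWeights α)
    (hA : BasicAssumption p v)
    (hρ : 0 < (⨅ s : Ω, strongConvexityModulus (fun y => (p.h y s : EReal)))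
      + strongConvexityModulus p.r₂)
    (hopt : ∃ a : ℝ, ⨅ y, p.f y = (a : EReal))
    {Θ : Type*} [MeasurableSpace Θ] (μ : Measure Θ) [IsProbabilityMeasure μ]
    (x₀ : EuclideanSpace ℝ (Fin n)) (s : ℕ → Θ → Ω)
    (x z u : ℕ → Θ → EuclideanSpace ℝ (Fin n))
    (hgen : IsGenerated p v α μ x₀ s x z u)
    (hx : ∀ᵐ ω ∂μ, limsup (fun k => ‖x k ω‖ₑ) atTop < ⊤)
    (hu : ∀ᵐ ω ∂μ, limsup (fun k => ‖u k ω‖ₑ) atTop < ⊤) :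
    -- (i) a subsequence, the same for all outcomes, whose limit points are critical
    (∃ l : ℕ → ℕ, StrictMono l ∧
      ∀ᵐ ω ∂μ, ∀ y, MapClusterPt y atTop (fun k => x (l k) ω) → p.IsCritical y) ∧
    -- (ii) the rate, in general and for constant weights
    (∀ C : Set (EuclideanSpace ℝ (Fin n)), IsCompact C → (∀ᵐ ω ∂μ, ∀ k, x k ω ∈ C) →
      ∀ L : ℝ≥0, EquiLipschitzGradients p L C v →
        (∀ k, 1 ≤ k → expectedDist p μ x k < ⊤) ∧
        ((fun k => (expectedDist p μ x k).toReal) =O[atTop]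
          fun k => 1 / √(∑ i ∈ Finset.range (k + 1), α i / weightSum α i)) ∧
        ((∀ k, α k = 1) →
          (fun k => (expectedDist p μ x k).toReal) =O[atTop]
            fun k : ℕ => 1 / √(Real.log k))) := by
  obtain ⟨a, ha⟩ := hopt
  have ha' : ∀ y, (a : EReal) ≤ p.f y := fun y => ha ▸ iInf_le _ y
  -- Only one modulus needs to be positive: a finite positive constant is taken below it, and plain
  -- convexity is used for the other part.
  obtain ⟨ρ₁, ρ₂, hρ', h1, h2⟩ : ∃ ρ₁ ρ₂ : ℝ≥0, 0 < ρ₁ + ρ₂ ∧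
      (∀ o, RhoConvex ρ₁ (fun y => (p.h y o : EReal))) ∧ RhoConvex ρ₂ p.r₂ := by
    rcases add_pos_iff.1 hρ with h | h
    · obtain ⟨c, hc0, hc⟩ := ENNReal.lt_iff_exists_nnreal_btwn.1 h
      exact ⟨c, 0, by simpa using hc0, fun o =>
        exists_rhoConvex_of_lt_modulus (hc.trans_le (iInf_le _ o)), p.r₂_convex⟩
    · obtain ⟨c, hc0, hc⟩ := ENNReal.lt_iff_exists_nnreal_btwn.1 h
      exact ⟨0, c, by simpa using hc0, fun o => rhoConvex_zero_of_convexOn (p.h_convex o),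
        exists_rhoConvex_of_lt_modulus hc⟩
  have hxb : ∀ᵐ ω ∂μ, ∃ R : ℕ, ∀ k, ‖x k ω‖ ≤ R := hx.mono fun ω => exists_norm_le_of_limsup
  refine ⟨?_, fun C hC hxC L hL => ?_⟩
  · obtain ⟨k, hk, hlim⟩ := exists_subsequence hα hA hgen
      (ae_summable_spread hα hA hρ' h1 h2 ha' hgen hxb)
    -- The spread at step `k` is centred at `x (k+1)`, hence the shift.
    refine ⟨fun j => k j + 1, fun i j hij => Nat.succ_lt_succ (hk hij), ?_⟩
    filter_upwards [hgen.ae_isPath, hlim, hxb, hu] with ω hω hlimω ⟨R, hR⟩ huω y hy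
    obtain ⟨U, hU⟩ := exists_norm_le_of_limsup huω
    exact hω.isCritical hα.pos hA hlimω.1 hlimω.2 hR hU hy
  · obtain ⟨hfin, hrate⟩ := expectedDist_rate hα hA hρ' h1 h2 ha' hgen hC hxC hL
    exact ⟨hfin, hrate, fun hone => hrate.trans (isBigO_one_div_sqrt_log hone)⟩
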